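/- Let $R$ be a commutative noetherian ring, let $t\in R$, and assume that $R$ is $tR$-adically complete (in particular separated). Complexes are indexed homologically. Let $A$ be a commutative DG $R$-algebra, i.e. an $R$-complex with $A_i=0$ for $i<0$ and with an associative, unital product that satisfies the Leibniz rule, such that $ab=(-1)^{|a||b|}ba$ and $a^2=0$ when $|a|$ is odd. Assume that each $A_i$ is a free $R$-module of finite rank. Let $K=K^R(t)$ be the Koszul complex $0\to Re\xrightarrow{\,e\mapsto t\,}R\to 0$, considered as a DG $R$-algebra, and let $B=K\otimes_R A$ be the tensor product DG $R$-algebra, with the morphism $A\to B$, $a\mapsto 1\otimes a$. Let $D$ be a DG $B$-module such that $\operatorname{H}_i(D)=0$ for all $i\ll 0$ and such that $\operatorname{H}_i(D)$ is a finitely generated $\operatorname{H}_0(B)$-module for every $i$. If $\operatorname{Ext}^2_B(D,D)=0$, then $D$ is quasi-liftable to $A$: there is a semi-free DG $A$-module $D'$ such that $D\simeq B\otimes_A D'$ as DG $B$-modules. Here $\simeq$ means being connected by a finite zigzag of quasiisomorphisms of DG modules. A semi-free DG module is one that is bounded below (zero in all degrees $i\ll 0$) and whose underlying graded module has a homogeneous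 basis over the underlying graded algebra. Finally, $\operatorname{Ext}^i_B(M,N)=\operatorname{H}_{-i}(\operatorname{Hom}_B(F,N))$ for a semi-free resolution $F\xrightarrow{\simeq}M$. -/

import Mathlib

open scoped DirectSum TensorProduct

namespace DG

universe u

theorem map_sign {R : Type*} [CommRing R] {M N : Type*} [AddCommGroup M] [AddCommGroup N]
    [Module R M] [Module R N] (f : M →ₗ[R] N) (s : ℤˣ) (x : M) : f (s • x) = s • f x := by
  rw [Units.smul_def, map_zsmul, Units.smul_def]

theorem map_sign₂ {R : Type*} [CommRing R] {M N P : Type*} [AddCommGroup M] [AddCommGroup N]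
    [AddCommGroup P] [Module R M] [Module R N] [Module R P] (f : M →ₗ[R] N →ₗ[R] P) (s : ℤˣ)
    (x : M) (y : N) : f (s • x) y = s • f x y :=
  map_sign (f.flip y) s x

/-- A complex of `R`-modules, indexed homologically by `ℤ`. The differential `X i → X j` is
available for every pair of indices with `j + 1 = i`, so that no transport along equalities of
indices is needed. -/
structure Cx (R : Type u) [CommRing R] where
  X : ℤ → Type u
  [addCommGroup : ∀ i, AddCommGroup (X i)]
  [module : ∀ i, Module R (X i)]
  d : ∀ i j : ℤ, j + 1 = i → X i →ₗ[R] X j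
  d_d : ∀ (i j k : ℤ) (hj : j + 1 = i) (hk : k + 1 = j) (x : X i), d j k hk (d i j hj x) = 0

attribute [instance] Cx.addCommGroup Cx.module

section Complexes

variable {R : Type u} [CommRing R]

namespace Cx

/-- The cycles of degree `i`. -/
def cycles (C : Cx R) (i : ℤ) : Submodule R (C.X i) :=
  LinearMap.ker (C.d i (i - 1) (by omega))

/-- The boundaries of degree `i`. -/
def boundaries (C : Cx R) (i : ℤ) : Submodule R (C.X i) :=
  LinearMap.range (C.d (i + 1) i rfl)

/-- The homology module `H_i(C)`, cycles modulo boundaries. -/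
abbrev homology (C : Cx R) (i : ℤ) : Type u :=
  C.cycles i ⧸ (C.boundaries i).submoduleOf (C.cycles i)

/-- `C_i = 0` for `i ≪ 0`. -/
def IsBoundedBelow (C : Cx R) : Prop :=
  ∃ b : ℤ, ∀ i < b, Subsingleton (C.X i)

/-- `H_i(C) = 0` for `i ≪ 0`. -/
def IsHomologicallyBoundedBelow (C : Cx R) : Prop :=
  ∃ b : ℤ, ∀ i < b, Subsingleton (C.homology i)

theorem mem_cycles (C : Cx R) {i j : ℤ} (h : j + 1 = i) (x : C.X i) :
    x ∈ C.cycles i ↔ C.d i j h x = 0 := by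
  obtain rfl : j = i - 1 := by omega
  exact LinearMap.mem_ker

theorem d_mem_boundaries (C : Cx R) {i j : ℤ} (h : j + 1 = i) (x : C.X i) :
    C.d i j h x ∈ C.boundaries j := by
  subst h
  exact ⟨x, rfl⟩

/-- The module of degree `n` of the tensor product complex:
the direct sum of all `C_i ⊗ E_j` with `i + j = n`. -/
abbrev TensorX (C E : Cx R) (n : ℤ) : Type u :=
  ⨁ p : {p : ℤ × ℤ // p.1 + p.2 = n}, C.X p.1.1 ⊗[R] E.X p.1.2

/-- The pure tensor `x ⊗ y` of degree `n`, for `x` of degree `i`, `y` of degree `j`, `i + j = n`. -/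
def tmk (C E : Cx R) (i j n : ℤ) (h : i + j = n) : C.X i →ₗ[R] E.X j →ₗ[R] TensorX C E n :=
  (TensorProduct.mk R (C.X i) (E.X j)).compr₂
    (DirectSum.lof R {p : ℤ × ℤ // p.1 + p.2 = n} (fun p => C.X p.1.1 ⊗[R] E.X p.1.2) ⟨(i, j), h⟩)

/-- The linear map out of the degree `n` part of `C ⊗ E` given by a family of bilinear maps. -/
def tlift (C E : Cx R) (n : ℤ) {Z : Type*} [AddCommGroup Z] [Module R Z]
    (φ : ∀ i j : ℤ, i + j = n → C.X i →ₗ[R] E.X j →ₗ[R] Z) : TensorX C E n →ₗ[R] Z :=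
  DirectSum.toModule R _ Z fun p => TensorProduct.lift (φ p.1.1 p.1.2 p.2)

@[simp]
theorem tlift_tmk (C E : Cx R) (n : ℤ) {Z : Type*} [AddCommGroup Z] [Module R Z]
    (φ : ∀ i j : ℤ, i + j = n → C.X i →ₗ[R] E.X j →ₗ[R] Z) (i j : ℤ) (h : i + j = n)
    (x : C.X i) (y : E.X j) : tlift C E n φ (tmk C E i j n h x y) = φ i j h x y := by
  simp [tlift, tmk, DirectSum.toModule_lof]

theorem tensor_induction {C E : Cx R} {n : ℤ} {P : TensorX C E n → Prop} (z : TensorX C E n)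
    (h0 : P 0) (hadd : ∀ x y, P x → P y → P (x + y))
    (hmk : ∀ (i j : ℤ) (h : i + j = n) (x : C.X i) (y : E.X j), P (tmk C E i j n h x y)) :
    P z := by
  induction z using DirectSum.induction_on with
  | zero => exact h0
  | of p w =>
    induction w using TensorProduct.induction_on with
    | zero => simpa using h0
    | tmul x y => exact hmk p.1.1 p.1.2 p.2 x y
    | add x y hx hy => rw [map_add]; exact hadd _ _ hx hy
  | add x y hx hy => exact hadd _ _ hx hy

theorem tensor_ext {C E : Cx R} {n : ℤ} {Z : Type*} [AddCommGroup Z] [Module R Z]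
    {f g : TensorX C E n →ₗ[R] Z}
    (h : ∀ (i j : ℤ) (hij : i + j = n) (x : C.X i) (y : E.X j),
      f (tmk C E i j n hij x y) = g (tmk C E i j n hij x y)) : f = g := by
  ext1 p
  ext x y
  exact h p.1.1 p.1.2 p.2 x y

/-- The tensor product `C ⊗ E` of complexes, `d (x ⊗ y) = d x ⊗ y + (-1)^|x| x ⊗ d y`. -/
def tensorD (C E : Cx R) (n m : ℤ) (h : m + 1 = n) : TensorX C E n →ₗ[R] TensorX C E m :=
  tlift C E n fun i j hij =>
    (tmk C E (i - 1) j m (by omega)).comp (C.d i (i - 1) (by omega)) +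
      i.negOnePow • (tmk C E i (j - 1) m (by omega)).compl₂ (E.d j (j - 1) (by omega))

theorem tensorD_tmk (C E : Cx R) {n m i j i' j' : ℤ} (h : m + 1 = n) (hij : i + j = n)
    (hi : i' + 1 = i) (hj : j' + 1 = j) (x : C.X i) (y : E.X j) :
    tensorD C E n m h (tmk C E i j n hij x y) =
      tmk C E i' j m (by omega) (C.d i i' hi x) y +
        i.negOnePow • tmk C E i j' m (by omega) x (E.d j j' hj y) := by
  obtain rfl : i' = i - 1 := by omega
  obtain rfl : j' = j - 1 := by omega
  simp [tensorD]

/-- The tensor product `C ⊗ E` of complexes. -/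
def tensor (C E : Cx R) : Cx R where
  X := TensorX C E
  d := tensorD C E
  d_d := by
    intro n m l hm hl z
    induction z using tensor_induction with
    | h0 => simp
    | hadd x y hx hy => simp [hx, hy]
    | hmk i j h x y =>
      have e : (i - 1).negOnePow = - i.negOnePow := by
        rw [Int.negOnePow_sub, Int.negOnePow_one]; simp
      rw [tensorD_tmk C E hm h (sub_add_cancel i 1) (sub_add_cancel j 1), map_add,
        Units.smul_def, map_zsmul, ← Units.smul_def,
        tensorD_tmk C E hl _ (sub_add_cancel (i - 1) 1) (sub_add_cancel j 1),
        tensorD_tmk C E hl _ (sub_add_cancel i 1) (sub_add_cancel (j - 1) 1)]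
      simp [C.d_d, E.d_d, e]

end Cx

end Complexes

/-- A commutative DG `R`-algebra: a complex with an associative, unital, graded commutative product
satisfying the Leibniz rule, with zero squares in odd degrees, concentrated in degrees `≥ 0`.
The product `X i × X j → X k` is available for every triple with `i + j = k`. -/
structure DGAlg (R : Type u) [CommRing R] extends Cx R where
  mul : ∀ i j k : ℤ, i + j = k → X i →ₗ[R] X j →ₗ[R] X k
  one : X 0
  mul_assoc : ∀ (i j k ij jk n : ℤ) (hij : i + j = ij) (hjk : j + k = jk) (h₁ : ij + k = n)
    (h₂ : i + jk = n) (x : X i) (y : X j) (z : X k),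
    mul ij k n h₁ (mul i j ij hij x y) z = mul i jk n h₂ x (mul j k jk hjk y z)
  one_mul : ∀ (i : ℤ) (x : X i), mul 0 i i (zero_add i) one x = x
  mul_comm : ∀ (i j k : ℤ) (h : i + j = k) (h' : j + i = k) (x : X i) (y : X j),
    mul i j k h x y = (i * j).negOnePow • mul j i k h' y x
  mul_self : ∀ (i k : ℤ) (h : i + i = k), Odd i → ∀ x : X i, mul i i k h x x = 0
  leibniz : ∀ (i j k i' j' k' : ℤ) (h : i + j = k) (hi : i' + 1 = i) (hj : j' + 1 = j)
    (hk : k' + 1 = k) (h₁ : i' + j = k') (h₂ : i + j' = k') (x : X i) (y : X j),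
    d k k' hk (mul i j k h x y) =
      mul i' j k' h₁ (d i i' hi x) y + i.negOnePow • mul i j' k' h₂ x (d j j' hj y)
  subsingleton_of_neg : ∀ i < 0, Subsingleton (X i)

/-- A DG module over the DG `R`-algebra `A`: a complex with an associative and unital
scalar multiplication satisfying the Leibniz rule. -/
structure DGMod {R : Type u} [CommRing R] (A : DGAlg R) extends Cx R where
  smul : ∀ i j k : ℤ, i + j = k → A.X i →ₗ[R] X j →ₗ[R] X k
  mul_smul : ∀ (i j k ij jk n : ℤ) (hij : i + j = ij) (hjk : j + k = jk) (h₁ : ij + k = n)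
    (h₂ : i + jk = n) (a : A.X i) (b : A.X j) (x : X k),
    smul ij k n h₁ (A.mul i j ij hij a b) x = smul i jk n h₂ a (smul j k jk hjk b x)
  one_smul : ∀ (i : ℤ) (x : X i), smul 0 i i (zero_add i) A.one x = x
  leibniz : ∀ (i j k i' j' k' : ℤ) (h : i + j = k) (hi : i' + 1 = i) (hj : j' + 1 = j)
    (hk : k' + 1 = k) (h₁ : i' + j = k') (h₂ : i + j' = k') (a : A.X i) (x : X j),
    d k k' hk (smul i j k h a x) =
      smul i' j k' h₁ (A.d i i' hi a) x + i.negOnePow • smul i j' k' h₂ a (d j j' hj x)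

section Algebras

variable {R : Type u} [CommRing R]

/-- A morphism of DG `R`-algebras: a chain map preserving products and the unit. -/
structure DGAlg.Hom (A B : DGAlg R) where
  app : ∀ i : ℤ, A.X i →ₗ[R] B.X i
  map_d : ∀ (i j : ℤ) (h : j + 1 = i) (x : A.X i), app j (A.d i j h x) = B.d i j h (app i x)
  map_mul : ∀ (i j k : ℤ) (h : i + j = k) (x : A.X i) (y : A.X j),
    app k (A.mul i j k h x y) = B.mul i j k h (app i x) (app j y)
  map_one : app 0 A.one = B.one

namespace DGAlg

/-- The degree `i` part of the Koszul complex on one element: `R` for `i = 0` (with basis `1`) and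
for `i = 1` (with basis `e`), and `0` otherwise. -/
def koszulX (R : Type u) [CommRing R] (i : ℤ) : Submodule R R where
  carrier := {r | i ≠ 0 → i ≠ 1 → r = 0}
  add_mem' := by
    intro a b ha hb h0 h1
    rw [ha h0 h1, hb h0 h1, add_zero]
  zero_mem' := fun _ _ => rfl
  smul_mem' := by
    intro c x hx h0 h1
    rw [hx h0 h1, smul_zero]

/-- The differential of the Koszul complex, `d e = t`. -/
def koszulD (t : R) (i j : ℤ) (h : j + 1 = i) : koszulX R i →ₗ[R] koszulX R j where
  toFun x := ⟨if i = 1 then t * x.1 else 0, by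
    intro h0 _
    rw [if_neg (by omega)]⟩
  map_add' x y := by
    ext
    by_cases hi : i = 1 <;> simp [hi, mul_add]
  map_smul' c x := by
    ext
    by_cases hi : i = 1 <;> simp [hi, mul_left_comm]

/-- The product of the Koszul complex: the coefficient of a product of total degree `0` or `1` is
the product of the coefficients, and `e * e = 0`. -/
def koszulMul (R : Type u) [CommRing R] (i j k : ℤ) (_ : i + j = k) :
    koszulX R i →ₗ[R] koszulX R j →ₗ[R] koszulX R k :=
  LinearMap.mk₂ R
    (fun x y => (⟨if k = 0 ∨ k = 1 then x.1 * y.1 else 0, by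
      intro h0 h1
      rw [if_neg (by omega)]⟩ : koszulX R k))
    (by intro x x' y; ext; by_cases hk : k = 0 ∨ k = 1 <;> simp [hk, add_mul])
    (by intro c x y; ext; by_cases hk : k = 0 ∨ k = 1 <;> simp [hk, _root_.mul_assoc])
    (by intro x y y'; ext; by_cases hk : k = 0 ∨ k = 1 <;> simp [hk, mul_add])
    (by intro c x y; ext; by_cases hk : k = 0 ∨ k = 1 <;> simp [hk, mul_left_comm])

theorem coe_koszulD (t : R) (i j : ℤ) (h : j + 1 = i) (x : koszulX R i) :
    (koszulD t i j h x : R) = if i = 1 then t * x else 0 := rfl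

theorem coe_koszulMul (i j k : ℤ) (h : i + j = k) (x : koszulX R i) (y : koszulX R j) :
    (koszulMul R i j k h x y : R) = if k = 0 ∨ k = 1 then (x : R) * y else 0 := rfl

theorem coe_koszul_sign (i k : ℤ) (x : koszulX R k) :
    ((i.negOnePow • x : koszulX R k) : R) = i.negOnePow • (x : R) := rfl

/-- The Koszul complex `K^R(t) = (0 → R e → R 1 → 0)` with `d e = t`, as a DG algebra. -/
def koszul (t : R) : DGAlg R where
  X i := koszulX R i
  d := koszulD t
  d_d := by
    intro i j k hj hk x
    ext
    rw [coe_koszulD, coe_koszulD]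
    by_cases h1 : j = 1
    · rw [if_pos h1, if_neg (by omega), mul_zero]
      rfl
    · rw [if_neg h1]
      rfl
  mul := koszulMul R
  one := ⟨1, fun h _ => absurd rfl h⟩
  mul_assoc := by
    intro i j k ij jk n hij hjk h₁ h₂ x y z
    ext
    simp only [coe_koszulMul]
    by_cases hi : i = 0 ∨ i = 1
    swap
    · simp [x.2 (by tauto) (by tauto)]
    by_cases hj : j = 0 ∨ j = 1
    swap
    · simp [y.2 (by tauto) (by tauto)]
    by_cases hk : k = 0 ∨ k = 1
    swap
    · simp [z.2 (by tauto) (by tauto)]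
    by_cases hn : n = 0 ∨ n = 1
    · rw [if_pos hn, if_pos hn, if_pos (by omega), if_pos (by omega), _root_.mul_assoc]
    · rw [if_neg hn, if_neg hn]
  one_mul := by
    intro i x
    ext
    simp only [coe_koszulMul]
    by_cases hi : i = 0 ∨ i = 1
    · simp [hi]
    · simp [hi, x.2 (by tauto) (by tauto)]
  mul_comm := by
    intro i j k h h' x y
    ext
    simp only [coe_koszulMul, coe_koszul_sign]
    by_cases hi : i = 0 ∨ i = 1
    swap
    · simp [x.2 (by tauto) (by tauto)]
    by_cases hj : j = 0 ∨ j = 1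
    swap
    · simp [y.2 (by tauto) (by tauto)]
    by_cases hk : k = 0 ∨ k = 1
    · have : i * j = 0 := by
        rcases hi with rfl | rfl <;> rcases hj with rfl | rfl <;> simp
        omega
      simp [this, hk, _root_.mul_comm]
    · simp [hk]
  mul_self := by
    intro i k h hi x
    ext
    rw [coe_koszulMul, if_neg]
    · rfl
    · rcases hi with ⟨c, rfl⟩
      omega
  leibniz := by
    intro i j k i' j' k' h hi hj hk h₁ h₂ x y
    ext
    simp only [coe_koszulMul, coe_koszul_sign, coe_koszulD, Submodule.coe_add]
    by_cases ci : i = 0 ∨ i = 1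
    swap
    · simp [x.2 (by tauto) (by tauto)]
    by_cases cj : j = 0 ∨ j = 1
    swap
    · simp [y.2 (by tauto) (by tauto)]
    subst h
    obtain rfl : k' = i + j - 1 := by omega
    rcases ci with rfl | rfl <;> rcases cj with rfl | rfl <;>
      simp [_root_.mul_assoc, mul_left_comm]
  subsingleton_of_neg := by
    intro i hi
    refine ⟨fun x y => ?_⟩
    ext
    rw [x.2 (by omega) (by omega), y.2 (by omega) (by omega)]

/-- The product of the tensor product of two DG algebras,
`(x ⊗ a) (x' ⊗ a') = (-1)^(|a| |x'|) (x x') ⊗ (a a')`. -/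
def tensorMul (A B : DGAlg R) (n n' m : ℤ) (h : n + n' = m) :
    Cx.TensorX A.toCx B.toCx n →ₗ[R] Cx.TensorX A.toCx B.toCx n' →ₗ[R]
      Cx.TensorX A.toCx B.toCx m :=
  Cx.tlift _ _ n fun i j hij => LinearMap.mk₂ R
    (fun x a => Cx.tlift _ _ n' fun i' j' hij' => (j * i').negOnePow •
      (Cx.tmk A.toCx B.toCx (i + i') (j + j') m (by omega)).compl₁₂
        (A.mul i i' (i + i') rfl x) (B.mul j j' (j + j') rfl a))
    (by intro x x' a; refine Cx.tensor_ext fun i' j' hij' y b => ?_; simp)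
    (by intro c x a; refine Cx.tensor_ext fun i' j' hij' y b => ?_; simp [smul_comm c])
    (by intro x a a'; refine Cx.tensor_ext fun i' j' hij' y b => ?_; simp)
    (by intro c x a; refine Cx.tensor_ext fun i' j' hij' y b => ?_; simp [smul_comm c])

theorem tensorMul_tmk (A B : DGAlg R) {n n' m i j i' j' p q : ℤ} (h : n + n' = m)
    (hij : i + j = n) (hij' : i' + j' = n') (hp : i + i' = p) (hq : j + j' = q)
    (x : A.X i) (a : B.X j) (x' : A.X i') (a' : B.X j') :
    tensorMul A B n n' m h (Cx.tmk _ _ i j n hij x a) (Cx.tmk _ _ i' j' n' hij' x' a') =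
      (j * i').negOnePow • Cx.tmk _ _ p q m (by omega) (A.mul i i' p hp x x')
        (B.mul j j' q hq a a') := by
  subst hp hq
  simp [tensorMul]

theorem tensorMul_assoc (A B : DGAlg R) (n n' n'' nn nn' m : ℤ) (h : n + n' = nn)
    (h' : n' + n'' = nn') (h₁ : nn + n'' = m) (h₂ : n + nn' = m)
    (z : Cx.TensorX A.toCx B.toCx n) (z' : Cx.TensorX A.toCx B.toCx n')
    (z'' : Cx.TensorX A.toCx B.toCx n'') :
    tensorMul A B nn n'' m h₁ (tensorMul A B n n' nn h z z') z'' =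
      tensorMul A B n nn' m h₂ z (tensorMul A B n' n'' nn' h' z' z'') := by
  induction z using Cx.tensor_induction with
  | h0 => simp
  | hadd x y hx hy => simp [hx, hy]
  | hmk i j hij x a =>
  induction z' using Cx.tensor_induction with
  | h0 => simp
  | hadd x y hx hy => simp [hx, hy]
  | hmk i' j' hij' x' a' =>
  induction z'' using Cx.tensor_induction with
  | h0 => simp
  | hadd x y hx hy => simp [hx, hy]
  | hmk i'' j'' hij'' x'' a'' =>
  rw [tensorMul_tmk A B h hij hij' rfl rfl, tensorMul_tmk A B h' hij' hij'' rfl rfl,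
    map_sign₂, map_sign,
    tensorMul_tmk A B h₁ _ hij'' (add_assoc i i' i'') (add_assoc j j' j''),
    tensorMul_tmk A B h₂ hij _ rfl rfl,
    A.mul_assoc i i' i'' _ _ _ rfl rfl _ rfl, B.mul_assoc j j' j'' _ _ _ rfl rfl _ rfl,
    smul_smul, smul_smul, ← Int.negOnePow_add, ← Int.negOnePow_add]
  congr 2
  ring

theorem tensorMul_one (A B : DGAlg R) (n : ℤ) (z : Cx.TensorX A.toCx B.toCx n) :
    tensorMul A B 0 n n (zero_add n) (Cx.tmk _ _ 0 0 0 rfl A.one B.one) z = z := by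
  induction z using Cx.tensor_induction with
  | h0 => simp
  | hadd x y hx hy => simp [hx, hy]
  | hmk i j hij x a =>
    rw [tensorMul_tmk A B _ _ hij (zero_add i) (zero_add j), A.one_mul, B.one_mul]
    simp

theorem tensorMul_comm (A B : DGAlg R) (n n' m : ℤ) (h : n + n' = m) (h' : n' + n = m)
    (z : Cx.TensorX A.toCx B.toCx n) (z' : Cx.TensorX A.toCx B.toCx n') :
    tensorMul A B n n' m h z z' = (n * n').negOnePow • tensorMul A B n' n m h' z' z := by
  induction z using Cx.tensor_induction with
  | h0 => simp
  | hadd x y hx hy => simp [hx, hy]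
  | hmk i j hij x a =>
  induction z' using Cx.tensor_induction with
  | h0 => simp
  | hadd x y hx hy => simp [hx, hy]
  | hmk i' j' hij' x' a' =>
  rw [tensorMul_tmk A B h hij hij' rfl rfl,
    tensorMul_tmk A B h' hij' hij (add_comm i' i) (add_comm j' j),
    A.mul_comm i i' _ rfl (add_comm i' i), B.mul_comm j j' _ rfl (add_comm j' j),
    map_sign, map_sign₂, smul_smul, smul_smul, smul_smul,
    ← Int.negOnePow_add, ← Int.negOnePow_add, ← Int.negOnePow_add]
  congr 1
  rw [Int.negOnePow_eq_iff]
  subst hij hij'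
  exact ⟨-(i * j'), by ring⟩

theorem tensorMul_self (A B : DGAlg R) (n m : ℤ) (h : n + n = m) (hn : Odd n)
    (z : Cx.TensorX A.toCx B.toCx n) : tensorMul A B n n m h z z = 0 := by
  induction z using Cx.tensor_induction with
  | h0 => simp
  | hadd x y hx hy =>
    have hc : tensorMul A B n n m h x y = - tensorMul A B n n m h y x := by
      rw [tensorMul_comm A B n n m h h x y, Int.negOnePow_odd _ (hn.mul hn)]
      simp
    simp [hx, hy, hc]
  | hmk i j hij x a =>
    rw [tensorMul_tmk A B h hij hij rfl rfl]
    rcases Int.even_or_odd i with hi | hi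
    · have hj : Odd j := by
        rw [← hij] at hn
        exact (Int.odd_add'.mp hn).mpr hi
      simp [B.mul_self j _ rfl hj]
    · simp [A.mul_self i _ rfl hi]

theorem tensorMul_leibniz (A B : DGAlg R) (i j k i' j' k' : ℤ) (h : i + j = k) (hi : i' + 1 = i)
    (hj : j' + 1 = j) (hk : k' + 1 = k) (h₁ : i' + j = k') (h₂ : i + j' = k')
    (x : Cx.TensorX A.toCx B.toCx i) (y : Cx.TensorX A.toCx B.toCx j) :
    Cx.tensorD A.toCx B.toCx k k' hk (tensorMul A B i j k h x y) =
      tensorMul A B i' j k' h₁ (Cx.tensorD A.toCx B.toCx i i' hi x) y +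
        i.negOnePow • tensorMul A B i j' k' h₂ x (Cx.tensorD A.toCx B.toCx j j' hj y) := by
  induction x using Cx.tensor_induction with
  | h0 => simp
  | hadd x y hx hy =>
    simp only [map_add, LinearMap.add_apply, hx, hy, smul_add]
    abel
  | hmk p q hpq x a =>
  induction y using Cx.tensor_induction with
  | h0 => simp
  | hadd x y hx hy =>
    simp only [map_add, hx, hy, smul_add]
    abel
  | hmk r s hrs y b =>
  have e₁ : p - 1 + r + 1 = p + r := by ring
  have e₂ : q - 1 + s + 1 = q + s := by ring
  rw [tensorMul_tmk A B h hpq hrs rfl rfl, map_sign, Cx.tensorD_tmk _ _ hk _ e₁ e₂,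
    Cx.tensorD_tmk _ _ hi hpq (sub_add_cancel p 1) (sub_add_cancel q 1),
    Cx.tensorD_tmk _ _ hj hrs (sub_add_cancel r 1) (sub_add_cancel s 1),
    A.leibniz p r _ (p - 1) (r - 1) _ rfl (sub_add_cancel p 1) (sub_add_cancel r 1) e₁ rfl
      (by ring),
    B.leibniz q s _ (q - 1) (s - 1) _ rfl (sub_add_cancel q 1) (sub_add_cancel s 1) e₂ rfl
      (by ring)]
  simp only [map_add, map_sign, map_sign₂, LinearMap.add_apply, smul_add, smul_smul]
  rw [tensorMul_tmk A B _ _ hrs (p := p - 1 + r) (q := q + s) rfl rfl,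
    tensorMul_tmk A B _ _ hrs (p := p + r) (q := q - 1 + s) rfl rfl,
    tensorMul_tmk A B _ hpq _ (p := p - 1 + r) (q := q + s) (by ring) rfl,
    tensorMul_tmk A B _ hpq _ (p := p + r) (q := q - 1 + s) rfl (by ring)]
  simp only [smul_smul, ← Int.negOnePow_add]
  have s₁ : (q * r + (p + r)).negOnePow = (p + (q - 1) * r).negOnePow := by
    rw [Int.negOnePow_eq_iff]
    exact ⟨r, by ring⟩
  have s₂ : (q * r + p).negOnePow = (i + q * (r - 1)).negOnePow := by
    rw [← hpq, Int.negOnePow_eq_iff]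
    exact ⟨0, by ring⟩
  have s₃ : (q * r + (p + r + q)).negOnePow = (i + r + q * r).negOnePow := by
    rw [← hpq]
    congr 1
    ring
  rw [s₁, s₂, s₃]
  abel

/-- The tensor product of two DG algebras. -/
def tensor (A B : DGAlg R) : DGAlg R where
  toCx := Cx.tensor A.toCx B.toCx
  mul := tensorMul A B
  one := Cx.tmk _ _ 0 0 0 rfl A.one B.one
  mul_assoc := tensorMul_assoc A B
  one_mul := tensorMul_one A B
  mul_comm := tensorMul_comm A B
  mul_self := fun n m h hn z => tensorMul_self A B n m h hn z
  leibniz := tensorMul_leibniz A B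
  subsingleton_of_neg := by
    intro n hn
    refine ⟨fun z w => ?_⟩
    have key : ∀ z : Cx.TensorX A.toCx B.toCx n, z = 0 := by
      intro z
      induction z using Cx.tensor_induction with
      | h0 => rfl
      | hadd x y hx hy => rw [hx, hy, add_zero]
      | hmk i j hij x a =>
        rcases lt_or_ge i 0 with hi | hi
        · have := A.subsingleton_of_neg i hi
          rw [Subsingleton.elim x 0]
          simp
        · have := B.subsingleton_of_neg j (by omega)
          rw [Subsingleton.elim a 0]
          simp
    exact (key z).trans (key w).symm

theorem d_one (A : DGAlg R) (j : ℤ) (h : j + 1 = 0) : A.d 0 j h A.one = 0 :=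
  have := A.subsingleton_of_neg j (by omega)
  Subsingleton.elim _ _

theorem tensorD_inr (A B : DGAlg R) (i j : ℤ) (h : j + 1 = i) (x : B.X i) :
    Cx.tensorD A.toCx B.toCx i j h (Cx.tmk _ _ 0 i i (zero_add i) A.one x) =
      Cx.tmk _ _ 0 j j (zero_add j) A.one (B.d i j h x) := by
  rw [Cx.tensorD_tmk _ _ h _ (sub_add_cancel 0 1) h, d_one]
  simp

theorem tensorMul_inr (A B : DGAlg R) (i j k : ℤ) (h : i + j = k) (x : B.X i) (y : B.X j) :
    tensorMul A B i j k h (Cx.tmk _ _ 0 i i (zero_add i) A.one x)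
        (Cx.tmk _ _ 0 j j (zero_add j) A.one y) =
      Cx.tmk _ _ 0 k k (zero_add k) A.one (B.mul i j k h x y) := by
  rw [tensorMul_tmk A B h _ _ (zero_add 0) h, A.one_mul]
  simp

/-- The morphism of DG algebras `B → A ⊗ B`, `b ↦ 1 ⊗ b`. -/
def tensorInr (A B : DGAlg R) : B.Hom (A.tensor B) where
  app n := Cx.tmk A.toCx B.toCx 0 n n (zero_add n) A.one
  map_d i j h x := (tensorD_inr A B i j h x).symm
  map_mul i j k h x y := (tensorMul_inr A B i j k h x y).symm
  map_one := rfl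

theorem d_zero_mul (A : DGAlg R) (i j : ℤ) (h : j + 1 = i) (a : A.X 0) (x : A.X i) :
    A.d i j h (A.mul 0 i i (zero_add i) a x) = A.mul 0 j j (zero_add j) a (A.d i j h x) := by
  have := A.subsingleton_of_neg (-1) (by omega)
  rw [A.leibniz 0 i i (-1) j j (zero_add i) rfl h h (by omega) (zero_add j),
    Subsingleton.elim (A.d 0 (-1) rfl a) 0]
  simp

/-- The degree zero part `A_0` of a DG algebra. -/
def DegZero (A : DGAlg R) : Type u := A.X 0

instance (A : DGAlg R) : AddCommGroup A.DegZero := inferInstanceAs (AddCommGroup (A.X 0))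

/-- `A_0` is a commutative ring under the product of `A`. -/
instance (A : DGAlg R) : CommRing A.DegZero where
  __ := (inferInstance : AddCommGroup A.DegZero)
  mul x y := A.mul 0 0 0 rfl x y
  one := A.one
  left_distrib x y z := map_add (A.mul 0 0 0 rfl x) y z
  right_distrib x y z := LinearMap.map_add₂ (A.mul 0 0 0 rfl) x y z
  zero_mul x := LinearMap.map_zero₂ (A.mul 0 0 0 rfl) x
  mul_zero x := map_zero (A.mul 0 0 0 rfl x)
  mul_assoc x y z := A.mul_assoc 0 0 0 0 0 0 rfl rfl rfl rfl x y z
  one_mul x := A.one_mul 0 x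
  mul_one x := by
    refine (A.mul_comm 0 0 0 rfl rfl x A.one).trans ?_
    rw [mul_zero, Int.negOnePow_zero]
    exact (_root_.one_smul ℤˣ _).trans (A.one_mul 0 x)
  mul_comm x y := (A.mul_comm 0 0 0 rfl rfl x y).trans (by simp; rfl)

/-- The ideal of `A_0` formed by the boundaries of degree zero. -/
def boundaryIdeal (A : DGAlg R) : Ideal A.DegZero where
  carrier := {x | ∃ y : A.X 1, A.d 1 0 rfl y = x}
  add_mem' := by
    rintro _ _ ⟨x, rfl⟩ ⟨y, rfl⟩
    exact ⟨x + y, map_add _ _ _⟩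
  zero_mem' := ⟨0, map_zero _⟩
  smul_mem' := by
    rintro a _ ⟨x, rfl⟩
    exact ⟨A.mul 0 1 1 rfl a x, A.d_zero_mul 1 0 rfl a x⟩

/-- The ring `H_0(A)`; all elements of `A_0` are cycles since `A_{-1} = 0`. -/
abbrev H0 (A : DGAlg R) : Type u := A.DegZero ⧸ A.boundaryIdeal

end DGAlg

namespace DGMod

variable {A : DGAlg R}

/-- A morphism of DG modules: a chain map that respects scalar multiplication. -/
structure Hom (M N : DGMod A) where
  app : ∀ i : ℤ, M.X i →ₗ[R] N.X i
  map_d : ∀ (i j : ℤ) (h : j + 1 = i) (x : M.X i), app j (M.d i j h x) = N.d i j h (app i x)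
  map_smul : ∀ (i j k : ℤ) (h : i + j = k) (a : A.X i) (x : M.X j),
    app k (M.smul i j k h a x) = N.smul i j k h a (app j x)

/-- The homology `H_i(M)` of a DG module. -/
def H (M : DGMod A) (i : ℤ) : Type u := M.toCx.homology i

instance (M : DGMod A) (i : ℤ) : AddCommGroup (M.H i) :=
  inferInstanceAs (AddCommGroup (M.toCx.homology i))

instance (M : DGMod A) (i : ℤ) : Module R (M.H i) :=
  inferInstanceAs (Module R (M.toCx.homology i))

/-- The map induced by a morphism on cycles. -/
def Hom.cyclesMap {M N : DGMod A} (f : M.Hom N) (i : ℤ) : M.cycles i →ₗ[R] N.cycles i :=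
  (f.app i).restrict fun x hx => by
    rw [Cx.mem_cycles _ (sub_add_cancel i 1)] at hx ⊢
    rw [← f.map_d, hx, map_zero]

/-- The map induced by a morphism on homology. -/
def Hom.homologyMap {M N : DGMod A} (f : M.Hom N) (i : ℤ) : M.H i →ₗ[R] N.H i :=
  Submodule.mapQ ((M.boundaries i).submoduleOf (M.cycles i))
    ((N.boundaries i).submoduleOf (N.cycles i)) (f.cyclesMap i) <| by
    rintro x ⟨y, hy⟩
    exact ⟨f.app (i + 1) y, (f.map_d _ _ rfl y).symm.trans (congrArg (f.app i) hy)⟩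

/-- A quasiisomorphism: a morphism that is bijective on all homology modules. -/
def Hom.IsQuasiIso {M N : DGMod A} (f : M.Hom N) : Prop :=
  ∀ i : ℤ, Function.Bijective (f.homologyMap i)

/-- `M ≃ N`: the DG modules are joined by a finite zigzag of quasiisomorphisms. -/
def QuasiIsomorphic (M N : DGMod A) : Prop :=
  Relation.EqvGen (fun M N : DGMod A => ∃ f : M.Hom N, f.IsQuasiIso) M N

theorem d_zero_smul (M : DGMod A) (i j : ℤ) (h : j + 1 = i) (a : A.X 0) (x : M.X i) :
    M.d i j h (M.smul 0 i i (zero_add i) a x) = M.smul 0 j j (zero_add j) a (M.d i j h x) := by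
  have := A.subsingleton_of_neg (-1) (by omega)
  rw [M.leibniz 0 i i (-1) j j (zero_add i) rfl h h (by omega) (zero_add j),
    Subsingleton.elim (A.d 0 (-1) rfl a) 0]
  simp

theorem d_one_smul (M : DGMod A) (i j : ℤ) (h : i + 1 = j) (y : A.X 1) (x : M.X i)
    (hx : x ∈ M.cycles i) :
    M.d j i h (M.smul 1 i j (by omega) y x) = M.smul 0 i i (zero_add i) (A.d 1 0 rfl y) x := by
  rw [Cx.mem_cycles _ (sub_add_cancel i 1)] at hx
  rw [M.leibniz 1 i j 0 (i - 1) i (by omega) rfl (sub_add_cancel i 1) h (zero_add i) (by ring), hx]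
  simp

/-- Multiplication by an element of `A_0` on the cycles of a DG module. -/
def smulCycles (M : DGMod A) (i : ℤ) (a : A.DegZero) : M.cycles i →ₗ[R] M.cycles i :=
  (M.smul 0 i i (zero_add i) a).restrict fun x hx => by
    rw [Cx.mem_cycles _ (sub_add_cancel i 1)] at hx ⊢
    exact (M.d_zero_smul i _ _ a x).trans ((congrArg _ hx).trans (map_zero _))

/-- Multiplication by an element of `A_0` on the homology of a DG module. -/
def smulHomology (M : DGMod A) (i : ℤ) (a : A.DegZero) : M.H i →ₗ[R] M.H i :=
  Submodule.mapQ ((M.boundaries i).submoduleOf (M.cycles i))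
    ((M.boundaries i).submoduleOf (M.cycles i)) (M.smulCycles i a) <| by
    rintro x ⟨y, hy⟩
    exact ⟨M.smul 0 (i + 1) (i + 1) (zero_add _) a y,
      (M.d_zero_smul (i + 1) i rfl a y).trans (congrArg (M.smul 0 i i (zero_add i) a) hy)⟩

/-- The homology class of a cycle. -/
def toH (M : DGMod A) (i : ℤ) : M.cycles i →ₗ[R] M.H i :=
  ((M.boundaries i).submoduleOf (M.cycles i)).mkQ

theorem toH_surjective (M : DGMod A) (i : ℤ) : Function.Surjective (M.toH i) :=
  Submodule.mkQ_surjective _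

theorem smulHomology_toH (M : DGMod A) (i : ℤ) (a : A.DegZero) (x : M.cycles i) :
    M.smulHomology i a (M.toH i x) = M.toH i (M.smulCycles i a x) := rfl

theorem smulCycles_one (M : DGMod A) (i : ℤ) (x : M.cycles i) : M.smulCycles i 1 x = x :=
  Subtype.ext (M.one_smul i x.1)

theorem smulCycles_mul (M : DGMod A) (i : ℤ) (a b : A.DegZero) (x : M.cycles i) :
    M.smulCycles i (a * b) x = M.smulCycles i a (M.smulCycles i b x) :=
  Subtype.ext (M.mul_smul 0 0 i 0 i i rfl (zero_add i) (zero_add i) (zero_add i) a b x.1)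

theorem smulCycles_zero (M : DGMod A) (i : ℤ) (x : M.cycles i) : M.smulCycles i 0 x = 0 :=
  Subtype.ext (LinearMap.map_zero₂ (M.smul 0 i i (zero_add i)) x.1)

theorem smulCycles_add (M : DGMod A) (i : ℤ) (a b : A.DegZero) (x : M.cycles i) :
    M.smulCycles i (a + b) x = M.smulCycles i a x + M.smulCycles i b x :=
  Subtype.ext (LinearMap.map_add₂ (M.smul 0 i i (zero_add i)) a b x.1)

/-- The action of `A_0` on `H_i(M)`. -/
def actionDegZero (M : DGMod A) (i : ℤ) : A.DegZero →+* Module.End R (M.H i) where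
  toFun := M.smulHomology i
  map_one' := by
    refine LinearMap.ext fun z => ?_
    obtain ⟨x, rfl⟩ := M.toH_surjective i z
    rw [smulHomology_toH, smulCycles_one, Module.End.one_apply]
  map_mul' a b := by
    refine LinearMap.ext fun z => ?_
    obtain ⟨x, rfl⟩ := M.toH_surjective i z
    rw [smulHomology_toH, smulCycles_mul, Module.End.mul_apply, smulHomology_toH,
      smulHomology_toH]
  map_zero' := by
    refine LinearMap.ext fun z => ?_
    obtain ⟨x, rfl⟩ := M.toH_surjective i z
    rw [smulHomology_toH, smulCycles_zero, map_zero, LinearMap.zero_apply]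
  map_add' a b := by
    refine LinearMap.ext fun z => ?_
    obtain ⟨x, rfl⟩ := M.toH_surjective i z
    rw [smulHomology_toH, smulCycles_add, map_add, LinearMap.add_apply, smulHomology_toH,
      smulHomology_toH]

/-- The action of `H_0(A)` on `H_i(M)`. -/
def actionH0 (M : DGMod A) (i : ℤ) : A.H0 →+* Module.End R (M.H i) :=
  Ideal.Quotient.lift A.boundaryIdeal (M.actionDegZero i) <| by
    rintro _ ⟨y, rfl⟩
    refine LinearMap.ext fun z => ?_
    obtain ⟨x, rfl⟩ := M.toH_surjective i z
    exact (Submodule.Quotient.mk_eq_zero _).mpr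
      ⟨M.smul 1 i (i + 1) (add_comm 1 i) y x.1, M.d_one_smul i (i + 1) rfl y x.1 x.2⟩

/-- `H_i(M)` is a module over `H_0(A)`. -/
instance moduleH0 (M : DGMod A) (i : ℤ) : Module A.H0 (M.H i) :=
  Module.compHom (M.H i) (M.actionH0 i)

/-- `H_i(M)` is finitely generated over `H_0(A)` for all `i`. -/
def IsHomologicallyDegreewiseFinite (M : DGMod A) : Prop :=
  ∀ i : ℤ, Module.Finite A.H0 (M.H i)

open Classical in
/-- The homogeneous family `e` is a semi-basis of `M`, that is, a basis of the graded module
underlying `M` over the graded algebra underlying `A`: in every degree `n`, each element is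
`∑ s, a s • e s` for a unique finitely supported family of `a s ∈ A_{n - deg s}`. -/
def IsSemiBasis (M : DGMod A) {ι : Type u} (deg : ι → ℤ) (e : ∀ s, M.X (deg s)) : Prop :=
  ∀ n : ℤ, Function.Bijective (DirectSum.toModule R ι (M.X n) fun s =>
    (M.smul (n - deg s) (deg s) n (sub_add_cancel n (deg s))).flip (e s))

/-- A semi-free DG module: bounded below, with a semi-basis. -/
def IsSemiFree (M : DGMod A) : Prop :=
  M.IsBoundedBelow ∧
    ∃ (ι : Type u) (deg : ι → ℤ) (e : ∀ s, M.X (deg s)), M.IsSemiBasis deg e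

/-- The DG module homomorphisms `M → N` of degree `p`: families of `R`-linear maps `M_i → N_j`,
`i + p = j`, with `f (a m) = (-1)^(p |a|) a f(m)`. They need not commute with differentials. -/
def homX (M N : DGMod A) (p : ℤ) :
    Submodule R (∀ q : {q : ℤ × ℤ // q.1 + p = q.2}, M.X q.1.1 →ₗ[R] N.X q.1.2) where
  carrier := {f | ∀ (i j k j' k' : ℤ) (h : i + j = k) (hj : j + p = j') (hk : k + p = k')
    (h' : i + j' = k') (a : A.X i) (m : M.X j),
    f ⟨(k, k'), hk⟩ (M.smul i j k h a m) =
      (p * i).negOnePow • N.smul i j' k' h' a (f ⟨(j, j'), hj⟩ m)}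
  add_mem' := by
    intro f g hf hg i j k j' k' h hj hk h' a m
    simp only [Pi.add_apply, LinearMap.add_apply, map_add, smul_add]
    rw [hf i j k j' k' h hj hk h', hg i j k j' k' h hj hk h']
  zero_mem' := by
    intro i j k j' k' h hj hk h' a m
    simp
  smul_mem' := by
    intro c f hf i j k j' k' h hj hk h' a m
    simp only [Pi.smul_apply, LinearMap.smul_apply, map_smul]
    rw [hf i j k j' k' h hj hk h', smul_comm]

/-- The differential of the Hom complex, `∂ f = d f - (-1)^|f| f d`, on families of maps. -/
def homDAux (M N : DGMod A) (p p' : ℤ) (h : p' + 1 = p)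
    (f : ∀ q : {q : ℤ × ℤ // q.1 + p = q.2}, M.X q.1.1 →ₗ[R] N.X q.1.2)
    (q : {q : ℤ × ℤ // q.1 + p' = q.2}) : M.X q.1.1 →ₗ[R] N.X q.1.2 :=
  (N.d (q.1.2 + 1) q.1.2 rfl).comp (f ⟨(q.1.1, q.1.2 + 1), by have := q.2; omega⟩) -
    p.negOnePow • (f ⟨(q.1.1 - 1, q.1.2), by have := q.2; omega⟩).comp
      (M.d q.1.1 (q.1.1 - 1) (sub_add_cancel _ 1))

theorem homDAux_apply (M N : DGMod A) (p p' : ℤ) (h : p' + 1 = p)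
    (f : ∀ q : {q : ℤ × ℤ // q.1 + p = q.2}, M.X q.1.1 →ₗ[R] N.X q.1.2)
    (i j i' j' : ℤ) (hq : i + p' = j) (hi : i' + 1 = i) (hj : j + 1 = j') (m : M.X i) :
    homDAux M N p p' h f ⟨(i, j), hq⟩ m =
      N.d j' j hj (f ⟨(i, j'), by omega⟩ m) -
        p.negOnePow • f ⟨(i', j), by omega⟩ (M.d i i' hi m) := by
  obtain rfl : i' = i - 1 := by omega
  subst hj
  rfl

/-- The differential of the Hom complex, `∂ f = d f - (-1)^|f| f d`. -/
def homD (M N : DGMod A) (p p' : ℤ) (h : p' + 1 = p) : homX M N p →ₗ[R] homX M N p' where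
  toFun f := ⟨homDAux M N p p' h f.1, by
    intro i j k j' k' hij hj hk h' a m
    have hf := f.2
    rw [homDAux_apply M N p p' h f.1 k k' (k - 1) (k' + 1) hk (sub_add_cancel k 1) rfl,
      homDAux_apply M N p p' h f.1 j j' (j - 1) (j' + 1) hj (sub_add_cancel j 1) rfl,
      hf i j k (j' + 1) (k' + 1) hij (by omega) (by omega) (by omega) a m,
      M.leibniz i j k (i - 1) (j - 1) (k - 1) hij (sub_add_cancel i 1) (sub_add_cancel j 1)
        (sub_add_cancel k 1) (by omega) (by omega), map_add, map_sign, map_sign,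
      hf (i - 1) j (k - 1) (j' + 1) k' (by omega) (by omega) (by omega) (by omega),
      hf i (j - 1) (k - 1) j' k' (by omega) (by omega) (by omega) (by omega),
      N.leibniz i (j' + 1) (k' + 1) (i - 1) j' k' (by omega) (sub_add_cancel i 1) rfl
        rfl (by omega) (by omega), map_sub, map_sign]
    simp only [smul_add, smul_sub, smul_smul, ← Int.negOnePow_add]
    have s₁ : (p + p * (i - 1)).negOnePow = (p * i).negOnePow := by
      congr 1
      ring
    have s₂ : (p * i + i).negOnePow = (p' * i).negOnePow := by
      rw [Int.negOnePow_eq_iff]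
      subst h
      exact ⟨i, by ring⟩
    have s₃ : (p + (i + p * i)).negOnePow = (p' * i + p).negOnePow := by
      rw [Int.negOnePow_eq_iff]
      subst h
      exact ⟨i, by ring⟩
    rw [s₁, s₂, s₃]
    abel⟩
  map_add' f g := by
    ext q m
    simp [homDAux]
    abel
  map_smul' c f := by
    ext q m
    simp [homDAux, smul_sub, smul_comm c]

/-- The complex `Hom_A(M, N)`. -/
def homCx (M N : DGMod A) : Cx R where
  X p := homX M N p
  d := homD M N
  d_d := by
    intro p p' p'' h h' f
    ext ⟨⟨i, j⟩, hq⟩ m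
    change homDAux M N p' p'' h' (homDAux M N p p' h f.1) ⟨(i, j), hq⟩ m = 0
    dsimp only at hq m
    rw [homDAux_apply M N p' p'' h' _ i j (i - 1) (j + 1) hq (sub_add_cancel i 1) rfl,
      homDAux_apply M N p p' h _ i (j + 1) (i - 1) (j + 1 + 1) _ (sub_add_cancel i 1) rfl,
      homDAux_apply M N p p' h _ (i - 1) j (i - 1 - 1) (j + 1) _ (sub_add_cancel _ 1) rfl,
      map_sub, N.d_d, M.d_d, map_sign]
    subst h
    simp [Int.negOnePow_succ]

/-- `Ext_A^i(M, N) = H_{-i}(Hom_A(F, N))`, computed by the semi-free resolution `F` of `M`. -/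
abbrev Ext (F N : DGMod A) (i : ℤ) : Type u := (homCx F N).homology (-i)

/-- `Ext_A^i(M, N) = 0`: there is a semi-free resolution `F → M` with
`H_{-i}(Hom_A(F, N)) = 0`. -/
def ExtVanishes (M N : DGMod A) (i : ℤ) : Prop :=
  ∃ F : DGMod A, F.IsSemiFree ∧ (∃ f : F.Hom M, f.IsQuasiIso) ∧
    Subsingleton (Ext F N i)

end DGMod

namespace DGMod

variable {A B : DGAlg R}

/-- The relations `b f(a) ⊗ m = b ⊗ a m` defining `B ⊗_A M` as a quotient of `B ⊗_R M`. -/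
def balanced (f : A.Hom B) (M : DGMod A) (n : ℤ) :
    Submodule R (Cx.TensorX B.toCx M.toCx n) :=
  Submodule.span R {z | ∃ (i j k ij jk : ℤ) (hij : i + j = ij) (hjk : j + k = jk)
    (h₁ : ij + k = n) (h₂ : i + jk = n) (b : B.X i) (a : A.X j) (m : M.X k),
    z = Cx.tmk _ _ ij k n h₁ (B.mul i j ij hij b (f.app j a)) m -
      Cx.tmk _ _ i jk n h₂ b (M.smul j k jk hjk a m)}

theorem mem_balanced (f : A.Hom B) (M : DGMod A) {n i j k ij jk : ℤ} (hij : i + j = ij)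
    (hjk : j + k = jk) (h₁ : ij + k = n) (h₂ : i + jk = n) (b : B.X i) (a : A.X j) (m : M.X k) :
    Cx.tmk _ _ ij k n h₁ (B.mul i j ij hij b (f.app j a)) m -
      Cx.tmk _ _ i jk n h₂ b (M.smul j k jk hjk a m) ∈ balanced f M n :=
  Submodule.subset_span ⟨i, j, k, ij, jk, hij, hjk, h₁, h₂, b, a, m, rfl⟩

theorem sign_mem {M : Type*} [AddCommGroup M] [Module R M] (U : Submodule R M) (s : ℤˣ) {x : M}
    (hx : x ∈ U) : s • x ∈ U := by
  rw [Units.smul_def]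
  exact U.toAddSubgroup.zsmul_mem hx _

theorem balanced_le_comap_d (f : A.Hom B) (M : DGMod A) (n n' : ℤ) (h : n' + 1 = n) :
    balanced f M n ≤ (balanced f M n').comap (Cx.tensorD B.toCx M.toCx n n' h) := by
  rw [balanced, Submodule.span_le]
  rintro _ ⟨i, j, k, ij, jk, hij, hjk, h₁, h₂, b, a, m, rfl⟩
  change Cx.tensorD B.toCx M.toCx n n' h _ ∈ balanced f M n'
  subst hij hjk
  have e₁ : i - 1 + j + 1 = i + j := by ring
  have e₂ : j - 1 + k + 1 = j + k := by ring
  have e : Cx.tensorD B.toCx M.toCx n n' h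
      (Cx.tmk _ _ (i + j) k n h₁ (B.mul i j _ rfl b (f.app j a)) m -
        Cx.tmk _ _ i (j + k) n h₂ b (M.smul j k _ rfl a m)) =
      (Cx.tmk _ _ (i - 1 + j) k n' (by omega)
          (B.mul (i - 1) j _ rfl (B.d i (i - 1) (sub_add_cancel i 1) b) (f.app j a)) m -
        Cx.tmk _ _ (i - 1) (j + k) n' (by omega) (B.d i (i - 1) (sub_add_cancel i 1) b)
          (M.smul j k _ rfl a m)) +
      i.negOnePow • (Cx.tmk _ _ (i - 1 + j) k n' (by omega)
          (B.mul i (j - 1) _ (by ring) b (f.app (j - 1) (A.d j (j - 1) (sub_add_cancel j 1) a))) m -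
        Cx.tmk _ _ i (j - 1 + k) n' (by omega) b
          (M.smul (j - 1) k _ rfl (A.d j (j - 1) (sub_add_cancel j 1) a) m)) +
      (i + j).negOnePow • (Cx.tmk _ _ (i + j) (k - 1) n' (by omega)
          (B.mul i j _ rfl b (f.app j a)) (M.d k (k - 1) (sub_add_cancel k 1) m) -
        Cx.tmk _ _ i (j - 1 + k) n' (by omega) b
          (M.smul j (k - 1) _ (by ring) a (M.d k (k - 1) (sub_add_cancel k 1) m))) := by
    rw [map_sub, Cx.tensorD_tmk _ _ h h₁ e₁ (sub_add_cancel k 1),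
      Cx.tensorD_tmk _ _ h h₂ (sub_add_cancel i 1) e₂,
      B.leibniz i j _ (i - 1) (j - 1) _ rfl (sub_add_cancel i 1) (sub_add_cancel j 1) e₁ rfl
        (by ring),
      M.leibniz j k _ (j - 1) (k - 1) _ rfl (sub_add_cancel j 1) (sub_add_cancel k 1) e₂ rfl
        (by ring), f.map_d]
    simp only [map_add, map_sign, map_sign₂, LinearMap.add_apply, smul_add, smul_sub, smul_smul,
      ← Int.negOnePow_add]
    abel
  rw [e]
  exact add_mem (add_mem (mem_balanced f M _ _ _ _ _ _ _)
    (sign_mem _ _ (mem_balanced f M _ _ _ _ _ _ _)))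
    (sign_mem _ _ (mem_balanced f M _ _ _ _ _ _ _))

/-- The action `b (b' ⊗ m) = (b b') ⊗ m` of `B` on `B ⊗_R M`. -/
def tensorAct (B : DGAlg R) (M : Cx R) (i n m : ℤ) (h : i + n = m) :
    B.X i →ₗ[R] Cx.TensorX B.toCx M n →ₗ[R] Cx.TensorX B.toCx M m :=
  LinearMap.flip <| Cx.tlift _ _ n fun j k hjk => LinearMap.mk₂ R
    (fun b' x => ((Cx.tmk B.toCx M (i + j) k m (by omega)).flip x).comp
      ((B.mul i j (i + j) rfl).flip b'))
    (by intro b b' x; ext; simp)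
    (by intro c b x; ext; simp)
    (by intro b x x'; ext; simp)
    (by intro c b x; ext; simp)

theorem tensorAct_tmk (B : DGAlg R) (M : Cx R) {i n m j k ij : ℤ} (h : i + n = m)
    (hjk : j + k = n) (hij : i + j = ij) (b : B.X i) (b' : B.X j) (x : M.X k) :
    tensorAct B M i n m h b (Cx.tmk _ _ j k n hjk b' x) =
      Cx.tmk _ _ ij k m (by omega) (B.mul i j ij hij b b') x := by
  subst hij
  simp [tensorAct]

theorem balanced_le_comap_act (f : A.Hom B) (M : DGMod A) (p n n' : ℤ) (h : p + n = n')
    (c : B.X p) :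
    balanced f M n ≤ (balanced f M n').comap (tensorAct B M.toCx p n n' h c) := by
  rw [balanced, Submodule.span_le]
  rintro _ ⟨i, j, k, ij, jk, hij, hjk, h₁, h₂, b, a, m, rfl⟩
  change tensorAct B M.toCx p n n' h c _ ∈ balanced f M n'
  rw [map_sub, tensorAct_tmk _ _ _ _ (ij := p + i + j) (by omega), tensorAct_tmk _ _ _ _ rfl,
    ← B.mul_assoc p i j (p + i) ij (p + i + j) rfl hij rfl (by omega)]
  exact mem_balanced f M rfl hjk _ _ _ _ _

theorem tensorAct_mul (B : DGAlg R) (M : Cx R) (i j n ij jn m : ℤ) (hij : i + j = ij)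
    (hjn : j + n = jn) (h₁ : ij + n = m) (h₂ : i + jn = m) (b : B.X i) (b' : B.X j)
    (z : Cx.TensorX B.toCx M n) :
    tensorAct B M ij n m h₁ (B.mul i j ij hij b b') z =
      tensorAct B M i jn m h₂ b (tensorAct B M j n jn hjn b' z) := by
  induction z using Cx.tensor_induction with
  | h0 => simp
  | hadd x y hx hy => simp [hx, hy]
  | hmk p q hpq c x =>
    rw [tensorAct_tmk _ _ _ _ rfl, tensorAct_tmk _ _ _ _ rfl,
      tensorAct_tmk _ _ _ _ (ij := ij + p) (by omega),
      B.mul_assoc i j p ij _ _ hij rfl _ (by omega)]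

theorem tensorAct_one (B : DGAlg R) (M : Cx R) (n : ℤ) (z : Cx.TensorX B.toCx M n) :
    tensorAct B M 0 n n (zero_add n) B.one z = z := by
  induction z using Cx.tensor_induction with
  | h0 => simp
  | hadd x y hx hy => simp [hx, hy]
  | hmk p q hpq c x => rw [tensorAct_tmk _ _ _ _ (zero_add p), B.one_mul]

theorem tensorAct_leibniz (B : DGAlg R) (M : Cx R) (i j k i' j' k' : ℤ) (h : i + j = k)
    (hi : i' + 1 = i) (hj : j' + 1 = j) (hk : k' + 1 = k) (h₁ : i' + j = k') (h₂ : i + j' = k')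
    (b : B.X i) (z : Cx.TensorX B.toCx M j) :
    Cx.tensorD B.toCx M k k' hk (tensorAct B M i j k h b z) =
      tensorAct B M i' j k' h₁ (B.d i i' hi b) z +
        i.negOnePow • tensorAct B M i j' k' h₂ b (Cx.tensorD B.toCx M j j' hj z) := by
  induction z using Cx.tensor_induction with
  | h0 => simp
  | hadd x y hx hy =>
    simp only [map_add, hx, hy, smul_add]
    abel
  | hmk p q hpq c x =>
    have e : i' + p + 1 = i + p := by omega
    rw [tensorAct_tmk _ _ _ _ rfl, Cx.tensorD_tmk _ _ _ _ e (sub_add_cancel q 1),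
      Cx.tensorD_tmk _ _ _ _ (sub_add_cancel p 1) (sub_add_cancel q 1),
      B.leibniz i p _ i' (p - 1) _ rfl hi (sub_add_cancel p 1) e rfl (by omega),
      map_add (tensorAct B M i j' k' h₂ b), map_sign, tensorAct_tmk _ _ _ _ rfl,
      tensorAct_tmk _ _ _ _ (ij := i' + p) (by omega), tensorAct_tmk _ _ _ _ rfl]
    simp only [map_add, map_sign₂, LinearMap.add_apply, smul_add, smul_smul, Int.negOnePow_add]
    abel

/-- The differential of `B ⊗_A M`. -/
def baseChangeD (f : A.Hom B) (M : DGMod A) (n n' : ℤ) (h : n' + 1 = n) :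
    (Cx.TensorX B.toCx M.toCx n ⧸ balanced f M n) →ₗ[R]
      (Cx.TensorX B.toCx M.toCx n' ⧸ balanced f M n') :=
  Submodule.mapQ _ _ (Cx.tensorD B.toCx M.toCx n n' h) (balanced_le_comap_d f M n n' h)

/-- The action `b (b' ⊗ m) = (b b') ⊗ m` of `B` on `B ⊗_A M`. -/
def baseChangeAct (f : A.Hom B) (M : DGMod A) (i n m : ℤ) (h : i + n = m) :
    B.X i →ₗ[R] (Cx.TensorX B.toCx M.toCx n ⧸ balanced f M n) →ₗ[R]
      (Cx.TensorX B.toCx M.toCx m ⧸ balanced f M m) where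
  toFun b := Submodule.mapQ _ _ (tensorAct B M.toCx i n m h b) (balanced_le_comap_act f M i n m h b)
  map_add' b b' := by
    refine LinearMap.ext fun z => ?_
    obtain ⟨z, rfl⟩ := Submodule.mkQ_surjective _ z
    simp
  map_smul' c b := by
    refine LinearMap.ext fun z => ?_
    obtain ⟨z, rfl⟩ := Submodule.mkQ_surjective _ z
    simp

theorem baseChangeD_mkQ (f : A.Hom B) (M : DGMod A) (n n' : ℤ) (h : n' + 1 = n)
    (z : Cx.TensorX B.toCx M.toCx n) :
    baseChangeD f M n n' h ((balanced f M n).mkQ z) =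
      (balanced f M n').mkQ (Cx.tensorD B.toCx M.toCx n n' h z) := rfl

theorem baseChangeAct_mkQ (f : A.Hom B) (M : DGMod A) (i n m : ℤ) (h : i + n = m) (b : B.X i)
    (z : Cx.TensorX B.toCx M.toCx n) :
    baseChangeAct f M i n m h b ((balanced f M n).mkQ z) =
      (balanced f M m).mkQ (tensorAct B M.toCx i n m h b z) := rfl

theorem baseChange_leibniz (f : A.Hom B) (M : DGMod A) (i j k i' j' k' : ℤ) (h : i + j = k)
    (hi : i' + 1 = i) (hj : j' + 1 = j) (hk : k' + 1 = k) (h₁ : i' + j = k') (h₂ : i + j' = k')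
    (b : B.X i) (z : Cx.TensorX B.toCx M.toCx j ⧸ balanced f M j) :
    baseChangeD f M k k' hk (baseChangeAct f M i j k h b z) =
      baseChangeAct f M i' j k' h₁ (B.d i i' hi b) z +
        i.negOnePow • baseChangeAct f M i j' k' h₂ b (baseChangeD f M j j' hj z) := by
  obtain ⟨z, rfl⟩ := Submodule.mkQ_surjective _ z
  rw [baseChangeD_mkQ, baseChangeAct_mkQ, baseChangeAct_mkQ, baseChangeAct_mkQ, baseChangeD_mkQ,
    tensorAct_leibniz B M.toCx i j k i' j' k' h hi hj hk h₁ h₂ b z, map_add, map_sign]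

/-- The base change `B ⊗_A M` of a DG `A`-module along a morphism `A → B` of DG algebras. -/
def baseChange (f : A.Hom B) (M : DGMod A) : DGMod B where
  X n := Cx.TensorX B.toCx M.toCx n ⧸ balanced f M n
  d := baseChangeD f M
  d_d := by
    intro i j k hj hk z
    obtain ⟨z, rfl⟩ := Submodule.mkQ_surjective _ z
    rw [baseChangeD_mkQ, baseChangeD_mkQ]
    exact (congrArg _ ((Cx.tensor B.toCx M.toCx).d_d i j k hj hk z)).trans (map_zero _)
  smul := baseChangeAct f M
  mul_smul := by
    intro i j k ij jk n hij hjk h₁ h₂ a b z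
    obtain ⟨z, rfl⟩ := Submodule.mkQ_surjective _ z
    exact congrArg (balanced f M n).mkQ
      (tensorAct_mul B M.toCx i j k ij jk n hij hjk h₁ h₂ a b z)
  one_smul := by
    intro n z
    obtain ⟨z, rfl⟩ := Submodule.mkQ_surjective _ z
    exact congrArg (balanced f M n).mkQ (tensorAct_one B M.toCx n z)
  leibniz := baseChange_leibniz f M

/-- A DG `B`-module `D` is quasi-liftable along `f : A → B` if `D ≃ B ⊗_A D'` for some semi-free
DG `A`-module `D'`. -/
def IsQuasiLiftable (f : A.Hom B) (D : DGMod B) : Prop :=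
  ∃ D' : DGMod A, D'.IsSemiFree ∧ D.QuasiIsomorphic (baseChange f D')

end DGMod

end Algebras

end DG

/-! Write $B = A\langle e \mid de = t\rangle$, and let the contraction of $B$ be the $A$-linear
derivation of degree $-1$ with $e \mapsto 1$; its kernel is $A$. Suppose that a semi-free DG
$B$-module $F$ carries a derivation $\pi$ over the contraction with $\pi^2 = 0$ and $\pi d + d\pi =
0$. Then $\ker\pi$ is a DG $A$-module, $F = \ker\pi \oplus e\ker\pi$, and $B \otimes_A \ker\pi \to
F$ is an isomorphism (`bijective_kerDerHom_app`). If $\pi$ kills a semi-basis, then $\ker\pi$ is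
semi-free on it (`isSemiBasis_kerDer`). So it suffices to find such a $\pi$ on some semi-free
resolution $F$ of $D$.

A semi-basis yields a derivation $p$ with $p^2 = 0$ that kills it; only $pd + dp = 0$ may fail. The
defect $c = pd + dp$ is a $B$-linear cycle of degree $-2$ in $\operatorname{Hom}_B(F,F)$. Since
$\operatorname{Ext}^2_B(D,D) = 0$, such cycles are boundaries (`ExtVanishes.exists_homD_eq`), say $c
= d\gamma + \gamma d$. Let $\varepsilon$ be multiplication by $e$ and write $\gamma = g_0 +
\varepsilon g_1$ with $g_0$ anticommuting and $g_1$ commuting with $p$. Conjugating $d$ by $1 -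
\varepsilon g_0$ replaces the defect $c$ by $t(g_1 - g_0^2)$, because $d\varepsilon + \varepsilon d
= t$.

This can be repeated: a defect $t^n c$ becomes $t^{n+1} c'$ after conjugation by $1 - t^n
\varepsilon g_0$, with $c'$ again a cycle (`StepData.step`). The maps $1 + \varepsilon\Gamma$
multiply by adding the $\Gamma$'s, so the successive corrections form a $t$-adic series. Its sum
yields a differential whose defect is divisible by every power of $t$, hence zero
(`exists_conj_anticommute`). Conjugating $p$ instead of $d$ gives $\pi$ (`exists_isDer_d_eq_zero`).

Convergence and separation require $F$ to be finitely generated over $R$ in each degree. Such a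
resolution exists because $R$ is noetherian and $B$ and the homology of $D$ are degreewise finite
over $R$ (`exists_finite_resolution`). -/

namespace DG

universe u

/-! ### Obstruction theory as computation in an associative algebra. -/

section RingLemmas

variable {R E : Type*} [CommRing R] [Ring E] [Algebra R E]

/-- The relations between a differential `δ`, a contraction `p`, multiplication `ε` by a generator
with `dε = t`, and an operator `c` with `pδ + δp = τ c`. -/
structure StepData (t τ : R) (δ p ε c : E) : Prop where
  dd : δ * δ = 0
  pp : p * p = 0
  ee : ε * ε = 0
  pe : p * ε = 1 - ε * p
  de : δ * ε = t • 1 - ε * δ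
  pd : p * δ = τ • c - δ * p
  dc : δ * c = c * δ
  pc : p * c = c * p
  ce : c * ε = ε * c

/-- One round of the approximation: the defect $\tau c$ of $p$ against the differential improves to
$t\tau c'$. The conjugating element uses only the part $g_0 = \gamma - \varepsilon(p\gamma + \gamma
p)$ of the homotopy $\gamma$, and $c' = g_1 - \tau g_0^2$ with $g_1 = p\gamma + \gamma p$. The
hypotheses on `ε` encode linearity over the exterior variable. -/
theorem StepData.step {t τ : R} {δ p ε c γ : E} (h : StepData t τ δ p ε c)
    (hc : δ * γ = c - γ * δ) (hγ : γ * ε = - (ε * γ))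
    (hg : (p * γ + γ * p) * ε = ε * (p * γ + γ * p)) :
    StepData t (t * τ)
      ((1 - τ • (ε * (γ - ε * (p * γ + γ * p)))) * δ * (1 + τ • (ε * (γ - ε * (p * γ + γ * p)))))
      p ε
      ((p * γ + γ * p) - τ • ((γ - ε * (p * γ + γ * p)) * (γ - ε * (p * γ + γ * p)))) := by
  obtain ⟨dd, pp, ee, pe, de, pd, dc, pc, ce⟩ := h
  have pp' (x : E) : p * (p * x) = 0 := by rw [← mul_assoc, pp, zero_mul]
  have ee' (x : E) : ε * (ε * x) = 0 := by rw [← mul_assoc, ee, zero_mul]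
  have dd' (x : E) : δ * (δ * x) = 0 := by rw [← mul_assoc, dd, zero_mul]
  have pe' (x : E) : p * (ε * x) = x - ε * (p * x) := by
    rw [← mul_assoc, pe, sub_mul, one_mul, mul_assoc]
  have de' (x : E) : δ * (ε * x) = t • x - ε * (δ * x) := by
    rw [← mul_assoc, de, sub_mul, smul_mul_assoc, one_mul, mul_assoc]
  have pd' (x : E) : p * (δ * x) = τ • (c * x) - δ * (p * x) := by
    rw [← mul_assoc, pd, sub_mul, smul_mul_assoc, mul_assoc]
  have dc' (x : E) : δ * (c * x) = c * (δ * x) := by rw [← mul_assoc, dc, mul_assoc]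
  have pc' (x : E) : p * (c * x) = c * (p * x) := by rw [← mul_assoc, pc, mul_assoc]
  have ce' (x : E) : c * (ε * x) = ε * (c * x) := by rw [← mul_assoc, ce, mul_assoc]
  -- Expansion $\gamma = g_0 + \varepsilon g_1$ in the exterior variable: $g_1$ commutes with $p$
  -- and $g_0$ anticommutes with it. The names are made opaque so that `simp` treats both as atoms.
  obtain ⟨g₁, h₁⟩ : ∃ g₁, p * γ + γ * p = g₁ := ⟨_, rfl⟩
  obtain ⟨g₀, h₀⟩ : ∃ g₀, γ - ε * g₁ = g₀ := ⟨_, rfl⟩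
  rw [h₁] at hg
  rw [h₁, h₀]
  have eg₁ (x : E) : g₁ * (ε * x) = ε * (g₁ * x) := by rw [← mul_assoc, hg, mul_assoc]
  have pg₁ : p * g₁ = g₁ * p := by
    rw [← h₁, mul_add, add_mul, pp', mul_assoc γ, pp, mul_zero, zero_add, add_zero, mul_assoc]
  have pg₁' (x : E) : p * (g₁ * x) = g₁ * (p * x) := by rw [← mul_assoc, pg₁, mul_assoc]
  have pγ : p * γ = g₁ - γ * p := by rw [← h₁, add_sub_cancel_right]
  have pγ' (x : E) : p * (γ * x) = g₁ * x - γ * (p * x) := by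
    rw [← mul_assoc, pγ, sub_mul, mul_assoc]
  have pg₀ : p * g₀ = - (g₀ * p) := by
    rw [← h₀, mul_sub, pe', pγ, sub_mul, pg₁, mul_assoc]
    abel
  have pg₀' (x : E) : p * (g₀ * x) = - (g₀ * (p * x)) := by
    rw [← mul_assoc, pg₀, neg_mul, mul_assoc]
  have g₀e : g₀ * ε = - (ε * g₀) := by
    rw [← h₀, sub_mul, mul_sub, hγ, mul_assoc, hg, ee', sub_zero, sub_zero]
  have g₀e' (x : E) : g₀ * (ε * x) = - (ε * (g₀ * x)) := by
    rw [← mul_assoc, g₀e, neg_mul, mul_assoc]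
  have hγ₀ : γ = g₀ + ε * g₁ := by rw [← h₀, sub_add_cancel]
  have hc' (x : E) : δ * (γ * x) = c * x - γ * (δ * x) := by
    rw [← mul_assoc, hc, sub_mul, mul_assoc]
  -- The anticommutator with $p$ does not preserve commutation with $\delta$ exactly: exchanging $p$
  -- and $\delta$ costs $\tau c$.
  have dg₁ : δ * g₁ = g₁ * δ + τ • (c * γ - γ * c) := by
    have e₁ : δ * (p * γ) = τ • (c * γ) - p * (δ * γ) := by rw [pd', sub_sub_cancel]
    have e₂ : γ * (δ * p) = τ • (γ * c) - γ * (p * δ) := by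
      rw [pd, mul_sub, mul_smul_comm, sub_sub_cancel]
    rw [← h₁, mul_add, e₁, hc' p, add_mul, hc, mul_sub, mul_assoc, mul_assoc, e₂, pc, smul_sub]
    abel
  have dg₁' (x : E) : δ * (g₁ * x) = g₁ * (δ * x) + τ • (c * (γ * x) - γ * (c * x)) := by
    rw [← mul_assoc, dg₁]
    simp only [add_mul, sub_mul, smul_mul_assoc, mul_assoc]
  have dg₀ : δ * g₀ = c - t • g₁ + τ • (ε * (c * g₀ - g₀ * c)) - g₀ * δ := by
    have : ε * (c * γ - γ * c) = ε * (c * g₀ - g₀ * c) := by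
      rw [hγ₀, mul_add, add_mul, ce']
      simp only [mul_sub, mul_add, mul_assoc, ee', add_zero]
    rw [← h₀, mul_sub, hc, de', dg₁, h₀, mul_add, mul_smul_comm, this, hγ₀, add_mul, mul_assoc]
    abel
  have dg₀' (x : E) : δ * (g₀ * x) =
      c * x - t • (g₁ * x) + τ • (ε * (c * (g₀ * x) - g₀ * (c * x))) - g₀ * (δ * x) := by
    rw [← mul_assoc, dg₀]
    simp only [add_mul, sub_mul, smul_mul_assoc, mul_assoc]
  -- The term $-\tau\varepsilon c$ cancels the old defect, because $p\varepsilon + \varepsilon p =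
  -- 1$ and $p$ commutes with $c$. All other new terms carry the factor $t$.
  have hδ : (1 - τ • (ε * g₀)) * δ * (1 + τ • (ε * g₀)) =
      δ + (τ * t) • g₀ - τ • (ε * c) + (τ * t) • (ε * g₁) - (τ * τ * t) • (ε * (g₀ * g₀)) := by
    simp only [mul_add, sub_mul, mul_one, one_mul, smul_mul_assoc, mul_smul_comm, mul_assoc, de',
      mul_sub, smul_sub, smul_add, dg₀, ee', g₀e', smul_zero, smul_smul, mul_neg, neg_zero]
    module
  rw [hδ]
  refine ⟨?_, pp, ee, pe, ?_, ?_, ?_, ?_, ?_⟩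
  · rw [← hδ]
    have : (1 + τ • (ε * g₀)) * (1 - τ • (ε * g₀)) = 1 := by
      simp only [mul_sub, add_mul, mul_one, one_mul, smul_mul_assoc, mul_smul_comm, mul_assoc,
        g₀e', ee', mul_neg, neg_zero, smul_zero, add_zero, add_sub_cancel_right]
    rw [show ∀ x y : E, x * δ * y * (x * δ * y) = x * δ * (y * x) * δ * y by
      intro x y; simp only [mul_assoc], this, mul_one, mul_assoc _ δ δ, dd, mul_zero, zero_mul]
  · simp only [add_mul, sub_mul, mul_add, mul_sub, smul_mul_assoc, mul_smul_comm, mul_assoc, de,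
      g₀e, g₀e', hg, ce, ee', mul_neg, smul_neg, neg_neg, smul_zero]
    module
  · simp only [add_mul, sub_mul, mul_add, mul_sub, smul_mul_assoc, mul_smul_comm, mul_assoc, pd,
      pg₀, pg₀', pe', pg₁, pc, mul_neg, neg_neg, smul_sub, smul_smul]
    module
  -- That the new $c'$ is a cycle cannot be read off from $t\tau c' = p\delta' + \delta' p$, since
  -- $t$ may be a zero divisor; hence the direct computation.
  · rw [hγ₀] at dg₁
    simp only [add_mul, sub_mul, mul_add, mul_sub, smul_mul_assoc, mul_smul_comm, mul_assoc, dg₁,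
      ce', eg₁, dg₀, dg₀', g₀e', mul_neg, smul_sub, smul_smul, smul_add, neg_neg, smul_neg]
    module
  · simp only [sub_mul, mul_sub, smul_mul_assoc, mul_smul_comm, mul_assoc, pg₀, pg₀', pg₁, mul_neg,
      neg_neg]
  · simp only [sub_mul, mul_sub, smul_mul_assoc, mul_smul_comm, mul_assoc, g₀e, g₀e', hg, mul_neg,
      neg_neg]

/-- Conjugation of `d` by `1 + εΓ`. -/
abbrev conj (d ε Γ : E) : E := (1 + ε * Γ) * d * (1 - ε * Γ)

/-- The cross term $\varepsilon x \varepsilon y = -\varepsilon^2 x y$ vanishes. Hence inverses are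
obtained by changing a sign, and an infinite product of conjugations becomes an infinite sum. -/
theorem one_add_mul_one_sub {ε x y : E} (hε : ε * ε = 0) (hx : x * ε = -(ε * x)) :
    (1 + ε * x) * (1 + ε * y) = 1 + ε * (x + y) := by
  have : ε * x * (ε * y) = 0 := by
    rw [mul_assoc, ← mul_assoc x, hx, neg_mul, mul_neg, mul_assoc, ← mul_assoc ε ε, hε, zero_mul,
      neg_zero]
  rw [add_mul, one_mul, mul_add (ε * x), this, mul_one, mul_add ε]
  abel

/-- Obstruction theory: if all cycles of degree `-2` are boundaries, then the contraction `p` is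
conjugate to one that commutes with the differential. -/
theorem exists_conj_anticommute (t : R) (L : ℤ → Submodule R E) (d p ε : E)
    (hone : (1 : E) ∈ L 0)
    (hmul : ∀ i j k : ℤ, i + j = k → ∀ x ∈ L i, ∀ y ∈ L j, x * y ∈ L k)
    (dd : d * d = 0) (pp : p * p = 0) (ee : ε * ε = 0) (pe : p * ε + ε * p = 1)
    (de : d * ε + ε * d = t • 1) (hε : ε ∈ L 1)
    (h₁ : ∀ x ∈ L (-1), x * ε = -(ε * x)) (h₂ : ∀ x ∈ L (-2), x * ε = ε * x)
    (hp : ∀ x ∈ L (-1), p * x + x * p ∈ L (-2)) (hpd : p * d + d * p ∈ L (-2))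
    (hExt : ∀ x ∈ L (-2), d * x = x * d → ∃ γ ∈ L (-1), x = d * γ + γ * d)
    (hcomplete : ∀ y : ℕ → E, (∀ n, y n ∈ L (-1)) →
      ∃ s ∈ L (-1), ∀ n, ∃ z ∈ L (-1), s = ∑ i ∈ Finset.range n, t ^ i • y i + t ^ n • z)
    (hsep : ∀ x : E, (∀ n : ℕ, ∃ z, x = t ^ n • z) → x = 0) :
    ∃ Γ ∈ L (-1), p * conj d ε Γ + conj d ε Γ * p = 0 := by
  have hu (Γ : E) (hΓ : Γ ∈ L (-1)) : (1 + ε * Γ) * (1 - ε * Γ) = 1 := by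
    rw [sub_eq_add_neg, ← mul_neg, one_add_mul_one_sub ee (h₁ Γ hΓ)]
    simp
  have hu' (Γ : E) (hΓ : Γ ∈ L (-1)) : (1 - ε * Γ) * (1 + ε * Γ) = 1 := by
    have := hu (-Γ) (neg_mem hΓ)
    rwa [mul_neg, sub_neg_eq_add, ← sub_eq_add_neg] at this
  have hadd (Γ z : E) (hz : z ∈ L (-1)) (hΓ : Γ ∈ L (-1)) (τ : R) : conj d ε (Γ - τ • z) =
      (1 - τ • (ε * z)) * conj d ε Γ * (1 + τ • (ε * z)) := by
    have e₁ : 1 + ε * (Γ - τ • z) = (1 - τ • (ε * z)) * (1 + ε * Γ) := by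
      have := one_add_mul_one_sub (y := Γ) ee (h₁ (-(τ • z)) (neg_mem ((L (-1)).smul_mem τ hz)))
      rw [mul_neg, mul_smul_comm, ← sub_eq_add_neg] at this
      rw [this]
      congr 2
      abel
    have e₂ : 1 - ε * (Γ - τ • z) = (1 - ε * Γ) * (1 + τ • (ε * z)) := by
      have := one_add_mul_one_sub (y := τ • z) ee (h₁ (-Γ) (neg_mem hΓ))
      rw [mul_neg, mul_smul_comm, ← sub_eq_add_neg] at this
      rw [this, sub_eq_add_neg, ← mul_neg]
      congr 2
      abel
    simp only [conj, e₁, e₂, mul_assoc]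
  -- Exactness in degree $-2$ passes from `d` to each conjugate differential, because the
  -- conjugating units lie in degree $0$.
  have hext (Γ : E) (hΓ : Γ ∈ L (-1)) (x : E) (hx : x ∈ L (-2))
      (hxc : conj d ε Γ * x = x * conj d ε Γ) :
      ∃ γ ∈ L (-1), x = conj d ε Γ * γ + γ * conj d ε Γ := by
    have hu0 : 1 + ε * Γ ∈ L 0 := add_mem hone (hmul 1 (-1) 0 (by norm_num) _ hε _ hΓ)
    have hv0 : 1 - ε * Γ ∈ L 0 := sub_mem hone (hmul 1 (-1) 0 (by norm_num) _ hε _ hΓ)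
    have huv := hu Γ hΓ
    have hvu := hu' Γ hΓ
    dsimp only [conj] at hxc ⊢
    generalize 1 + ε * Γ = u at *
    generalize 1 - ε * Γ = v at *
    have uv' (y : E) : u * (v * y) = y := by rw [← mul_assoc, huv, one_mul]
    have vu' (y : E) : v * (u * y) = y := by rw [← mul_assoc, hvu, one_mul]
    obtain ⟨γ, hγ, e⟩ := hExt (v * x * u)
      (hmul (-2) 0 (-2) (by norm_num) _ (hmul 0 (-2) (-2) (by norm_num) _ hv0 _ hx) _ hu0) (by
        have := congrArg (fun y => v * y * u) hxc
        simp only [mul_assoc, vu', hvu, mul_one] at this ⊢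
        exact this)
    refine ⟨u * γ * v,
      hmul (-1) 0 (-1) (by norm_num) _ (hmul 0 (-1) (-1) (by norm_num) _ hu0 _ hγ) _ hv0, ?_⟩
    have := congrArg (fun y => u * y * v) e
    simp only [mul_assoc, uv', vu', huv, mul_one, mul_add, add_mul] at this ⊢
    exact this
  -- Invariant of the iteration: after conjugation by $1 + \varepsilon\Gamma$ the defect is $t^n$
  -- times a cycle of degree $-2$.
  let Q (n : ℕ) (Γ : E) : Prop :=
    Γ ∈ L (-1) ∧ ∃ c ∈ L (-2), StepData t (t ^ n) (conj d ε Γ) p ε c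
  have hQ0 : Q 0 0 := by
    refine ⟨zero_mem _, _, hpd, ?_⟩
    have : conj d ε 0 = d := by simp [conj]
    rw [this]
    refine ⟨dd, pp, ee, eq_sub_of_add_eq pe, eq_sub_of_add_eq de, ?_, ?_, ?_, h₂ _ hpd⟩
    · simp
    · rw [mul_add, add_mul, ← mul_assoc d d, dd, mul_assoc p d d, dd, mul_assoc]
      simp
    · rw [mul_add, add_mul, ← mul_assoc p p, pp, mul_assoc d p p, pp, mul_assoc]
      simp
  -- The implication stands inside the existential so that `choose` gives a correction for every
  -- pair; the value is irrelevant when `Q n Γ` fails.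
  have hstep : ∀ n Γ, ∃ y, Q n Γ → y ∈ L (-1) ∧ Q (n + 1) (Γ - t ^ n • y) := by
    intro n Γ
    by_cases hq : Q n Γ
    swap
    · exact ⟨0, fun h => absurd h hq⟩
    obtain ⟨hΓ, c, hcL, hs⟩ := hq
    obtain ⟨γ, hγ, e⟩ := hext Γ hΓ c hcL hs.dc
    have hg := hp γ hγ
    have hy : γ - ε * (p * γ + γ * p) ∈ L (-1) :=
      sub_mem hγ (hmul 1 (-2) (-1) (by norm_num) _ hε _ hg)
    refine ⟨γ - ε * (p * γ + γ * p), fun _ => ⟨hy, sub_mem hΓ ((L (-1)).smul_mem _ hy),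
      (p * γ + γ * p) - t ^ n •
        ((γ - ε * (p * γ + γ * p)) * (γ - ε * (p * γ + γ * p))),
      sub_mem hg ((L (-2)).smul_mem _ (hmul (-1) (-1) (-2) (by norm_num) _ hy _ hy)), ?_⟩⟩
    rw [hadd Γ _ hy hΓ, pow_succ']
    exact hs.step (eq_sub_of_add_eq e.symm) (h₁ γ hγ) (h₂ _ hg)
  choose Y hY using hstep
  let G : ℕ → E := fun n => Nat.rec 0 (fun n Γ => Γ - t ^ n • Y n Γ) n
  have hG (n : ℕ) : Q n (G n) := by
    induction n with
    | zero => exact hQ0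
    | succ n ih => exact (hY n (G n) ih).2
  have hGsum (n : ℕ) : G n = -∑ i ∈ Finset.range n, t ^ i • Y i (G i) := by
    induction n with
    | zero => simp [G]
    | succ n ih =>
      have : G (n + 1) = G n - t ^ n • Y n (G n) := rfl
      rw [this, Finset.sum_range_succ, neg_add, ← ih, sub_eq_add_neg]
  obtain ⟨s, hs, hsn⟩ := hcomplete (fun n => Y n (G n)) fun n => (hY n (G n) (hG n)).1
  -- For each $n$ the limit differs from the $n$-th approximation by a multiple of $t^n$, and the
  -- defect of that approximation is itself a multiple of $t^n$. So the defect of the limit is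
  -- divisible by all $t^n$.
  refine ⟨-s, neg_mem hs, hsep _ fun n => ?_⟩
  obtain ⟨z, hz, e⟩ := hsn n
  obtain ⟨hGn, c, hc, hsd⟩ := hG n
  have e' : -s = G n - t ^ n • z := by
    rw [e, hGsum]
    abel
  have hpd' := hsd.pd
  rw [e', hadd _ z hz hGn]
  generalize conj d ε (G n) = δ at *
  have e'' : (1 - t ^ n • (ε * z)) * δ * (1 + t ^ n • (ε * z)) =
      δ + t ^ n • (δ * (ε * z) - ε * z * δ - t ^ n • (ε * z * δ * (ε * z))) := by
    simp only [sub_mul, mul_add, one_mul, mul_one, smul_mul_assoc, mul_smul_comm, smul_sub]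
    abel
  rw [e'']
  generalize δ * (ε * z) - ε * z * δ - t ^ n • (ε * z * δ * (ε * z)) = w
  refine ⟨c + p * w + w * p, ?_⟩
  rw [mul_add, hpd', add_mul, mul_smul_comm, smul_mul_assoc]
  module

end RingLemmas

/-! ### Homomorphisms of DG modules, semi-bases, and lifting through quasiisomorphisms. -/

section HomCalculus

variable {R : Type u} [CommRing R] {A : DGAlg R}

namespace DGMod

/-- The component `M_i → N_j` of a homomorphism of degree `p`. -/
def hApp {M N : DGMod A} {p : ℤ} (f : homX M N p) (i j : ℤ) (h : i + p = j) :
    M.X i →ₗ[R] N.X j := f.1 ⟨(i, j), h⟩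

/-- A homomorphism of degree `p` from its components. -/
def homOf {M N : DGMod A} {p : ℤ} (f : ∀ i j : ℤ, i + p = j → M.X i →ₗ[R] N.X j)
    (hf : ∀ (i j k j' k' : ℤ) (h : i + j = k) (hj : j + p = j') (hk : k + p = k')
      (h' : i + j' = k') (a : A.X i) (m : M.X j),
      f k k' hk (M.smul i j k h a m) = (p * i).negOnePow • N.smul i j' k' h' a (f j j' hj m)) :
    homX M N p :=
  ⟨fun q => f q.1.1 q.1.2 q.2, hf⟩

variable {M N P : DGMod A} {p q r : ℤ}

@[simp]
theorem hApp_homOf (f : ∀ i j : ℤ, i + p = j → M.X i →ₗ[R] N.X j) (hf) (i j : ℤ)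
    (h : i + p = j) (x : M.X i) : hApp (homOf (M := M) (N := N) f hf) i j h x = f i j h x := rfl

theorem hApp_smul (f : homX M N p) {i j k j' k' : ℤ} (h : i + j = k) (hj : j + p = j')
    (hk : k + p = k') (h' : i + j' = k') (a : A.X i) (m : M.X j) :
    hApp f k k' hk (M.smul i j k h a m) =
      (p * i).negOnePow • N.smul i j' k' h' a (hApp f j j' hj m) :=
  f.2 i j k j' k' h hj hk h' a m

@[simp]
theorem hApp_add (f g : homX M N p) (i j : ℤ) (h : i + p = j) (x : M.X i) :
    hApp (f + g) i j h x = hApp f i j h x + hApp g i j h x := rfl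

@[simp]
theorem hApp_sub (f g : homX M N p) (i j : ℤ) (h : i + p = j) (x : M.X i) :
    hApp (f - g) i j h x = hApp f i j h x - hApp g i j h x := rfl

@[simp]
theorem hApp_zero (i j : ℤ) (h : i + p = j) (x : M.X i) :
    hApp (0 : homX M N p) i j h x = 0 := rfl

@[simp]
theorem hApp_const_smul (c : R) (f : homX M N p) (i j : ℤ) (h : i + p = j) (x : M.X i) :
    hApp (c • f) i j h x = c • hApp f i j h x := rfl

@[simp]
theorem hApp_sign_smul (s : ℤˣ) (f : homX M N p) (i j : ℤ) (h : i + p = j) (x : M.X i) :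
    hApp (s • f) i j h x = s • hApp f i j h x := rfl

theorem hApp_ext {f g : homX M N p}
    (h : ∀ (i j : ℤ) (hij : i + p = j) (x : M.X i), hApp f i j hij x = hApp g i j hij x) :
    f = g := by
  refine Subtype.ext (funext fun q => LinearMap.ext fun x => ?_)
  obtain ⟨⟨i, j⟩, hq⟩ := q
  exact h i j hq x

theorem hApp_homD (f : homX M N p) {p' i j i' j' : ℤ} (h : p' + 1 = p) (hq : i + p' = j)
    (hi : i' + 1 = i) (hj : j + 1 = j') (x : M.X i) :
    hApp (homD M N p p' h f) i j hq x =
      N.d j' j hj (hApp f i j' (by omega) x) -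
        p.negOnePow • hApp f i' j (by omega) (M.d i i' hi x) :=
  homDAux_apply M N p p' h f.1 i j i' j' hq hi hj x

/-- Composition of homomorphisms. -/
def hComp (g : homX N P q) (f : homX M N p) (r : ℤ) (h : p + q = r) : homX M P r :=
  homOf (fun i j hij => (hApp g (i + p) j (by omega)).comp (hApp f i (i + p) rfl)) <| by
    intro i j k j' k' hij hj hk h' a m
    simp only [LinearMap.comp_apply]
    rw [hApp_smul f hij rfl rfl (by omega : i + (j + p) = k + p), map_sign,
      hApp_smul g _ (by omega : j + p + q = j') (by omega) h', smul_smul, ← Int.negOnePow_add]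
    congr 2
    subst h
    ring

theorem hApp_hComp (g : homX N P q) (f : homX M N p) (h : p + q = r) {i j k : ℤ}
    (hij : i + r = j) (hk : i + p = k) (x : M.X i) :
    hApp (hComp g f r h) i j hij x = hApp g k j (by omega) (hApp f i k hk x) := by
  subst hk
  rfl

theorem homD_hComp (g : homX N P q) (f : homX M N p) {p' q' r' : ℤ} (h : p + q = r)
    (hp : p' + 1 = p) (hq : q' + 1 = q) (hr : r' + 1 = r) :
    homD M P r r' hr (hComp g f r h) =
      hComp (homD N P q q' hq g) f r' (by omega) +
        q.negOnePow • hComp g (homD M N p p' hp f) r' (by omega) := by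
  refine hApp_ext fun i j hij x => ?_
  rw [hApp_add, hApp_sign_smul, hApp_homD _ hr hij (sub_add_cancel i 1) rfl,
    hApp_hComp g f h _ (k := i + p) rfl, hApp_hComp g f h _ (k := i + p') (by omega),
    hApp_hComp _ f _ _ (k := i + p) rfl, hApp_hComp g _ _ _ (k := i + p') rfl,
    hApp_homD g hq _ (i' := i + p') (by omega) rfl,
    hApp_homD f hp _ (sub_add_cancel i 1) (j' := i + p) (by omega), map_sub, map_sign, smul_sub,
    smul_smul, ← Int.negOnePow_add, add_comm q p, h]
  abel

/-- A morphism of DG modules as a homomorphism of degree zero. -/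
def Hom.toHomX (f : M.Hom N) : homX M N 0 :=
  homOf (fun i j hij => (by obtain rfl : i = j := by omega
                            exact f.app i)) <| by
    intro i j k j' k' hij hj hk h' a m
    obtain rfl : j = j' := by omega
    obtain rfl : k = k' := by omega
    simpa using f.map_smul i j k hij a m

@[simp]
theorem Hom.hApp_toHomX (f : M.Hom N) (i : ℤ) (h : i + 0 = i) (x : M.X i) :
    hApp f.toHomX i i h x = f.app i x := rfl

theorem Hom.homD_toHomX (f : M.Hom N) (h : -1 + 1 = (0 : ℤ)) :
    homD M N 0 (-1) h f.toHomX = 0 := by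
  refine hApp_ext fun i j hij x => ?_
  obtain rfl : j = i - 1 := by omega
  rw [hApp_homD f.toHomX h hij (sub_add_cancel i 1) (sub_add_cancel i 1), Hom.hApp_toHomX,
    Hom.hApp_toHomX, f.map_d]
  simp

/-- The identity as a homomorphism of degree zero. -/
def Hom.id (M : DGMod A) : M.Hom M where
  app _ := LinearMap.id
  map_d _ _ _ _ := rfl
  map_smul _ _ _ _ _ _ := rfl

section SemiBasis

variable {ι : Type u} {deg : ι → ℤ} {e : ∀ s, M.X (deg s)}

open Classical in
/-- The isomorphism of a graded module with a direct sum of shifts of `A` given by a semi-basis. -/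
noncomputable def IsSemiBasis.equiv (hb : M.IsSemiBasis deg e) (n : ℤ) :
    (⨁ s, A.X (n - deg s)) ≃ₗ[R] M.X n :=
  LinearEquiv.ofBijective (DirectSum.toModule R ι (M.X n) fun s =>
    (M.smul (n - deg s) (deg s) n (sub_add_cancel n (deg s))).flip (e s)) (hb n)

open Classical in
theorem IsSemiBasis.equiv_lof (hb : M.IsSemiBasis deg e) (n : ℤ) (s : ι) (a : A.X (n - deg s)) :
    hb.equiv n (DirectSum.lof R ι (fun s => A.X (n - deg s)) s a) =
      M.smul (n - deg s) (deg s) n (sub_add_cancel n (deg s)) a (e s) := by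
  simp [IsSemiBasis.equiv, DirectSum.toModule_lof]

theorem IsSemiBasis.induction (hb : M.IsSemiBasis deg e) {n : ℤ} {Q : M.X n → Prop} (x : M.X n)
    (h0 : Q 0) (hadd : ∀ x y, Q x → Q y → Q (x + y))
    (hsmul : ∀ (s : ι) (i : ℤ) (h : i + deg s = n) (a : A.X i), Q (M.smul i (deg s) n h a (e s))) :
    Q x := by
  classical
  obtain ⟨y, rfl⟩ := (hb.equiv n).surjective x
  induction y using DirectSum.induction_on with
  | zero => rwa [map_zero]
  | of s a =>
    have := hb.equiv_lof n s a
    rw [DirectSum.lof_eq_of] at this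
    rw [this]
    exact hsmul _ _ _ _
  | add x y hx hy => rw [map_add]; exact hadd _ _ hx hy

open Classical in
/-- The linear map on `M_n` with prescribed values on the `a • e s`. -/
noncomputable def IsSemiBasis.desc (hb : M.IsSemiBasis deg e) (n : ℤ) {Z : Type*} [AddCommGroup Z]
    [Module R Z] (φ : ∀ (s : ι) (i : ℤ), i + deg s = n → A.X i →ₗ[R] Z) : M.X n →ₗ[R] Z :=
  (DirectSum.toModule R ι Z fun s => φ s (n - deg s) (sub_add_cancel n (deg s))).comp
    (hb.equiv n).symm.toLinearMap

theorem IsSemiBasis.desc_smul (hb : M.IsSemiBasis deg e) {n : ℤ} {Z : Type*} [AddCommGroup Z]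
    [Module R Z] (φ : ∀ (s : ι) (i : ℤ), i + deg s = n → A.X i →ₗ[R] Z) (s : ι) (i : ℤ)
    (h : i + deg s = n) (a : A.X i) :
    hb.desc n φ (M.smul i (deg s) n h a (e s)) = φ s i h a := by
  classical
  obtain rfl : i = n - deg s := by omega
  rw [← hb.equiv_lof, IsSemiBasis.desc, LinearMap.comp_apply, LinearEquiv.coe_coe,
    LinearEquiv.symm_apply_apply, DirectSum.toModule_lof]

/-- The homomorphism of degree `p` with prescribed values on a semi-basis. -/
noncomputable def IsSemiBasis.lift (hb : M.IsSemiBasis deg e) {N : DGMod A} {p : ℤ}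
    (w : ∀ s, N.X (deg s + p)) : homX M N p :=
  homOf (fun n m h => hb.desc n fun s i hi =>
    (p * i).negOnePow • (N.smul i (deg s + p) m (by omega)).flip (w s)) <| by
    intro i j k j' k' h hj hk h' a m
    induction m using hb.induction with
    | h0 => simp
    | hadd x y hx hy => simp [hx, hy]
    | hsmul s l hl b =>
      rw [← M.mul_smul i l (deg s) (i + l) j k rfl hl (by omega) h, hb.desc_smul, hb.desc_smul]
      simp only [LinearMap.smul_apply, LinearMap.flip_apply]
      rw [N.mul_smul i l _ _ j' k' rfl (by omega) _ h', map_sign, smul_smul, mul_add,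
        Int.negOnePow_add]

theorem IsSemiBasis.lift_smul (hb : M.IsSemiBasis deg e) {N : DGMod A} {p : ℤ}
    (w : ∀ s, N.X (deg s + p)) {n m i : ℤ} (s : ι) (h : n + p = m) (hi : i + deg s = n)
    (a : A.X i) :
    hApp (hb.lift w) n m h (M.smul i (deg s) n hi a (e s)) =
      (p * i).negOnePow • N.smul i (deg s + p) m (by omega) a (w s) := by
  have := hb.desc_smul (n := n) (fun s i hi => (p * i).negOnePow •
    (N.smul i (deg s + p) m (by omega)).flip (w s)) s i hi a
  rw [IsSemiBasis.lift, hApp_homOf, this, LinearMap.smul_apply, LinearMap.flip_apply]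

theorem IsSemiBasis.lift_apply (hb : M.IsSemiBasis deg e) {N : DGMod A} {p : ℤ}
    (w : ∀ s, N.X (deg s + p)) (s : ι) : hApp (hb.lift w) (deg s) (deg s + p) rfl (e s) = w s := by
  have := hb.lift_smul w s rfl (zero_add _) A.one
  rw [M.one_smul, N.one_smul] at this
  simpa using this

/-- Since the algebra vanishes in negative degrees, an element of degree $i$ involves only basis
elements of degree at most $i$. This is what permits induction on the degree of basis elements: the
differential of one of degree $n+1$ is governed by those of degree at most $n$. -/
theorem IsSemiBasis.hApp_eq_of_le (hb : M.IsSemiBasis deg e) {f g : homX M N p} {n : ℤ}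
    (h : ∀ s, deg s ≤ n → hApp f (deg s) _ rfl (e s) = hApp g (deg s) _ rfl (e s)) {i j : ℤ}
    (hi : i ≤ n) (hij : i + p = j) (x : M.X i) : hApp f i j hij x = hApp g i j hij x := by
  induction x using hb.induction with
  | h0 => simp
  | hadd x y hx hy => simp [hx, hy]
  | hsmul s l hl b =>
    rcases lt_or_ge l 0 with hl0 | hl0
    · have := A.subsingleton_of_neg l hl0
      rw [Subsingleton.elim b 0]
      simp
    · rw [hApp_smul f hl rfl hij (by omega), hApp_smul g hl rfl hij (by omega),
        h s (by omega)]

theorem IsSemiBasis.hApp_ext (hb : M.IsSemiBasis deg e) {f g : homX M N p}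
    (h : ∀ s, hApp f (deg s) _ rfl (e s) = hApp g (deg s) _ rfl (e s)) : f = g :=
  DGMod.hApp_ext fun i _ hij x => hb.hApp_eq_of_le (n := i) (fun s _ => h s) le_rfl hij x

end SemiBasis

end DGMod

/-- Recursive construction of a family of data, degree by degree. -/
theorem exists_forall_of_step {ι : Type*} (deg : ι → ℤ) {V : ι → Type*} (b : ℤ)
    (Q : ℤ → (∀ s, V s) → Prop)
    (hloc : ∀ n v v', (∀ s, deg s ≤ n → v s = v' s) → Q n v → Q n v')
    (h0 : ∃ v, Q b v)
    (hstep : ∀ n ≥ b, ∀ v, Q n v → ∃ v', (∀ s, deg s ≤ n → v s = v' s) ∧ Q (n + 1) v') :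
    ∃ v, ∀ n ≥ b, Q n v := by
  obtain ⟨v₀, hv₀⟩ := h0
  have hstep' : ∀ (n : ℕ) (v : ∀ s, V s), ∃ v', Q (b + n) v →
      (∀ s, deg s ≤ b + n → v s = v' s) ∧ Q (b + n + 1) v' := by
    intro n v
    by_cases h : Q (b + n) v
    · obtain ⟨v', h'⟩ := hstep (b + n) (by omega) v h
      exact ⟨v', fun _ => h'⟩
    · exact ⟨v, fun h' => absurd h' h⟩
  choose F hF using hstep'
  let W : ℕ → ∀ s, V s := fun n => Nat.rec v₀ (fun n v => F n v) n
  have hW (n : ℕ) : Q (b + n) (W n) := by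
    induction n with
    | zero =>
      rw [Nat.cast_zero, add_zero]
      exact hv₀
    | succ n ih =>
      have := (hF n (W n) ih).2
      rw [Nat.cast_succ, ← add_assoc]
      exact this
  have hagree (n k : ℕ) (s : ι) (hs : deg s ≤ b + n) : W n s = W (n + k) s := by
    induction k with
    | zero => rfl
    | succ k ih =>
      rw [ih]
      exact (hF (n + k) (W (n + k)) (hW _)).1 s (by push_cast; omega)
  -- Diagonal choice: an index takes its value from the first stage at which that value is frozen.
  -- Truncation sends all degrees below `b` to stage $0$.
  refine ⟨fun s => W (deg s - b).toNat s, fun n hn => ?_⟩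
  obtain ⟨k, rfl⟩ : ∃ k : ℕ, n = b + k := ⟨(n - b).toNat, by omega⟩
  refine hloc _ (W k) _ (fun s hs => ?_) (hW k)
  have : k = (deg s - b).toNat + (k - (deg s - b).toNat) := by omega
  rw [this]
  exact (hagree _ _ s (by omega)).symm

namespace DGMod

variable {M N P : DGMod A} {p : ℤ}

theorem toH_eq_zero_iff (M : DGMod A) {i : ℤ} (x : M.cycles i) :
    M.toH i x = 0 ↔ ∃ y, M.d (i + 1) i rfl y = x.1 :=
  Submodule.Quotient.mk_eq_zero _

theorem Hom.homologyMap_toH (f : M.Hom N) {i : ℤ} (x : M.cycles i) :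
    f.homologyMap i (M.toH i x) = N.toH i (f.cyclesMap i x) := rfl

/-- This is acyclicity of the mapping cone of `f`, written out in components: injectivity on
homology makes `x` a boundary, and surjectivity one degree higher corrects the choice of primitive.
-/
theorem Hom.IsQuasiIso.exists_lift {f : M.Hom N} (hf : f.IsQuasiIso) {i j k m : ℤ} (hj : i + 1 = j)
    (hk : k + 1 = i) (hm : j + 1 = m) {x : M.X i} (hx : M.d i k hk x = 0) {y : N.X j}
    (hy : N.d j i hj y = f.app i x) :
    ∃ (x' : M.X j) (z : N.X m), M.d j i hj x' = x ∧
      f.app j x' - y = N.d m j hm z := by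
  subst hj hm
  have hxc : x ∈ M.cycles i := (M.mem_cycles hk x).2 hx
  have h0 : M.toH i ⟨x, hxc⟩ = 0 := by
    apply (hf i).1
    rw [map_zero, Hom.homologyMap_toH, toH_eq_zero_iff]
    exact ⟨y, hy⟩
  obtain ⟨x₀, hx₀⟩ := (toH_eq_zero_iff M _).1 h0
  have hc : f.app (i + 1) x₀ - y ∈ N.cycles (i + 1) := by
    rw [N.mem_cycles rfl, map_sub, ← f.map_d, hx₀, hy, sub_self]
  obtain ⟨w, hw⟩ := (hf (i + 1)).2 (N.toH _ ⟨_, hc⟩)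
  obtain ⟨w, rfl⟩ := M.toH_surjective _ w
  rw [Hom.homologyMap_toH, ← sub_eq_zero, ← map_sub, toH_eq_zero_iff] at hw
  obtain ⟨z, hz⟩ := hw
  refine ⟨x₀ - w.1, -z, ?_, ?_⟩
  · rw [map_sub, hx₀, (M.mem_cycles rfl _).1 w.2, sub_zero]
  · rw [map_neg, hz, map_sub]
    change _ = -(f.app (i + 1) w.1 - (f.app (i + 1) x₀ - y))
    abel

/-- Homomorphisms from a semi-free module lift through a quasiisomorphism, up to homotopy. -/
theorem exists_homD_eq {F X Y : DGMod A} (hF : F.IsSemiFree) {f : X.Hom Y} (hf : f.IsQuasiIso)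
    {p p' p₁ p₂ : ℤ} (h₀ : p' + 1 = p) (h₁ : p + 1 = p₁) (h₂ : p₁ + 1 = p₂) (φ : homX F X p)
    (hφ : homD F X p p' h₀ φ = 0) (ψ : homX F Y p₁)
    (hψ : homD F Y p₁ p h₁ ψ = hComp f.toHomX φ p (add_zero p)) :
    ∃ (φ' : homX F X p₁) (ψ' : homX F Y p₂), homD F X p₁ p h₁ φ' = φ ∧
      homD F Y p₂ p₁ h₂ ψ' = hComp f.toHomX φ' p₁ (add_zero p₁) - ψ := by
  obtain ⟨⟨b, hbd⟩, ι, deg, e, hb⟩ := hF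
  -- The pair $(\varphi, \psi)$ is a cycle of $\operatorname{Hom}(F, \operatorname{cone} f)$, and a
  -- primitive is sought by its values on the semi-basis. `Q n` says that the two equations hold on
  -- basis elements of degree at most $n$.
  let Q (n : ℤ) (v : ∀ s, X.X (deg s + p₁) × Y.X (deg s + p₂)) : Prop :=
    ∀ s, deg s ≤ n →
      hApp (homD F X p₁ p h₁ (hb.lift fun s => (v s).1)) (deg s) _ rfl (e s) =
        hApp φ (deg s) _ rfl (e s) ∧
      hApp (homD F Y p₂ p₁ h₂ (hb.lift fun s => (v s).2)) (deg s) _ rfl (e s) =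
        hApp (hComp f.toHomX (hb.lift fun s => (v s).1) p₁ (add_zero p₁) - ψ) (deg s) _ rfl (e s)
  have hagree {n : ℤ} {v v' : ∀ s, X.X (deg s + p₁) × Y.X (deg s + p₂)}
      (h : ∀ s, deg s ≤ n → v s = v' s) {i : ℤ} (hi : i ≤ n) (x : F.X i) :
      (∀ j hj, hApp (hb.lift fun s => (v s).1) i j hj x =
        hApp (hb.lift fun s => (v' s).1) i j hj x) ∧
      (∀ j hj, hApp (hb.lift fun s => (v s).2) i j hj x =
        hApp (hb.lift fun s => (v' s).2) i j hj x) := by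
    constructor
    · intro j hj
      refine hb.hApp_eq_of_le (n := n) (fun s hs => ?_) hi hj x
      rw [hb.lift_apply, hb.lift_apply, h s hs]
    · intro j hj
      refine hb.hApp_eq_of_le (n := n) (fun s hs => ?_) hi hj x
      rw [hb.lift_apply, hb.lift_apply, h s hs]
  have hloc : ∀ n v v', (∀ s, deg s ≤ n → v s = v' s) → Q n v → Q n v' := by
    intro n v v' h hQ s hs
    obtain ⟨q₁, q₂⟩ := hQ s hs
    have a₁ := hagree h hs (e s)
    have a₂ := hagree h (by omega : deg s - 1 ≤ n) (F.d _ _ (sub_add_cancel (deg s) 1) (e s))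
    rw [hApp_homD _ h₁ _ (sub_add_cancel (deg s) 1) (by omega : deg s + p + 1 = deg s + p₁)]
      at q₁ ⊢
    rw [hApp_sub, hApp_hComp _ _ _ _ rfl,
      hApp_homD _ h₂ _ (sub_add_cancel (deg s) 1) (by omega : deg s + p₁ + 1 = deg s + p₂)]
      at q₂ ⊢
    rw [← a₁.1, ← a₂.1, ← a₁.2, ← a₂.2]
    exact ⟨q₁, q₂⟩
  -- In degrees at most $b - 1$ the module is zero, so the basis elements there vanish and there is
  -- nothing to solve.
  obtain ⟨v, hv⟩ := exists_forall_of_step deg (b - 1) Q hloc ⟨fun _ => 0, by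
    intro s hs
    have := hbd (deg s) (by omega)
    rw [Subsingleton.elim (e s) 0]
    simp⟩ (by
    intro n _ v hQ
    have key : ∀ s, ∃ u : X.X (deg s + p₁) × Y.X (deg s + p₂), deg s = n + 1 →
        X.d (deg s + p₁) (deg s + p) (by omega) u.1 - p₁.negOnePow •
          hApp (hb.lift fun s => (v s).1) (deg s - 1) _ (by omega)
            (F.d _ _ (sub_add_cancel (deg s) 1) (e s)) = hApp φ (deg s) _ rfl (e s) ∧
        Y.d (deg s + p₂) (deg s + p₁) (by omega) u.2 - p₂.negOnePow •
          hApp (hb.lift fun s => (v s).2) (deg s - 1) _ (by omega)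
            (F.d _ _ (sub_add_cancel (deg s) 1) (e s)) =
              f.app _ u.1 - hApp ψ (deg s) _ rfl (e s) := by
      intro s
      by_cases hs : deg s = n + 1
      swap
      · exact ⟨0, fun h => absurd h hs⟩
      have eq1 := hb.hApp_eq_of_le (fun s hs => (hQ s hs).1) (by omega : deg s - 1 ≤ n)
        (by omega : deg s - 1 + p = deg s + p') (F.d _ _ (sub_add_cancel (deg s) 1) (e s))
      have eq2 := hb.hApp_eq_of_le (fun s hs => (hQ s hs).2) (by omega : deg s - 1 ≤ n)
        (by omega : deg s - 1 + p₁ = deg s + p) (F.d _ _ (sub_add_cancel (deg s) 1) (e s))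
      rw [hApp_homD _ h₁ _ (sub_add_cancel (deg s - 1) 1)
        (by omega : deg s + p' + 1 = deg s + p), F.d_d, map_zero, smul_zero, sub_zero] at eq1
      rw [hApp_homD _ h₂ _ (sub_add_cancel (deg s - 1) 1)
        (by omega : deg s + p + 1 = deg s + p₁), F.d_d, map_zero, smul_zero, sub_zero,
        hApp_sub, hApp_hComp _ _ _ _ (by omega : deg s - 1 + p₁ = deg s + p),
        Hom.hApp_toHomX] at eq2
      have e3 : hApp (homD F X p p' h₀ φ) (deg s) _ rfl (e s) = 0 := by rw [hφ]; rfl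
      rw [hApp_homD _ h₀ _ (sub_add_cancel (deg s) 1)
        (by omega : deg s + p' + 1 = deg s + p)] at e3
      have e4 : hApp (homD F Y p₁ p h₁ ψ) (deg s) _ rfl (e s) =
        hApp (hComp f.toHomX φ p (add_zero p)) (deg s) _ rfl (e s) := by rw [hψ]
      rw [hApp_homD _ h₁ _ (sub_add_cancel (deg s) 1)
        (by omega : deg s + p + 1 = deg s + p₁), hApp_hComp _ _ _ _ rfl, Hom.hApp_toHomX] at e4
      have s₁ : p₁.negOnePow = -p.negOnePow := by rw [← h₁, Int.negOnePow_succ]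
      have s₂ : p₂.negOnePow = -p₁.negOnePow := by rw [← h₂, Int.negOnePow_succ]
      -- The equations at `e s` ask for a primitive, in the cone, of an element built from the
      -- values already chosen on $d(e_s)$. It is a cycle by the induction hypotheses `eq1`, `eq2`
      -- and the cycle conditions `e3`, `e4`.
      obtain ⟨x', z, hx', hz⟩ := hf.exists_lift (i := deg s + p) (j := deg s + p₁)
        (k := deg s + p') (m := deg s + p₂) (by omega) (by omega) (by omega)
        (x := hApp φ (deg s) _ rfl (e s) + p₁.negOnePow •
          hApp (hb.lift fun s => (v s).1) (deg s - 1) _ (by omega)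
            (F.d _ _ (sub_add_cancel (deg s) 1) (e s)))
        (by rw [map_add, map_sign, eq1, sub_eq_zero.1 e3, s₁, Units.neg_smul, add_neg_cancel])
        (y := hApp ψ (deg s) _ rfl (e s) - p₂.negOnePow •
          hApp (hb.lift fun s => (v s).2) (deg s - 1) _ (by omega)
            (F.d _ _ (sub_add_cancel (deg s) 1) (e s)))
        (by
          rw [map_sub, map_sign, eq2, sub_eq_iff_eq_add.1 e4, map_add, map_sign, s₂,
            Units.neg_smul, smul_sub]
          abel)
      refine ⟨(x', z), fun _ => ⟨?_, ?_⟩⟩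
      · rw [hx', add_sub_cancel_right]
      · rw [← hz]
        abel
    choose u hu using key
    have hvv' : ∀ s, deg s ≤ n → v s = if deg s = n + 1 then u s else v s := fun s hs => by
      rw [if_neg (by omega)]
    refine ⟨fun s => if deg s = n + 1 then u s else v s, hvv', fun s hs => ?_⟩
    rcases hs.lt_or_eq with hs | hs
    · exact hloc n v _ hvv' hQ s (by omega)
    · have a₂ := hagree hvv' (by omega : deg s - 1 ≤ n) (F.d _ _ (sub_add_cancel (deg s) 1) (e s))
      rw [hApp_homD _ h₁ _ (sub_add_cancel (deg s) 1) (by omega : deg s + p + 1 = deg s + p₁),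
        hApp_sub, hApp_hComp _ _ _ _ rfl, Hom.hApp_toHomX,
        hApp_homD _ h₂ _ (sub_add_cancel (deg s) 1) (by omega : deg s + p₁ + 1 = deg s + p₂),
        hb.lift_apply, hb.lift_apply, ← a₂.1, ← a₂.2]
      simp only [if_pos hs]
      exact hu s hs)
  refine ⟨hb.lift fun s => (v s).1, hb.lift fun s => (v s).2,
    hb.hApp_ext fun s => ((hv (max (deg s) (b - 1)) (le_max_right _ _)) s (le_max_left _ _)).1,
    hb.hApp_ext fun s => ((hv (max (deg s) (b - 1)) (le_max_right _ _)) s (le_max_left _ _)).2⟩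

end DGMod

end HomCalculus

/-! ### Independence of Ext vanishing from the resolution. -/

section ExtTransfer

variable {R : Type u} [CommRing R] {A : DGAlg R}

theorem Cx.exists_d_eq_of_subsingleton {C : Cx R} {i j k : ℤ} (h : Subsingleton (C.homology i))
    (hj : i + 1 = j) (hk : k + 1 = i) {x : C.X i} (hx : C.d i k hk x = 0) :
    ∃ y, C.d j i hj y = x := by
  subst hj
  have := (Submodule.Quotient.mk_eq_zero ((C.boundaries i).submoduleOf (C.cycles i))).1
    (Subsingleton.elim (Submodule.Quotient.mk ⟨x, (C.mem_cycles hk x).2 hx⟩) 0)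
  exact this

namespace DGMod

variable {M N P Q : DGMod A} {p q r s : ℤ}

theorem hComp_assoc (h : homX P Q r) (g : homX N P q) (f : homX M N p) {pq qr s : ℤ}
    (h₁ : p + q = pq) (h₂ : pq + r = s) (h₃ : q + r = qr) (h₄ : p + qr = s) :
    hComp h (hComp g f pq h₁) s h₂ = hComp (hComp h g qr h₃) f s h₄ := by
  refine hApp_ext fun i j hij x => ?_
  rw [hApp_hComp _ _ _ _ rfl, hApp_hComp _ _ _ _ rfl, hApp_hComp _ _ _ _ rfl,
    hApp_hComp _ _ _ _ (by omega : i + p + q = i + pq)]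

theorem hComp_zero (g : homX N P q) (h : p + q = r) : hComp g (0 : homX M N p) r h = 0 :=
  hApp_ext fun i j hij x => by rw [hApp_hComp _ _ _ _ rfl]; simp

theorem zero_hComp (f : homX M N p) (h : p + q = r) : hComp (0 : homX N P q) f r h = 0 :=
  hApp_ext fun i j hij x => by rw [hApp_hComp _ _ _ _ rfl]; simp

theorem hComp_sub (g : homX N P q) (f f' : homX M N p) (h : p + q = r) :
    hComp g (f - f') r h = hComp g f r h - hComp g f' r h :=
  hApp_ext fun i j hij x => by simp [hApp_hComp _ _ _ _ rfl]

theorem sub_hComp (g g' : homX N P q) (f : homX M N p) (h : p + q = r) :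
    hComp (g - g') f r h = hComp g f r h - hComp g' f r h :=
  hApp_ext fun i j hij x => by simp [hApp_hComp _ _ _ _ rfl]

theorem hComp_id (g : homX M N p) (h : 0 + p = p) : hComp g (Hom.id M).toHomX p h = g :=
  hApp_ext fun i j hij x => by
    rw [hApp_hComp _ _ _ _ (add_zero i), Hom.hApp_toHomX]
    rfl

/-- Vanishing of `Ext` can be tested on endomorphisms of any semi-free resolution. -/
theorem ExtVanishes.exists_homD_eq {F D : DGMod A} (hExt : ExtVanishes D D 2) (hF : F.IsSemiFree)
    {g : F.Hom D} (hg : g.IsQuasiIso) (z : homX F F (-2))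
    (hz : homD F F (-2) (-3) (by norm_num) z = 0) :
    ∃ γ : homX F F (-1), homD F F (-1) (-2) (by norm_num) γ = z := by
  obtain ⟨F₀, hF₀, ⟨f, hf⟩, hs⟩ := hExt
  -- Taking $\varphi = 0$ in the lifting lemma yields comparison chain maps $h : F \to F_0$ and $k :
  -- F_0 \to F$ over $D$, up to homotopy.
  obtain ⟨h, ψ₁, hh, hψ₁⟩ := DGMod.exists_homD_eq hF hf (p := -1) (p' := -2) (p₁ := 0) (p₂ := 1)
    (by norm_num) (by norm_num) (by norm_num) 0 (map_zero _) g.toHomX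
    (by rw [g.homD_toHomX, hComp_zero])
  obtain ⟨k, ψ₂, hk, hψ₂⟩ := DGMod.exists_homD_eq hF₀ hg (p := -1) (p' := -2) (p₁ := 0) (p₂ := 1)
    (by norm_num) (by norm_num) (by norm_num) 0 (map_zero _) f.toHomX
    (by rw [f.homD_toHomX, hComp_zero])
  have hgz : homD F D (-2) (-3) (by norm_num) (hComp g.toHomX z (-2) (by norm_num)) = 0 := by
    rw [homD_hComp _ _ _ (by norm_num : -3 + 1 = (-2 : ℤ)) (by norm_num : -1 + 1 = (0 : ℤ)), hz,
      g.homD_toHomX, hComp_zero, zero_hComp]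
    simp
  -- The hypothesis concerns only $\operatorname{Hom}(F_0, D)$, so the cycle $z$ is moved there as
  -- $g z k$.
  obtain ⟨w, hw⟩ : ∃ w : homX F₀ D (-1), homD F₀ D (-1) (-2) (by norm_num) w =
      hComp (hComp g.toHomX z (-2) (by norm_num)) k (-2) (by norm_num) := by
    refine Cx.exists_d_eq_of_subsingleton (C := homCx F₀ D) (k := -3) hs (by norm_num)
      (by norm_num) ?_
    refine (homD_hComp _ _ _ (by norm_num : -1 + 1 = (0 : ℤ))
      (by norm_num : -3 + 1 = (-2 : ℤ)) _).trans ?_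
    rw [hgz, hk, hComp_zero, zero_hComp]
    simp
    rfl
  -- A homotopy $\theta$ with $\partial\theta = kh - 1$ exists because $g(kh - 1)$ is null-homotopic
  -- and $g$ is a quasiisomorphism.
  obtain ⟨θ, -, hθ, -⟩ := DGMod.exists_homD_eq hF hg (p := 0) (p' := -1) (p₁ := 1) (p₂ := 2)
    (by norm_num) (by norm_num) (by norm_num) (hComp k h 0 (by norm_num) - (Hom.id F).toHomX)
    (by
      rw [map_sub, Hom.homD_toHomX, homD_hComp _ _ _ (by norm_num : -1 + 1 = (0 : ℤ))
        (by norm_num : -1 + 1 = (0 : ℤ)), hh, hk, hComp_zero, zero_hComp]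
      simp)
    (ψ₁ + hComp ψ₂ h 1 (by norm_num))
    (by
      rw [map_add, homD_hComp _ _ _ (by norm_num : -1 + 1 = (0 : ℤ))
        (by norm_num : 0 + 1 = (1 : ℤ)), hh, hComp_zero, hψ₁, hψ₂, sub_hComp, hComp_sub, hComp_id,
        hComp_assoc _ _ _ _ _ (by norm_num : 0 + 0 = (0 : ℤ)) (by norm_num)]
      simp)
  -- From $\partial w = gzk$ follows $gz = \partial(wh - gz\theta)$. Lifting this through $g$ makes
  -- $z$ itself a boundary.
  obtain ⟨γ, -, hγ, -⟩ := DGMod.exists_homD_eq hF hg (p := -2) (p' := -3) (p₁ := -1) (p₂ := 0)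
    (by norm_num) (by norm_num) (by norm_num) z hz
    (hComp w h (-1) (by norm_num) -
      hComp (hComp g.toHomX z (-2) (by norm_num)) θ (-1) (by norm_num))
    (by
      rw [map_sub, homD_hComp _ _ _ (by norm_num : -1 + 1 = (0 : ℤ))
        (by norm_num : -2 + 1 = (-1 : ℤ)), hh, hComp_zero, hw,
        homD_hComp _ _ _ (by norm_num : 0 + 1 = (1 : ℤ))
        (by norm_num : -3 + 1 = (-2 : ℤ)), hgz, hθ, zero_hComp, hComp_sub, hComp_id,
        hComp_assoc _ _ _ _ _ (by norm_num : 0 + -2 = (-2 : ℤ)) (by norm_num),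
        Int.negOnePow_even (-2) ⟨-1, by norm_num⟩]
      simp)
  exact ⟨γ, hγ⟩

end DGMod

end ExtTransfer

/-! ### Free DG modules and graded submodules spanned by part of a semi-basis. -/

section Construction

variable {R : Type u} [CommRing R] {A : DGAlg R}

/-- Transport along an equality of degrees. -/
def Cx.castX (C : Cx R) {i j : ℤ} (h : i = j) : C.X i →ₗ[R] C.X j := by
  subst h
  exact LinearMap.id

@[simp]
theorem Cx.castX_self (C : Cx R) {i : ℤ} (h : i = i) (x : C.X i) : C.castX h x = x := rfl

@[simp]
theorem Cx.castX_castX (C : Cx R) {i j k : ℤ} (h : i = j) (h' : j = k) (x : C.X i) :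
    C.castX h' (C.castX h x) = C.castX (h.trans h') x := by
  subst h h'
  rfl

theorem Cx.castX_d (C : Cx R) {i j k : ℤ} (h : j = k) (hj : j + 1 = i) (x : C.X i) :
    C.castX h (C.d i j hj x) = C.d i k (by omega) x := by
  subst h
  rfl

theorem DGAlg.mul_one (A : DGAlg R) (i : ℤ) (x : A.X i) :
    A.mul i 0 i (add_zero i) x A.one = x := by
  rw [A.mul_comm i 0 i (add_zero i) (zero_add i), A.one_mul, mul_zero, Int.negOnePow_zero]
  exact _root_.one_smul ℤˣ x

theorem DGAlg.mul_castX_one (A : DGAlg R) {i j : ℤ} (hj : 0 = j) (h : i + j = i) (x : A.X i) :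
    A.mul i j i h x (A.castX hj A.one) = x := by
  subst hj
  exact A.mul_one i x

namespace DGMod

variable {M N P : DGMod A} {p q r : ℤ}

theorem hApp_eq_castX (f : homX M N p) {i j : ℤ} (h : i + p = j) (x : M.X i) :
    hApp f i j h x = N.castX h (hApp f i (i + p) rfl x) := by
  subst h
  rfl

/-- A graded submodule of a DG module, with another differential satisfying the Leibniz rule. -/
def ofSubmodule (M : DGMod A) (D : ∀ i j : ℤ, j + 1 = i → M.X i →ₗ[R] M.X j)
    (U : ∀ i, Submodule R (M.X i))
    (hleib : ∀ (i j k i' j' k' : ℤ) (h : i + j = k) (hi : i' + 1 = i) (hj : j' + 1 = j)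
      (hk : k' + 1 = k) (h₁ : i' + j = k') (h₂ : i + j' = k') (a : A.X i) (x : M.X j),
      D k k' hk (M.smul i j k h a x) =
        M.smul i' j k' h₁ (A.d i i' hi a) x + i.negOnePow • M.smul i j' k' h₂ a (D j j' hj x))
    (hsmul : ∀ (i j k : ℤ) (h : i + j = k) (a : A.X i), ∀ x ∈ U j, M.smul i j k h a x ∈ U k)
    (hD : ∀ (i j : ℤ) (h : j + 1 = i), ∀ x ∈ U i, D i j h x ∈ U j)
    (hDD : ∀ (i j k : ℤ) (hj : j + 1 = i) (hk : k + 1 = j), ∀ x ∈ U i,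
      D j k hk (D i j hj x) = 0) : DGMod A where
  X i := U i
  d i j h := (D i j h).restrict (hD i j h)
  d_d i j k hj hk x := Subtype.ext (hDD i j k hj hk x.1 x.2)
  smul i j k h := LinearMap.mk₂ R
    (fun a x => (⟨M.smul i j k h a x.1, hsmul i j k h a x.1 x.2⟩ : U k))
    (fun a a' x => Subtype.ext (LinearMap.map_add₂ _ a a' x.1))
    (fun c a x => Subtype.ext (LinearMap.map_smul₂ _ c a x.1))
    (fun a x x' => Subtype.ext (map_add (M.smul i j k h a) x.1 x'.1))
    (fun c a x => Subtype.ext (map_smul (M.smul i j k h a) c x.1))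
  mul_smul i j k ij jk n hij hjk h₁ h₂ a b x :=
    Subtype.ext (M.mul_smul i j k ij jk n hij hjk h₁ h₂ a b x.1)
  one_smul i x := Subtype.ext (M.one_smul i x.1)
  leibniz i j k i' j' k' h hi hj hk h₁ h₂ a x :=
    Subtype.ext (hleib i j k i' j' k' h hi hj hk h₁ h₂ a x.1)

theorem Hom.isQuasiIso_of {f : M.Hom N}
    (hinj : ∀ (i : ℤ) (x : M.X i), M.d i (i - 1) (sub_add_cancel i 1) x = 0 →
      f.app i x ∈ N.boundaries i → x ∈ M.boundaries i)
    (hsurj : ∀ (i : ℤ), ∀ y ∈ N.cycles i,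
      ∃ x ∈ M.cycles i, y - f.app i x ∈ N.boundaries i) : f.IsQuasiIso := by
  intro i
  constructor
  · rw [injective_iff_map_eq_zero]
    intro z hz
    obtain ⟨x, rfl⟩ := M.toH_surjective i z
    rw [homologyMap_toH, toH_eq_zero_iff] at hz
    rw [toH_eq_zero_iff]
    exact hinj i x.1 ((M.mem_cycles _ _).1 x.2) hz
  · intro z
    obtain ⟨y, rfl⟩ := N.toH_surjective i z
    obtain ⟨x, hx, hxy⟩ := hsurj i y.1 y.2
    refine ⟨M.toH i ⟨x, hx⟩, ?_⟩
    rw [homologyMap_toH, eq_comm, ← sub_eq_zero, ← map_sub, toH_eq_zero_iff]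
    exact hxy

section Free

variable (A) {ι : Type u} (deg : ι → ℤ)

/-- The direct sum of shifts of `A`. -/
noncomputable def free : DGMod A where
  X n := ⨁ s, A.X (n - deg s)
  d n m h := DFinsupp.mapRange.linearMap fun s => A.d (n - deg s) (m - deg s) (by omega)
  d_d i j k hj hk x := DFinsupp.ext fun s => A.d_d _ _ _ _ _ (x s)
  smul i j k h :=
    { toFun := fun a =>
        DFinsupp.mapRange.linearMap fun s => A.mul i (j - deg s) (k - deg s) (by omega) a
      map_add' := fun a b => LinearMap.ext fun x => DFinsupp.ext fun s =>
        LinearMap.map_add₂ (A.mul i (j - deg s) (k - deg s) (by omega)) a b (x s)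
      map_smul' := fun c a => LinearMap.ext fun x => DFinsupp.ext fun s =>
        LinearMap.map_smul₂ (A.mul i (j - deg s) (k - deg s) (by omega)) c a (x s) }
  mul_smul i j k ij jk n hij hjk h₁ h₂ a b x :=
    DFinsupp.ext fun s => A.mul_assoc i j _ ij _ _ hij _ _ _ a b (x s)
  one_smul i x := DFinsupp.ext fun s => A.one_mul _ (x s)
  leibniz i j k i' j' k' h hi hj hk h₁ h₂ a x :=
    DFinsupp.ext fun s => A.leibniz i _ _ i' _ _ (by omega) hi (by omega) _ _ _ a (x s)

open Classical in
/-- The standard semi-basis of a direct sum of shifts of `A`. -/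
noncomputable def freeBasis (s : ι) : (free A deg).X (deg s) :=
  DirectSum.lof R ι (fun s' => A.X (deg s - deg s')) s (A.castX (sub_self (deg s)).symm A.one)

theorem isSemiBasis_freeBasis : (free A deg).IsSemiBasis deg (freeBasis A deg) := by
  classical
  intro n
  have key : (DirectSum.toModule R ι ((free A deg).X n) fun s =>
      ((free A deg).smul (n - deg s) (deg s) n (sub_add_cancel n (deg s))).flip
        (freeBasis A deg s)) = (LinearMap.id : (⨁ s, A.X (n - deg s)) →ₗ[R] _) := by
    refine DirectSum.linearMap_ext R fun s => LinearMap.ext fun a => ?_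
    rw [LinearMap.comp_apply, DirectSum.toModule_lof]
    change (free A deg).smul (n - deg s) (deg s) n (sub_add_cancel n (deg s)) a
      (freeBasis A deg s) = DirectSum.lof R ι (fun s => A.X (n - deg s)) s a
    refine (DFinsupp.mapRange_single (hf := fun _ => map_zero _)).trans ?_
    exact congrArg (DFinsupp.single s) (A.mul_castX_one _ _ a)
  exact (congrArg (fun f : (⨁ s, A.X (n - deg s)) →ₗ[R] (⨁ s, A.X (n - deg s)) =>
    Function.Bijective f) key).mpr Function.bijective_id

end Free

section Span

variable {ι : Type u} {deg : ι → ℤ}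

/-- The graded submodule spanned by the members of a homogeneous family with index in `S`. -/
def gspan (e : ∀ s, M.X (deg s)) (S : Set ι) (n : ℤ) : Submodule R (M.X n) :=
  Submodule.span R {x | ∃ s ∈ S, ∃ (i : ℤ) (h : i + deg s = n) (a : A.X i),
    x = M.smul i (deg s) n h a (e s)}

variable {e : ∀ s, M.X (deg s)} {S : Set ι}

theorem smul_mem_gspan {s : ι} (hs : s ∈ S) {i n : ℤ} (h : i + deg s = n) (a : A.X i) :
    M.smul i (deg s) n h a (e s) ∈ gspan e S n :=
  Submodule.subset_span ⟨s, hs, i, h, a, rfl⟩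

theorem mem_gspan {s : ι} (hs : s ∈ S) : e s ∈ gspan e S (deg s) := by
  rw [← M.one_smul _ (e s)]
  exact smul_mem_gspan hs _ _

theorem gspan_le {n : ℤ} {U : Submodule R (M.X n)}
    (h : ∀ s ∈ S, ∀ (i : ℤ) (h : i + deg s = n) (a : A.X i), M.smul i (deg s) n h a (e s) ∈ U) :
    gspan e S n ≤ U := by
  rw [gspan, Submodule.span_le]
  rintro _ ⟨s, hs, i, hi, a, rfl⟩
  exact h s hs i hi a

theorem gspan_le_of_agree {T : Set ι} {n i : ℤ} (h : ∀ s, deg s ≤ n → s ∈ S → s ∈ T)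
    (hi : i ≤ n) : gspan e S i ≤ gspan e T i := by
  refine gspan_le fun s hs l hl a => ?_
  rcases lt_or_ge l 0 with h0 | h0
  · have := A.subsingleton_of_neg l h0
    rw [Subsingleton.elim a 0]
    simp
  · exact smul_mem_gspan (h s (by omega) hs) _ _

theorem smul_gspan {i j k : ℤ} (h : i + j = k) (a : A.X i) (x : M.X j) (hx : x ∈ gspan e S j) :
    M.smul i j k h a x ∈ gspan e S k := by
  revert x
  change gspan e S j ≤ (gspan e S k).comap (M.smul i j k h a)
  refine gspan_le fun s hs l hl b => ?_
  rw [Submodule.mem_comap, ← M.mul_smul i l (deg s) (i + l) j k rfl hl (by omega) h]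
  exact smul_mem_gspan hs _ _

/-- Basis elements of degree above $n$ contribute nothing in degree $n$, because the algebra is zero
in negative degrees; finitely many images of finite modules remain. -/
theorem gspan_fg (hA : ∀ i, Module.Finite R (A.X i)) {n : ℤ}
    (hS : {s ∈ S | deg s ≤ n}.Finite) : (gspan e S n).FG := by
  have : gspan e S n = ⨆ s ∈ hS.toFinset,
      LinearMap.range ((M.smul (n - deg s) (deg s) n (sub_add_cancel n _)).flip (e s)) := by
    apply le_antisymm
    · refine gspan_le fun s hs l hl b => ?_
      rcases lt_or_ge l 0 with h0 | h0
      · have := A.subsingleton_of_neg l h0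
        rw [Subsingleton.elim b 0]
        simp
      · obtain rfl : l = n - deg s := by omega
        have hs' : s ∈ hS.toFinset := hS.mem_toFinset.2 ⟨hs, by omega⟩
        exact Submodule.mem_iSup_of_mem s (Submodule.mem_iSup_of_mem hs' ⟨b, rfl⟩)
    · refine iSup₂_le fun s hs => ?_
      rintro _ ⟨b, rfl⟩
      exact smul_mem_gspan (hS.mem_toFinset.1 hs).1 _ _
  rw [this]
  refine Submodule.fg_biSup _ _ fun s _ => ?_
  have := hA (n - deg s)
  exact Module.Finite.iff_fg.1 (Module.Finite.range
    ((M.smul (n - deg s) (deg s) n (sub_add_cancel n _)).flip (e s)))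

/-- The part of a semi-basis with index in `S` is a semi-basis of its span. -/
theorem isSemiBasis_ofSubmodule_gspan (hb : M.IsSemiBasis deg e)
    (D : ∀ i j : ℤ, j + 1 = i → M.X i →ₗ[R] M.X j) (hleib) (hsmul) (hD) (hDD) :
    (M.ofSubmodule D (gspan e S) hleib hsmul hD hDD).IsSemiBasis (ι := S) (fun s => deg s.1)
      fun s => ⟨e s.1, mem_gspan s.2⟩ := by
  classical
  let _ : DecidableEq S := fun a b => Classical.propDecidable (a = b)
  intro n
  let F := M.ofSubmodule D (gspan e S) hleib hsmul hD hDD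
  let f : (⨁ s : S, A.X (n - deg s.1)) →ₗ[R] F.X n := DirectSum.toModule R S (F.X n) fun s =>
    (F.smul (n - deg s.1) (deg s.1) n (sub_add_cancel n _)).flip ⟨e s.1, mem_gspan s.2⟩
  -- Extension by zero from `S` to all indices. Through it `f` becomes a restriction of the
  -- coordinate isomorphism of the ambient module, which gives injectivity.
  let g : (⨁ s : S, A.X (n - deg s.1)) →ₗ[R] (⨁ s, A.X (n - deg s)) :=
    DirectSum.toModule R S _ fun s => DirectSum.lof R ι (fun s => A.X (n - deg s)) s.1
  have hf (s : S) (a : A.X (n - deg s.1)) :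
      (f (DirectSum.lof R S (fun s => A.X (n - deg s.1)) s a)).1 =
        M.smul (n - deg s.1) (deg s.1) n (sub_add_cancel n _) a (e s.1) := by
    exact congrArg Subtype.val (DirectSum.toModule_lof R (M := fun s : S => A.X (n - deg s.1))
      (N := F.X n) s a)
  have hfg (x) : (f x).1 = hb.equiv n (g x) := by
    suffices h : (gspan e S n).subtype.comp (show _ →ₗ[R] gspan e S n from f) =
        (hb.equiv n).toLinearMap.comp g from
      LinearMap.congr_fun h x
    refine DirectSum.linearMap_ext R fun s => LinearMap.ext fun a => ?_
    refine (hf s a).trans ?_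
    simp only [LinearMap.comp_apply]
    simp only [g, DirectSum.toModule_lof, LinearEquiv.coe_coe, hb.equiv_lof]
  have hg (x) (s : S) : g x s.1 = x s := by
    suffices h : (DirectSum.component R ι _ s.1).comp g = DirectSum.component R S _ s from
      LinearMap.congr_fun h x
    refine DirectSum.linearMap_ext R fun s' => LinearMap.ext fun a => ?_
    simp only [LinearMap.comp_apply, g, DirectSum.toModule_lof]
    by_cases hs : s' = s
    · subst hs
      rw [DirectSum.component.lof_self, DirectSum.component.lof_self]
    · rw [DirectSum.component.of, DirectSum.component.of, dif_neg hs,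
        dif_neg fun h => hs (Subtype.ext h)]
  change Function.Bijective f
  constructor
  · rw [injective_iff_map_eq_zero]
    intro x hx
    have h0 : g x = 0 := by
      apply (hb.equiv n).injective
      rw [← hfg, hx, map_zero]
      rfl
    refine DFinsupp.ext fun s => ?_
    rw [← hg, h0]
    rfl
  · have : gspan e S n ≤ LinearMap.range
        ((gspan e S n).subtype.comp (show _ →ₗ[R] gspan e S n from f)) := by
      refine gspan_le fun s hs i hi a => ?_
      obtain rfl : i = n - deg s := by omega
      exact ⟨DirectSum.lof R S (fun s => A.X (n - deg s.1)) ⟨s, hs⟩ a, hf ⟨s, hs⟩ a⟩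
    rintro ⟨x, hx⟩
    obtain ⟨y, hy⟩ := this hx
    exact ⟨y, Subtype.ext hy⟩

end Span

end DGMod

end Construction

/-! ### Degreewise finite semi-free resolutions. -/

section Resolution

variable {R : Type u} [CommRing R] {A : DGAlg R}

namespace DGMod

/-- The differential of `M` perturbed by a homomorphism of degree `-1`. -/
def perturb {M : DGMod A} (η : homX M M (-1)) (i j : ℤ) (h : j + 1 = i) : M.X i →ₗ[R] M.X j :=
  M.d i j h + hApp η i j (by omega)

theorem perturb_smul {M : DGMod A} (η : homX M M (-1)) (i j k i' j' k' : ℤ) (h : i + j = k)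
    (hi : i' + 1 = i) (hj : j' + 1 = j) (hk : k' + 1 = k) (h₁ : i' + j = k') (h₂ : i + j' = k')
    (a : A.X i) (x : M.X j) :
    perturb η k k' hk (M.smul i j k h a x) =
      M.smul i' j k' h₁ (A.d i i' hi a) x + i.negOnePow • M.smul i j' k' h₂ a
        (perturb η j j' hj x) := by
  simp only [perturb, LinearMap.add_apply, map_add, smul_add]
  rw [M.leibniz i j k i' j' k' h hi hj hk h₁ h₂, hApp_smul η h (by omega) _ h₂, neg_one_mul,
    Int.negOnePow_neg]
  abel

/-- The square of an odd derivation over a differential is linear. Hence, on a span of basis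
elements, the perturbed differential squares to zero as soon as it does so on those elements. -/
theorem perturb_perturb_smul {M : DGMod A} (η : homX M M (-1)) {i j k j' k' j'' k'' : ℤ}
    (h : i + j = k) (hj : j' + 1 = j) (hk : k' + 1 = k) (hj' : j'' + 1 = j') (hk' : k'' + 1 = k')
    (a : A.X i) (x : M.X j) :
    perturb η k' k'' hk' (perturb η k k' hk (M.smul i j k h a x)) =
      M.smul i j'' k'' (by omega) a (perturb η j' j'' hj' (perturb η j j' hj x)) := by
  rw [perturb_smul η i j k (i - 1) j' k' h (sub_add_cancel i 1) hj hk (by omega) (by omega),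
    map_add, map_sign,
    perturb_smul η (i - 1) j k' (i - 1 - 1) j' k'' (by omega) (sub_add_cancel _ 1) hj hk'
      (by omega) (by omega),
    perturb_smul η i j' k' (i - 1) j'' k'' (by omega) (sub_add_cancel i 1) hj' hk' (by omega)
      (by omega), A.d_d, Int.negOnePow_sub, Int.negOnePow_one, smul_add, smul_smul]
  simp

section Stage

variable {M D : DGMod A} {ι : Type u} {deg : ι → ℤ} {e : ∀ s, M.X (deg s)}

/-- Candidate data for a resolution of `D`: a set of basis elements, their differentials and their
images in `D`. -/
abbrev ResData (M D : DGMod A) (deg : ι → ℤ) :=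
  ∀ s : ι, Prop × M.X (deg s + -1) × D.X (deg s + 0)

/-- The chosen basis elements. -/
def ResData.support (v : ResData M D deg) : Set ι := {s | (v s).1}

/-- The differential given by the data. -/
noncomputable def ResData.diff (v : ResData M D deg) (hb : M.IsSemiBasis deg e) (i j : ℤ)
    (h : j + 1 = i) : M.X i →ₗ[R] M.X j :=
  perturb (hb.lift fun s => (v s).2.1) i j h

/-- The map to `D` given by the data. -/
noncomputable def ResData.map (v : ResData M D deg) (hb : M.IsSemiBasis deg e) (i : ℤ) :
    M.X i →ₗ[R] D.X i :=
  hApp (hb.lift fun s => (v s).2.2) i i (add_zero i)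

/-- The data define a resolution of `D` up to degree `n`. -/
structure ResData.IsStage (v : ResData M D deg) (hb : M.IsSemiBasis deg e) (b n : ℤ) : Prop where
  le_deg : ∀ s ∈ v.support, deg s ≤ n → b ≤ deg s
  finite : {s ∈ v.support | deg s ≤ n}.Finite
  diff_mem : ∀ s ∈ v.support, deg s ≤ n →
    v.diff hb (deg s) (deg s - 1) (sub_add_cancel _ 1) (e s) ∈ gspan e v.support (deg s - 1)
  diff_diff : ∀ s ∈ v.support, deg s ≤ n →
    v.diff hb (deg s - 1) (deg s - 1 - 1) (sub_add_cancel _ 1)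
      (v.diff hb (deg s) (deg s - 1) (sub_add_cancel _ 1) (e s)) = 0
  d_map : ∀ s ∈ v.support, deg s ≤ n →
    D.d (deg s) (deg s - 1) (sub_add_cancel _ 1) (v.map hb (deg s) (e s)) =
      v.map hb (deg s - 1) (v.diff hb (deg s) (deg s - 1) (sub_add_cancel _ 1) (e s))
  surj : ∀ i ≤ n, D.cycles i ≤
    (gspan e v.support i ⊓ LinearMap.ker (v.diff hb i (i - 1) (sub_add_cancel i 1))).map
      (v.map hb i) ⊔ D.boundaries i
  -- The inequality is strict because killing classes of degree $i$ requires basis elements of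
  -- degree $i + 1$.
  inj : ∀ i < n, gspan e v.support i ⊓ LinearMap.ker (v.diff hb i (i - 1) (sub_add_cancel i 1)) ⊓
    (D.boundaries i).comap (v.map hb i) ≤
      (gspan e v.support (i + 1)).map (v.diff hb (i + 1) i rfl)

variable {v v' : ResData M D deg} {n : ℤ}

theorem ResData.diff_eq (hb : M.IsSemiBasis deg e) (h : ∀ s, deg s ≤ n → v s = v' s) {i j : ℤ}
    (hi : i ≤ n) (hj : j + 1 = i) : v.diff hb i j hj = v'.diff hb i j hj := by
  refine LinearMap.ext fun x => congrArg (M.d i j hj x + ·) ?_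
  refine hb.hApp_eq_of_le (fun s hs => ?_) hi _ x
  rw [hb.lift_apply, hb.lift_apply, h s hs]

theorem ResData.map_eq (hb : M.IsSemiBasis deg e) (h : ∀ s, deg s ≤ n → v s = v' s) {i : ℤ}
    (hi : i ≤ n) : v.map hb i = v'.map hb i := by
  refine LinearMap.ext fun x => ?_
  refine hb.hApp_eq_of_le (fun s hs => ?_) hi _ x
  rw [hb.lift_apply, hb.lift_apply, h s hs]

theorem ResData.diff_basis (hb : M.IsSemiBasis deg e) (v : ResData M D deg) (s : ι) {j : ℤ}
    (hj : j + 1 = deg s) : v.diff hb (deg s) j hj (e s) =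
      M.d (deg s) j hj (e s) + M.castX (by omega) (v s).2.1 := by
  rw [ResData.diff, perturb, LinearMap.add_apply, hApp_eq_castX, hb.lift_apply]

theorem ResData.map_basis (hb : M.IsSemiBasis deg e) (v : ResData M D deg) (s : ι) :
    v.map hb (deg s) (e s) = D.castX (add_zero _) (v s).2.2 := by
  rw [ResData.map, hApp_eq_castX, hb.lift_apply]

theorem ResData.gspan_support_eq (h : ∀ s, deg s ≤ n → v s = v' s) {i : ℤ} (hi : i ≤ n) :
    gspan e v.support i = gspan e v'.support i := by
  apply le_antisymm
  · refine gspan_le_of_agree (fun s hs hsv => ?_) hi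
    change (v' s).1
    rw [← h s hs]
    exact hsv
  · refine gspan_le_of_agree (fun s hs hsv => ?_) hi
    change (v s).1
    rw [h s hs]
    exact hsv

theorem ResData.IsStage.congr {hb : M.IsSemiBasis deg e} {b : ℤ}
    (h : ∀ s, deg s ≤ n → v s = v' s) (hv : v.IsStage hb b n) : v'.IsStage hb b n := by
  have hs (s : ι) (hs : deg s ≤ n) (hs' : s ∈ v'.support) : s ∈ v.support := by
    change (v s).1
    rw [h s hs]
    exact hs'
  refine ⟨fun s h₁ h₂ => hv.le_deg s (hs s h₂ h₁) h₂, hv.finite.subset fun s h' =>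
    ⟨hs s h'.2 h'.1, h'.2⟩, fun s h₁ h₂ => ?_, fun s h₁ h₂ => ?_, fun s h₁ h₂ => ?_,
    fun i hi => ?_, fun i hi => ?_⟩
  · have := hv.diff_mem s (hs s h₂ h₁) h₂
    rwa [diff_eq hb h h₂, gspan_support_eq h (by omega)] at this
  · have := hv.diff_diff s (hs s h₂ h₁) h₂
    rwa [diff_eq hb h h₂, diff_eq hb h (by omega)] at this
  · have := hv.d_map s (hs s h₂ h₁) h₂
    rwa [diff_eq hb h h₂, map_eq hb h h₂, map_eq hb h (by omega)] at this
  · have := hv.surj i hi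
    rwa [diff_eq hb h hi, map_eq hb h hi, gspan_support_eq h hi] at this
  · have := hv.inj i hi
    rwa [diff_eq hb h hi.le, diff_eq hb h (by omega), map_eq hb h hi.le, gspan_support_eq h hi.le,
      gspan_support_eq h (by omega)] at this

theorem cycles_le_boundaries_of_subsingleton (D : DGMod A) {i : ℤ}
    (h : Subsingleton (D.homology i)) : D.cycles i ≤ D.boundaries i := fun _ hx =>
  (toH_eq_zero_iff D ⟨_, hx⟩).1 (Subsingleton.elim (α := D.homology i) _ _)

/-- Generators are numbered by an initial segment of `ℕ` so that they can be attached to an index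
set of basis elements fixed in advance. -/
theorem exists_span_image_Iio_eq {N : Type*} [AddCommGroup N] [Module R N] {U : Submodule R N}
    (h : U.FG) : ∃ (k : ℕ) (z : ℕ → N), Submodule.span R (z '' Set.Iio k) = U := by
  obtain ⟨k, f, hf⟩ := Submodule.fg_iff_exists_fin_generating_family.1 h
  refine ⟨k, fun j => if hj : j < k then f ⟨j, hj⟩ else 0, ?_⟩
  rw [← hf]
  congr 1
  ext x
  constructor
  · rintro ⟨j, hj, rfl⟩
    exact ⟨⟨j, hj⟩, by simp [Set.mem_Iio.1 hj]⟩
  · rintro ⟨j, rfl⟩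
    exact ⟨j.1, j.2, dif_pos j.2⟩

theorem exists_span_sup_boundaries (D : DGMod A) {i : ℤ} (h : Module.Finite R (D.H i)) :
    ∃ (k : ℕ) (w : ℕ → D.X i), (∀ j, w j ∈ D.cycles i) ∧
      D.cycles i ≤ Submodule.span R (w '' Set.Iio k) ⊔ D.boundaries i := by
  obtain ⟨k, f, hf⟩ := exists_span_image_Iio_eq h.fg_top
  choose g hg using fun j => D.toH_surjective i (f j)
  refine ⟨k, fun j => (g j).1, fun j => (g j).2, fun x hx => ?_⟩
  have hx' : D.toH i ⟨x, hx⟩ ∈ (Submodule.span R (g '' Set.Iio k)).map (D.toH i) := by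
    rw [Submodule.map_span, ← Set.image_comp, show D.toH i ∘ g = f from funext hg, hf]
    trivial
  obtain ⟨y, hy, hyx⟩ := hx'
  rw [eq_comm, ← sub_eq_zero, ← map_sub, toH_eq_zero_iff] at hyx
  have e : x = y.1 + (x - y.1) := by abel
  rw [e]
  refine Submodule.add_mem_sup ?_ hyx
  have := Submodule.mem_map_of_mem (f := (D.cycles i).subtype) hy
  rwa [Submodule.map_span, ← Set.image_comp] at this

end Stage

/-- The index set for a free module with countably many basis elements of each degree, in two
families. -/
abbrev ResIndex : Type u := ULift.{u} (ℤ × (ℕ ⊕ ℕ))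

/-- The degree of a basis element. -/
abbrev ResIndex.deg (s : ResIndex.{u}) : ℤ := s.down.1

/-- Basis elements of degree $n + 1$ are adjoined for two purposes: to kill the kernel on homology
in degree $n$, and to hit generators of $H_{n+1}(D)$. Everything in degrees at most $n$ stays as it
was. -/
theorem ResData.exists_step [IsNoetherianRing R] (hA : ∀ i, Module.Finite R (A.X i))
    {M D : DGMod A} {e : ∀ s, M.X (ResIndex.deg s)} (hb : M.IsSemiBasis ResIndex.deg e)
    (hH : ∀ i, Module.Finite R (D.H i)) {b n : ℤ} (hn : b - 1 ≤ n) (v : ResData M D ResIndex.deg)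
    (hv : v.IsStage hb b n) :
    ∃ v' : ResData M D ResIndex.deg, (∀ s, ResIndex.deg s ≤ n → v s = v' s) ∧
      v'.IsStage hb b (n + 1) := by
  classical
  obtain ⟨k, z, hz⟩ : ∃ (k : ℕ) (z : ℕ → M.X n), Submodule.span R (z '' Set.Iio k) =
      gspan e v.support n ⊓ LinearMap.ker (v.diff hb n (n - 1) (sub_add_cancel n 1)) ⊓
        (D.boundaries n).comap (v.map hb n) := by
    -- The only use of noetherianity in the construction: the cycles of degree $n$ that become
    -- boundaries in `D` need finitely many generators `z j`.
    have : IsNoetherian R (gspan e v.support n) :=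
      isNoetherian_of_fg_of_noetherian _ (gspan_fg hA hv.finite)
    exact exists_span_image_Iio_eq
      ((isNoetherian_submodule.1 this) _ (inf_le_left.trans inf_le_left))
  have hz' (j : ℕ) (hj : j < k) := hz.le (Submodule.subset_span ⟨j, hj, rfl⟩)
  choose! y hy using fun (j : ℕ) (hj : j < k) => (hz' j hj).2
  obtain ⟨l, w, hw, hwspan⟩ := D.exists_span_sup_boundaries (hH (n + 1))
  -- An element of the first family gets differential `z j` and image `y j`, where $d(y_j)$ is the
  -- image of `z j`; one of the second family is a cycle with image `w j`. Subtracting `M.d` cancels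
  -- the differential of the ambient free module, to which the data are a perturbation.
  let v' : ResData M D ResIndex.deg := fun s =>
    if h : s.down.1 = n + 1 then
      match s.down.2 with
      | .inl j => (j < k, M.castX (by unfold ResIndex.deg; omega) (z j) - M.d _ _ (by omega) (e s),
          D.castX (by unfold ResIndex.deg; omega) (y j))
      | .inr j => (j < l, - M.d _ _ (by omega) (e s),
          D.castX (by unfold ResIndex.deg; omega) (w j))
    else if s.down.1 ≤ n then v s else (False, 0, 0)
  have hvv' (s) (hs : ResIndex.deg s ≤ n) : v s = v' s := by
    unfold ResIndex.deg at hs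
    simp only [v']
    rw [dif_neg (by omega), if_pos hs]
  have h₁ (j : ℕ) : v' ⟨(n + 1, .inl j)⟩ = (j < k,
      M.castX (show n = n + 1 + -1 by omega) (z j) -
        M.d (n + 1) (n + 1 + -1) (by omega) (e ⟨(n + 1, .inl j)⟩),
      D.castX (add_zero (n + 1)).symm (y j)) := dif_pos rfl
  have h₂ (j : ℕ) : v' ⟨(n + 1, .inr j)⟩ = (j < l,
      - M.d (n + 1) (n + 1 + -1) (by omega) (e ⟨(n + 1, .inr j)⟩),
      D.castX (add_zero (n + 1)).symm (w j)) := dif_pos rfl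
  have hd₁ (j : ℕ) : v'.diff hb (n + 1) n rfl (e ⟨(n + 1, .inl j)⟩) = z j := by
    refine (v'.diff_basis hb ⟨(n + 1, .inl j)⟩ rfl).trans ?_
    rw [h₁, map_sub, Cx.castX_castX, Cx.castX_self, Cx.castX_d]
    exact add_sub_cancel _ _
  have hd₂ (j : ℕ) : v'.diff hb (n + 1) n rfl (e ⟨(n + 1, .inr j)⟩) = 0 := by
    refine (v'.diff_basis hb ⟨(n + 1, .inr j)⟩ rfl).trans ?_
    rw [h₂, map_neg, Cx.castX_d]
    exact add_neg_cancel _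
  have hm₁ (j : ℕ) : v'.map hb (n + 1) (e ⟨(n + 1, .inl j)⟩) = y j := by
    refine (v'.map_basis hb ⟨(n + 1, .inl j)⟩).trans ?_
    rw [h₁, Cx.castX_castX, Cx.castX_self]
  have hm₂ (j : ℕ) : v'.map hb (n + 1) (e ⟨(n + 1, .inr j)⟩) = w j := by
    refine (v'.map_basis hb ⟨(n + 1, .inr j)⟩).trans ?_
    rw [h₂, Cx.castX_castX, Cx.castX_self]
  have hs₁ (j : ℕ) : (⟨(n + 1, .inl j)⟩ : ResIndex) ∈ v'.support ↔ j < k := by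
    change (v' _).1 ↔ _
    rw [h₁]
  have hs₂ (j : ℕ) : (⟨(n + 1, .inr j)⟩ : ResIndex) ∈ v'.support ↔ j < l := by
    change (v' _).1 ↔ _
    rw [h₂]
  have hst := hv.congr hvv'
  rw [v.diff_eq hb hvv' le_rfl, v.map_eq hb hvv' le_rfl, v.gspan_support_eq hvv' le_rfl] at hz hz'
  rw [v.map_eq hb hvv' le_rfl] at hy
  refine ⟨v', hvv', ?_⟩
  clear_value v'
  -- a basis element of degree `n + 1` belongs to one of the two families
  have hcases {Q : ∀ s : ResIndex, Prop} (h₁ : ∀ s ∈ v'.support, ResIndex.deg s ≤ n → Q s)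
      (h₂ : ∀ j, j < k → Q ⟨(n + 1, .inl j)⟩) (h₃ : ∀ j, j < l → Q ⟨(n + 1, .inr j)⟩) :
      ∀ s ∈ v'.support, ResIndex.deg s ≤ n + 1 → Q s := by
    rintro ⟨⟨m, c⟩⟩ hs hsn
    rcases hsn.lt_or_eq with h | h
    · exact h₁ _ hs (by omega)
    · change m = n + 1 at h
      subst h
      rcases c with j | j
      · exact h₂ j ((hs₁ j).1 hs)
      · exact h₃ j ((hs₂ j).1 hs)
  refine ⟨hcases hst.le_deg (fun _ _ => ?_) (fun _ _ => ?_), ?_, ?_, ?_, ?_, ?_, ?_⟩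
  · change b ≤ n + 1
    omega
  · change b ≤ n + 1
    omega
  · let T : Set ResIndex := {s ∈ v'.support | ResIndex.deg s ≤ n} ∪
      (fun j => ⟨(n + 1, .inl j)⟩) '' Set.Iio k ∪ (fun j => ⟨(n + 1, .inr j)⟩) '' Set.Iio l
    refine Set.Finite.subset (s := T) ((hst.finite.union ((Set.finite_Iio k).image _)).union
      ((Set.finite_Iio l).image _)) fun s hs => ?_
    exact hcases (Q := fun s => s ∈ T) (fun s hs hsn => Or.inl (Or.inl ⟨hs, hsn⟩))
      (fun j hj => Or.inl (Or.inr ⟨j, hj, rfl⟩)) (fun j hj => Or.inr ⟨j, hj, rfl⟩) s hs.1 hs.2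
  · have key₁ (j : ℕ) (hj : j < k) (i : ℤ) (hi : i + 1 = n + 1) :
        v'.diff hb (n + 1) i hi (e ⟨(n + 1, .inl j)⟩) ∈ gspan e v'.support i := by
      obtain rfl : i = n := by omega
      rw [hd₁]
      exact (hz' j hj).1.1
    have key₂ (j : ℕ) (i : ℤ) (hi : i + 1 = n + 1) :
        v'.diff hb (n + 1) i hi (e ⟨(n + 1, .inr j)⟩) ∈ gspan e v'.support i := by
      obtain rfl : i = n := by omega
      rw [hd₂]
      exact zero_mem _
    exact hcases hst.diff_mem (fun j hj => key₁ j hj _ _) (fun j _ => key₂ j _ _)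
  · have key₁ (j : ℕ) (hj : j < k) (i l : ℤ) (hi : i + 1 = n + 1) (hl : l + 1 = i) :
        v'.diff hb i l hl (v'.diff hb (n + 1) i hi (e ⟨(n + 1, .inl j)⟩)) = 0 := by
      obtain rfl : i = n := by omega
      obtain rfl : l = i - 1 := by omega
      rw [hd₁]
      exact (hz' j hj).1.2
    have key₂ (j : ℕ) (i l : ℤ) (hi : i + 1 = n + 1) (hl : l + 1 = i) :
        v'.diff hb i l hl (v'.diff hb (n + 1) i hi (e ⟨(n + 1, .inr j)⟩)) = 0 := by
      obtain rfl : i = n := by omega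
      rw [hd₂, map_zero]
    exact hcases hst.diff_diff (fun j hj => key₁ j hj _ _ _ _) (fun j _ => key₂ j _ _ _ _)
  · have key₁ (j : ℕ) (hj : j < k) (i : ℤ) (hi : i + 1 = n + 1) :
        D.d (n + 1) i hi (v'.map hb (n + 1) (e ⟨(n + 1, .inl j)⟩)) =
          v'.map hb i (v'.diff hb (n + 1) i hi (e ⟨(n + 1, .inl j)⟩)) := by
      obtain rfl : i = n := by omega
      rw [hd₁, hm₁]
      exact hy j hj
    have key₂ (j : ℕ) (i : ℤ) (hi : i + 1 = n + 1) :
        D.d (n + 1) i hi (v'.map hb (n + 1) (e ⟨(n + 1, .inr j)⟩)) =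
          v'.map hb i (v'.diff hb (n + 1) i hi (e ⟨(n + 1, .inr j)⟩)) := by
      obtain rfl : i = n := by omega
      rw [hd₂, hm₂, map_zero]
      exact (D.mem_cycles hi _).1 (hw j)
    exact hcases hst.d_map (fun j hj => key₁ j hj _ _) (fun j _ => key₂ j _ _)
  · intro i hi
    rcases hi.lt_or_eq with hi | rfl
    · exact hst.surj i (by omega)
    · refine hwspan.trans (sup_le_sup_right ?_ _)
      rw [Submodule.span_le]
      rintro _ ⟨j, hj, rfl⟩
      refine ⟨e ⟨(n + 1, .inr j)⟩, ⟨mem_gspan ((hs₂ j).2 hj), ?_⟩, hm₂ j⟩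
      have key (i : ℤ) (hi : i + 1 = n + 1) :
          v'.diff hb (n + 1) i hi (e ⟨(n + 1, .inr j)⟩) = 0 := by
        obtain rfl : i = n := by omega
        exact hd₂ j
      exact key _ _
  · intro i hi
    rcases (Int.lt_add_one_iff.1 hi).lt_or_eq with hi | rfl
    · exact hst.inj i hi
    · rw [← hz, Submodule.span_le]
      rintro _ ⟨j, hj, rfl⟩
      exact ⟨e ⟨(i + 1, .inl j)⟩, mem_gspan ((hs₁ j).2 hj), hd₁ j⟩

/-- Since $A_0$ maps onto $H_0(A)$, generators over $H_0(A)$ give a surjection onto the homology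
from a finite power of $A_0$, which is finite over $R$. -/
theorem finite_H_of_isHomologicallyDegreewiseFinite (hA : Module.Finite R (A.X 0)) (D : DGMod A)
    (hD : D.IsHomologicallyDegreewiseFinite) (i : ℤ) : Module.Finite R (D.H i) := by
  obtain ⟨k, f, hf⟩ := Submodule.fg_iff_exists_fin_generating_family.1 (hD i).fg_top
  let g : (Fin k → A.X 0) →ₗ[R] D.H i :=
    ∑ j, (show A.X 0 →ₗ[R] D.H i from
      { toFun := fun a => D.smulHomology i a (f j)
        map_add' := fun a b => congrArg (fun φ : Module.End R (D.H i) => φ (f j))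
          ((D.actionDegZero i).map_add a b)
        map_smul' := fun c a => by
          obtain ⟨x, hx⟩ := D.toH_surjective i (f j)
          rw [← hx]
          exact congrArg (D.toH i) (Subtype.ext
            (LinearMap.map_smul₂ (D.smul 0 i i (zero_add i)) c a x.1)) }).comp (LinearMap.proj j)
  refine Module.Finite.of_surjective g fun z => ?_
  have hz : z ∈ Submodule.span A.H0 (Set.range f) := by
    rw [hf]
    trivial
  obtain ⟨c, rfl⟩ := (Submodule.mem_span_range_iff_exists_fun _).1 hz
  choose a ha using fun j => Ideal.Quotient.mk_surjective (c j)
  refine ⟨a, (LinearMap.sum_apply _ _ (show Fin k → A.X 0 from a)).trans ?_⟩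
  refine Finset.sum_congr rfl fun j _ => ?_
  rw [← ha]
  rfl

/-- Every DG module with bounded below and degreewise finite homology has a semi-free resolution
which is finitely generated in each degree. -/
theorem exists_finite_resolution [IsNoetherianRing R] (hA : ∀ i, Module.Finite R (A.X i))
    (D : DGMod A) (hD : D.IsHomologicallyBoundedBelow) (hH : ∀ i, Module.Finite R (D.H i)) :
    ∃ F : DGMod A, F.IsSemiFree ∧ (∀ i, Module.Finite R (F.X i)) ∧
      ∃ g : F.Hom D, g.IsQuasiIso := by
  obtain ⟨b, hbd⟩ := hD
  -- A fixed ambient module with infinitely many basis elements in each degree. The resolution is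
  -- the span of the chosen ones, with a perturbed differential that need square to zero only there.
  let M : DGMod A := free A ResIndex.deg.{u}
  let e := freeBasis A ResIndex.deg.{u}
  have hb : M.IsSemiBasis ResIndex.deg e := isSemiBasis_freeBasis A _
  obtain ⟨v, hv⟩ : ∃ v : ResData M D ResIndex.deg, ∀ n ≥ b - 1, v.IsStage hb b n :=
    exists_forall_of_step ResIndex.deg (b - 1)
    (fun n (v : ResData M D ResIndex.deg) => v.IsStage hb b n)
    (fun n v v' h hv => hv.congr h)
    ⟨fun _ => (False, 0, 0), by
      -- At stage $b - 1$ no basis element is chosen; the homology of `D` vanishes up to that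
      -- degree, so this is already a resolution there.
      have hs (i : ℤ) : gspan e (ResData.support (fun _ => (False, 0, 0) :
          ResData M D ResIndex.deg)) i = ⊥ :=
        le_bot_iff.1 (gspan_le fun _ h => h.elim)
      refine ⟨fun _ h => h.elim, ?_, fun _ h => h.elim, fun _ h => h.elim, fun _ h => h.elim,
        fun i hi => ?_, fun i hi => ?_⟩
      · exact Set.finite_empty.subset fun _ h => h.1
      · exact (cycles_le_boundaries_of_subsingleton D (hbd i (by omega))).trans le_sup_right
      · rw [hs]
        exact (inf_le_left.trans inf_le_left).trans bot_le⟩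
    (fun n hn v hv => ResData.exists_step hA hb hH hn v hv)
  have hv' (i : ℤ) : v.IsStage hb b (max i (b - 1)) := hv _ (le_max_right _ _)
  have hleib := perturb_smul (hb.lift fun s => (v s).2.1)
  have hdiff (i j : ℤ) (h : j + 1 = i) :
      gspan e v.support i ≤ (gspan e v.support j).comap (v.diff hb i j h) := by
    refine gspan_le fun s hs l hl a => ?_
    rw [Submodule.mem_comap, ResData.diff,
      hleib l (ResIndex.deg s) i (l - 1) (ResIndex.deg s - 1) j hl
      (sub_add_cancel _ 1) (sub_add_cancel _ 1) h (by omega) (by omega)]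
    exact add_mem (smul_mem_gspan hs _ _) (sign_mem _ _ (smul_gspan _ _ _
      ((hv' (ResIndex.deg s)).diff_mem s hs (le_max_left _ _))))
  have hdd (i j k : ℤ) (hj : j + 1 = i) (hk : k + 1 = j) : gspan e v.support i ≤
      LinearMap.ker ((v.diff hb j k hk).comp (v.diff hb i j hj)) := by
    refine gspan_le fun s hs l hl a => ?_
    rw [LinearMap.mem_ker, LinearMap.comp_apply, ResData.diff, ResData.diff,
      perturb_perturb_smul _ hl (sub_add_cancel _ 1) hj (sub_add_cancel _ 1) hk]
    have := (hv' (ResIndex.deg s)).diff_diff s hs (le_max_left _ _)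
    rw [ResData.diff, ResData.diff] at this
    rw [this, map_zero]
  have hmap_smul (i j k : ℤ) (h : i + j = k) (a : A.X i) (x : M.X j) :
      v.map hb k (M.smul i j k h a x) = D.smul i j k h a (v.map hb j x) := by
    rw [ResData.map, hApp_smul _ h (add_zero j) (add_zero k) h]
    simp [ResData.map]
  have hdmap (i j : ℤ) (h : j + 1 = i) : gspan e v.support i ≤
      LinearMap.eqLocus ((D.d i j h).comp (v.map hb i)) ((v.map hb j).comp (v.diff hb i j h)) := by
    refine gspan_le fun s hs l hl a => ?_
    rw [LinearMap.mem_eqLocus, LinearMap.comp_apply, LinearMap.comp_apply, hmap_smul,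
      D.leibniz l (ResIndex.deg s) i (l - 1) (ResIndex.deg s - 1) j hl
        (sub_add_cancel _ 1) (sub_add_cancel _ 1) h
        (by omega) (by omega), ResData.diff,
      hleib l (ResIndex.deg s) i (l - 1) (ResIndex.deg s - 1) j hl
        (sub_add_cancel _ 1) (sub_add_cancel _ 1) h
        (by omega) (by omega), map_add, map_sign, hmap_smul, hmap_smul,
      (hv' (ResIndex.deg s)).d_map s hs (le_max_left _ _), ResData.diff]
  let F : DGMod A := M.ofSubmodule (v.diff hb) (gspan e v.support) hleib
    (fun i j k h a x hx => smul_gspan h a x hx) hdiff hdd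
  let g : F.Hom D :=
    { app := fun i => (v.map hb i).comp (gspan e v.support i).subtype
      map_d := fun i j h x => (hdmap i j h x.2).symm
      map_smul := fun i j k h a x => hmap_smul i j k h a x.1 }
  refine ⟨F, ⟨⟨b, fun i hi => ?_⟩, _, _, _, isSemiBasis_ofSubmodule_gspan hb _ _ _ _ _⟩,
    fun i => ?_, g, Hom.isQuasiIso_of (fun i x hx hgx => ?_) fun i y hy => ?_⟩
  · have : gspan e v.support i ≤ ⊥ := gspan_le fun s hs l hl a => by
      have h1 := (hv' (ResIndex.deg s)).le_deg s hs (le_max_left _ _)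
      have := A.subsingleton_of_neg l (by omega)
      rw [Subsingleton.elim a 0]
      simp
    exact ⟨fun x y => Subtype.ext ((this x.2).trans (this y.2).symm)⟩
  · exact Module.Finite.iff_fg.2 (gspan_fg hA ((hv' i).finite.subset fun s hs =>
      ⟨hs.1, hs.2.trans (le_max_left _ _)⟩))
  · obtain ⟨y, hy, hyx⟩ := (hv' (i + 1)).inj i (by omega) ⟨⟨x.2, congrArg Subtype.val hx⟩, hgx⟩
    exact ⟨⟨y, hy⟩, Subtype.ext hyx⟩
  · obtain ⟨_, ⟨x, ⟨hx, hdx⟩, rfl⟩, z, hz, e⟩ := Submodule.mem_sup.1 ((hv' i).surj i (by omega) hy)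
    refine ⟨⟨x, hx⟩, Subtype.ext hdx, ?_⟩
    rw [← e]
    change v.map hb i x + z - v.map hb i x ∈ _
    rwa [add_sub_cancel_left]

end DGMod

end Resolution

/-! ### The contraction of $K \otimes A$ along the Koszul generator. -/

section Contraction

variable {R : Type u} [CommRing R]

/-- The map `κ ⊗ 1` on a tensor product of complexes, for `κ` of degree `-1`. -/
def Cx.tensorContr (C E : Cx R) (κ : ∀ i j : ℤ, j + 1 = i → C.X i →ₗ[R] C.X j) (n m : ℤ)
    (h : m + 1 = n) : Cx.TensorX C E n →ₗ[R] Cx.TensorX C E m :=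
  Cx.tlift C E n fun i j hij =>
    (Cx.tmk C E (i - 1) j m (by omega)).comp (κ i (i - 1) (sub_add_cancel i 1))

namespace Cx

variable {C E : Cx R} {κ : ∀ i j : ℤ, j + 1 = i → C.X i →ₗ[R] C.X j}

theorem tensorContr_tmk {n m i j i' : ℤ} (h : m + 1 = n) (hij : i + j = n) (hi : i' + 1 = i)
    (x : C.X i) (a : E.X j) :
    tensorContr C E κ n m h (tmk C E i j n hij x a) =
      tmk C E i' j m (by omega) (κ i i' hi x) a := by
  obtain rfl : i' = i - 1 := by omega
  exact tlift_tmk _ _ _ _ _ _ _ _ _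

theorem tensorContr_tensorContr
    (hκ : ∀ (i j k : ℤ) (hj : j + 1 = i) (hk : k + 1 = j) (x : C.X i), κ j k hk (κ i j hj x) = 0)
    {n m l : ℤ} (h : m + 1 = n) (h' : l + 1 = m) (z : TensorX C E n) :
    tensorContr C E κ m l h' (tensorContr C E κ n m h z) = 0 := by
  induction z using tensor_induction with
  | h0 => simp
  | hadd x y hx hy => simp [hx, hy]
  | hmk i j hij x a =>
    rw [tensorContr_tmk h hij (sub_add_cancel i 1), tensorContr_tmk h' _ (sub_add_cancel (i - 1) 1),
      hκ]
    simp

theorem tensorContr_tensorD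
    (hκ : ∀ (i j k : ℤ) (hj : j + 1 = i) (hk : k + 1 = j) (x : C.X i),
      κ j k hk (C.d i j hj x) + C.d j k hk (κ i j hj x) = 0)
    {n m l : ℤ} (h : m + 1 = n) (h' : l + 1 = m) (z : TensorX C E n) :
    tensorContr C E κ m l h' (tensorD C E n m h z) +
      tensorD C E m l h' (tensorContr C E κ n m h z) = 0 := by
  induction z using tensor_induction with
  | h0 => simp
  | hadd x y hx hy =>
    simp only [map_add]
    rw [add_add_add_comm, hx, hy, add_zero]
  | hmk i j hij x a =>
    have e : (i - 1).negOnePow = - i.negOnePow := by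
      rw [Int.negOnePow_sub, Int.negOnePow_one]; simp
    rw [tensorD_tmk C E h hij (sub_add_cancel i 1) (sub_add_cancel j 1), map_add, map_sign,
      tensorContr_tmk h hij (sub_add_cancel i 1),
      tensorContr_tmk h' _ (sub_add_cancel (i - 1) 1), tensorContr_tmk h' _ (sub_add_cancel i 1),
      tensorD_tmk C E h' _ (sub_add_cancel (i - 1) 1) (sub_add_cancel j 1), e,
      eq_neg_of_add_eq_zero_left (hκ _ _ _ (sub_add_cancel i 1) (sub_add_cancel (i - 1) 1) x)]
    simp only [map_neg, LinearMap.neg_apply, Units.neg_smul]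
    abel

end Cx

theorem DGAlg.tensorContr_tensorMul {K A : DGAlg R}
    {κ : ∀ i j : ℤ, j + 1 = i → K.X i →ₗ[R] K.X j}
    (hκ : ∀ (i j k i' j' k' : ℤ) (h : i + j = k) (hi : i' + 1 = i) (hj : j' + 1 = j)
      (hk : k' + 1 = k) (h₁ : i' + j = k') (h₂ : i + j' = k') (x : K.X i) (y : K.X j),
      κ k k' hk (K.mul i j k h x y) =
        K.mul i' j k' h₁ (κ i i' hi x) y + i.negOnePow • K.mul i j' k' h₂ x (κ j j' hj y))
    (i j k i' j' k' : ℤ) (h : i + j = k) (hi : i' + 1 = i) (hj : j' + 1 = j)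
    (hk : k' + 1 = k) (h₁ : i' + j = k') (h₂ : i + j' = k')
    (x : Cx.TensorX K.toCx A.toCx i) (y : Cx.TensorX K.toCx A.toCx j) :
    Cx.tensorContr K.toCx A.toCx κ k k' hk (tensorMul K A i j k h x y) =
      tensorMul K A i' j k' h₁ (Cx.tensorContr K.toCx A.toCx κ i i' hi x) y +
        i.negOnePow • tensorMul K A i j' k' h₂ x (Cx.tensorContr K.toCx A.toCx κ j j' hj y) := by
  induction x using Cx.tensor_induction with
  | h0 => simp
  | hadd x y hx hy =>
    simp only [map_add, LinearMap.add_apply, hx, hy, smul_add]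
    abel
  | hmk p q hpq x a =>
  induction y using Cx.tensor_induction with
  | h0 => simp
  | hadd x y hx hy =>
    simp only [map_add, hx, hy, smul_add]
    abel
  | hmk r s hrs y b =>
  have e₁ : p - 1 + r + 1 = p + r := by ring
  rw [tensorMul_tmk K A h hpq hrs rfl rfl, map_sign, Cx.tensorContr_tmk hk _ e₁,
    Cx.tensorContr_tmk hi hpq (sub_add_cancel p 1), Cx.tensorContr_tmk hj hrs (sub_add_cancel r 1),
    hκ p r _ (p - 1) (r - 1) _ rfl (sub_add_cancel p 1) (sub_add_cancel r 1) e₁ rfl (by ring),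
    tensorMul_tmk K A _ _ hrs (p := p - 1 + r) (q := q + s) rfl rfl,
    tensorMul_tmk K A _ hpq _ (p := p - 1 + r) (q := q + s) (by ring) rfl]
  simp only [map_add, map_sign₂, LinearMap.add_apply, smul_add, smul_smul, ← Int.negOnePow_add]
  have s₂ : (q * r + p).negOnePow = (i + q * (r - 1)).negOnePow := by
    rw [← hpq, Int.negOnePow_eq_iff]
    exact ⟨0, by ring⟩
  rw [s₂]

/-- A presentation of `f : A → B` as the adjunction of an exterior variable `e` with `d e = t`:
a derivation of `B` of degree `-1` that anticommutes with the differential, takes `e` to `1`, and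
whose kernel is `A`. -/
structure DGAlg.Contraction {A B : DGAlg R} (f : A.Hom B) (t : R) where
  contr : ∀ n m : ℤ, m + 1 = n → B.X n →ₗ[R] B.X m
  contr_contr : ∀ (n m l : ℤ) (h : m + 1 = n) (h' : l + 1 = m) (b : B.X n),
    contr m l h' (contr n m h b) = 0
  contr_d : ∀ (n m l : ℤ) (h : m + 1 = n) (h' : l + 1 = m) (b : B.X n),
    contr m l h' (B.d n m h b) + B.d m l h' (contr n m h b) = 0
  contr_mul : ∀ (i j k i' j' k' : ℤ) (h : i + j = k) (hi : i' + 1 = i) (hj : j' + 1 = j)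
    (hk : k' + 1 = k) (h₁ : i' + j = k') (h₂ : i + j' = k') (x : B.X i) (y : B.X j),
    contr k k' hk (B.mul i j k h x y) =
      B.mul i' j k' h₁ (contr i i' hi x) y + i.negOnePow • B.mul i j' k' h₂ x (contr j j' hj y)
  e : B.X 1
  contr_e : contr 1 0 rfl e = B.one
  d_e : B.d 1 0 rfl e = t • B.one
  contr_app : ∀ (n m : ℤ) (h : m + 1 = n) (a : A.X n), contr n m h (f.app n a) = 0
  app_injective : ∀ n, Function.Injective (f.app n)
  exists_eq : ∀ (n m : ℤ) (h : 1 + m = n) (b : B.X n),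
    ∃ (a : A.X n) (a' : A.X m), b = f.app n a + B.mul 1 m n h e (f.app m a')

namespace DGAlg

/-- Two parameters are allowed because the contraction $e \mapsto 1$ is the Koszul differential with
parameter $1$. This gives both that it squares to zero and that it anticommutes with the
differential with parameter $t$. -/
theorem koszulD_koszulD (r s : R) {i j k : ℤ} (h : j + 1 = i) (h' : k + 1 = j)
    (x : koszulX R i) : koszulD r j k h' (koszulD s i j h x) = 0 := by
  ext
  rw [coe_koszulD, coe_koszulD]
  by_cases hj : j = 1
  · rw [if_pos hj, if_neg (by omega), mul_zero]
    rfl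
  · rw [if_neg hj]
    rfl

/-- The map `e ↦ 1` of degree `-1` on the Koszul complex. -/
def koszulContr (t : R) (i j : ℤ) (h : j + 1 = i) : (koszul t).X i →ₗ[R] (koszul t).X j :=
  koszulD (1 : R) i j h

/-- The generator of degree one of the Koszul complex. -/
def koszulGen (t : R) : (koszul t).X 1 := (⟨1, fun _ h => absurd rfl h⟩ : koszulX R 1)

theorem koszulD_koszulGen (s t : R) : koszulD s 1 0 rfl (koszulGen t) = s • (koszul t).one :=
  Subtype.ext ((coe_koszulD s 1 0 rfl _).trans (if_pos rfl))

theorem koszul_eq_smul_one (t : R) (x : (koszul t).X 0) : ∃ r : R, x = r • (koszul t).one :=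
  ⟨x.1, Subtype.ext (_root_.mul_one x.1).symm⟩

theorem koszul_eq_smul_gen (t : R) (x : (koszul t).X 1) : ∃ r : R, x = r • koszulGen t :=
  ⟨x.1, Subtype.ext (_root_.mul_one x.1).symm⟩

theorem koszul_eq_zero (t : R) {i : ℤ} (h₀ : i ≠ 0) (h₁ : i ≠ 1) (x : (koszul t).X i) : x = 0 :=
  Subtype.ext (x.2 h₀ h₁)

/-- The coefficient of an element of the Koszul complex. -/
def koszulCoeff (t : R) (i : ℤ) : (koszul t).X i →ₗ[R] R := (koszulX R i).subtype

/-- The projection of `K ⊗ A` onto `A`. -/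
def koszulRetract (t : R) (A : DGAlg R) (n : ℤ) :
    Cx.TensorX (koszul t).toCx A.toCx n →ₗ[R] A.X n :=
  Cx.tlift _ _ n fun i j h =>
    if hi : i = 0 then
      ((LinearMap.lsmul R (A.X n)).comp (koszulCoeff t i)).compl₂
        (A.toCx.castX (by omega : j = n))
    else 0

theorem koszulRetract_inr (t : R) (A : DGAlg R) (n : ℤ) (a : A.X n) :
    koszulRetract t A n ((tensorInr (koszul t) A).app n a) = a := by
  refine (Cx.tlift_tmk _ _ _ _ _ _ _ _ _).trans ?_
  rw [dif_pos rfl]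
  exact one_smul R a

/-- The Koszul complex has basis $1, e$, so that $K \otimes A = A \oplus eA$. -/
theorem exists_eq_koszul_tensor (t : R) (A : DGAlg R) (n m : ℤ) (h : 1 + m = n)
    (b : Cx.TensorX (koszul t).toCx A.toCx n) :
    ∃ (a : A.X n) (a' : A.X m),
      b = Cx.tmk _ _ 0 n n (zero_add n) (koszul t).one a +
        tensorMul (koszul t) A 1 m n h (Cx.tmk _ _ 1 0 1 (add_zero 1) (koszulGen t) A.one)
          (Cx.tmk _ _ 0 m m (zero_add m) (koszul t).one a') := by
  induction b using Cx.tensor_induction with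
  | h0 => exact ⟨0, 0, by simp⟩
  | hadd x y hx hy =>
    obtain ⟨a, a', rfl⟩ := hx
    obtain ⟨c, c', rfl⟩ := hy
    refine ⟨a + c, a' + c', ?_⟩
    simp only [map_add]
    abel
  | hmk i j hij x a =>
    by_cases h₀ : i = 0
    · subst h₀
      obtain rfl : j = n := by omega
      obtain ⟨r, rfl⟩ := koszul_eq_smul_one t x
      exact ⟨r • a, 0, by simp⟩
    by_cases h₁ : i = 1
    · subst h₁
      obtain rfl : j = m := by omega
      obtain ⟨r, rfl⟩ := koszul_eq_smul_gen t x
      refine ⟨0, r • a, ?_⟩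
      rw [tensorMul_tmk (koszul t) A h _ _ (add_zero 1) (zero_add j), A.one_mul,
        (koszul t).mul_one]
      simp
    · rw [koszul_eq_zero t h₀ h₁ x]
      exact ⟨0, 0, by simp⟩

theorem koszul_contr_e (t : R) (A : DGAlg R) :
    Cx.tensorContr (koszul t).toCx A.toCx (koszulContr t) 1 0 (zero_add 1)
      (Cx.tmk _ _ 1 0 1 (add_zero 1) (koszulGen t) A.one) =
        Cx.tmk _ _ 0 0 0 (add_zero 0) (koszul t).one A.one := by
  rw [Cx.tensorContr_tmk (zero_add 1) (add_zero 1) (zero_add 1) (koszulGen t) A.one]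
  have h : koszulContr t 1 0 (zero_add 1) (koszulGen t) = (koszul t).one :=
    (koszulD_koszulGen 1 t).trans (one_smul R _)
  rw [h]

theorem koszul_d_e (t : R) (A : DGAlg R) :
    Cx.tensorD (koszul t).toCx A.toCx 1 0 (zero_add 1)
      (Cx.tmk _ _ 1 0 1 (add_zero 1) (koszulGen t) A.one) =
        t • Cx.tmk _ _ 0 0 0 (add_zero 0) (koszul t).one A.one := by
  have h : (koszul t).d 1 0 (zero_add 1) (koszulGen t) = t • (koszul t).one := koszulD_koszulGen t t
  rw [Cx.tensorD_tmk (koszul t).toCx A.toCx (zero_add 1) (add_zero 1) (zero_add 1)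
    (sub_add_cancel 0 1) (koszulGen t) A.one, A.d_one, h]
  simp

theorem koszul_contr_inr (t : R) (A : DGAlg R) (n m : ℤ) (h : m + 1 = n) (a : A.X n) :
    Cx.tensorContr (koszul t).toCx A.toCx (koszulContr t) n m h
      (Cx.tmk _ _ 0 n n (zero_add n) (koszul t).one a) = 0 := by
  have e : koszulContr t 0 (0 - 1) (sub_add_cancel 0 1) (koszul t).one = 0 :=
    Subtype.ext ((coe_koszulD 1 0 _ _ _).trans (if_neg zero_ne_one))
  rw [Cx.tensorContr_tmk h (zero_add n) (sub_add_cancel 0 1)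
    (koszul t).one a]
  rw [e]
  simp

/-- The contraction of `K ⊗ A` along the generator of the Koszul complex `K`. -/
def koszulContraction (t : R) (A : DGAlg R) : Contraction (tensorInr (koszul t) A) t where
  contr := Cx.tensorContr (koszul t).toCx A.toCx (koszulContr t)
  contr_contr _ _ _ h h' b :=
    Cx.tensorContr_tensorContr (fun _ _ _ hj hk x => koszulD_koszulD 1 1 hj hk x) h h' b
  contr_d _ _ _ h h' b :=
    Cx.tensorContr_tensorD (fun _ _ _ hj hk x => (congrArg₂ (· + ·)
      (koszulD_koszulD 1 t hj hk x) (koszulD_koszulD t 1 hj hk x)).trans (add_zero 0)) h h' b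
  -- The Koszul product does not depend on the parameter, so the Leibniz rule for parameter $1$ says
  -- that $e \mapsto 1$ is a derivation of the algebra with parameter $t$.
  contr_mul := tensorContr_tensorMul (koszul (1 : R)).leibniz
  e := Cx.tmk _ _ 1 0 1 (add_zero 1) (koszulGen t) A.one
  contr_e := koszul_contr_e t A
  d_e := koszul_d_e t A
  contr_app := koszul_contr_inr t A
  app_injective n := Function.LeftInverse.injective (koszulRetract_inr t A n)
  exists_eq := exists_eq_koszul_tensor t A

end DGAlg

namespace DGAlg.Contraction

variable {A B : DGAlg R} {f : A.Hom B} {t : R}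
-- The contraction sends $a + e a'$ to $a'$.
theorem exists_app_eq (c : Contraction f t) {n m : ℤ} (h : m + 1 = n) (b : B.X n)
    (hb : c.contr n m h b = 0) :
    ∃ a, f.app n a = b := by
  obtain ⟨a, a', rfl⟩ := c.exists_eq n m (by omega) b
  rw [map_add, c.contr_app, zero_add, c.contr_mul 1 m n 0 (m - 1) m _ rfl (sub_add_cancel m 1) h
    (zero_add m) (by ring), c.contr_app, map_zero, smul_zero, add_zero, c.contr_e, B.one_mul] at hb
  exact ⟨a, by rw [hb, map_zero, add_zero]⟩

theorem finite (c : Contraction f t) (hA : ∀ i, Module.Finite R (A.X i)) (n : ℤ) :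
    Module.Finite R (B.X n) := by
  refine Module.Finite.of_surjective ((f.app n).coprod
    ((B.mul 1 (n - 1) n (by ring) c.e).comp (f.app (n - 1)))) fun b => ?_
  obtain ⟨a, a', rfl⟩ := c.exists_eq n (n - 1) (by ring) b
  exact ⟨(a, a'), rfl⟩

end DGAlg.Contraction

end Contraction

/-! ### Adic convergence and separation for finitely generated modules. -/

section Complete

variable {R : Type*} [CommRing R] {t : R} {N : Type*} [AddCommGroup N] [Module R N]

theorem mem_span_singleton_pow_smul_top {n : ℕ} {x : N} :
    x ∈ (Ideal.span {t} ^ n • ⊤ : Submodule R N) ↔ ∃ z, x = t ^ n • z := by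
  rw [Ideal.span_singleton_pow, Submodule.ideal_span_singleton_smul,
    Submodule.mem_smul_pointwise_iff_exists]
  simp [eq_comm]

variable (t)

theorem exists_adic_sum_ring [IsAdicComplete (Ideal.span {t}) R] (y : ℕ → R) :
    ∃ s, ∀ n : ℕ, ∃ z, s = ∑ i ∈ Finset.range n, t ^ i * y i + t ^ n * z := by
  obtain ⟨s, hs⟩ := IsPrecomplete.prec (I := Ideal.span {t}) (M := R) inferInstance
    (f := fun n => ∑ i ∈ Finset.range n, t ^ i * y i) <| by
    intro m n h
    rw [SModEq.comm, SModEq.sub_mem, ← Finset.sum_range_add_sum_Ico _ h, add_sub_cancel_left]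
    refine Submodule.sum_mem _ fun i hi => mem_span_singleton_pow_smul_top.2
      ⟨t ^ (i - m) * y i, ?_⟩
    rw [smul_eq_mul, ← mul_assoc, ← pow_add, Nat.add_sub_of_le (Finset.mem_Ico.1 hi).1]
  refine ⟨s, fun n => ?_⟩
  obtain ⟨z, hz⟩ := mem_span_singleton_pow_smul_top.1 (SModEq.sub_mem.1 (hs n).symm)
  exact ⟨z, by rw [← smul_eq_mul (t ^ n), ← hz]; ring⟩

/-- The series is lifted along a surjection from $R^k$ and summed coordinatewise. The remainders are
kept explicitly in the form $t^n z$, which is what the limit argument consumes. -/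
theorem exists_adic_sum [IsAdicComplete (Ideal.span {t}) R] [Module.Finite R N] (y : ℕ → N) :
    ∃ s, ∀ n : ℕ, ∃ z, s = ∑ i ∈ Finset.range n, t ^ i • y i + t ^ n • z := by
  obtain ⟨k, g, hg⟩ := Module.Finite.exists_fin' R N
  choose c hc using fun i => hg (y i)
  choose s z hz using fun j => exists_adic_sum_ring t fun i => c i j
  refine ⟨g s, fun n => ⟨g fun j => z j n, ?_⟩⟩
  have : s = ∑ i ∈ Finset.range n, t ^ i • c i + t ^ n • fun j => z j n := by
    ext j
    simpa [Finset.sum_apply] using hz j n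
  rw [this, map_add, map_sum, map_smul]
  simp [hc]

/-- Completeness puts $t$ in the Jacobson radical, and Krull's intersection theorem applies to
finite modules over a noetherian ring. -/
theorem eq_zero_of_forall_eq_pow_smul [IsNoetherianRing R] [IsAdicComplete (Ideal.span {t}) R]
    [Module.Finite R N] (x : N) (h : ∀ n : ℕ, ∃ z, x = t ^ n • z) : x = 0 := by
  have := IsHausdorff.of_le_jacobson (Ideal.span {t}) N (IsAdicComplete.le_jacobson_bot _)
  refine IsHausdorff.haus this x fun n => ?_
  rw [SModEq.zero]
  exact mem_span_singleton_pow_smul_top.2 (h n)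

end Complete

/-! ### Graded maps as elements of one endomorphism ring. -/

section Total

variable {R : Type u} [CommRing R] {X : ℤ → Type u} [∀ i, AddCommGroup (X i)] [∀ i, Module R (X i)]

/-- The endomorphism of the product of all components given by a family of maps of degree `p`. -/
def totalEnd (p : ℤ) (φ : ∀ i j : ℤ, i + p = j → X i →ₗ[R] X j) : Module.End R (∀ i, X i) :=
  LinearMap.pi fun j => (φ (j - p) j (sub_add_cancel j p)).comp (LinearMap.proj (j - p))

theorem totalEnd_apply {p : ℤ} (φ : ∀ i j : ℤ, i + p = j → X i →ₗ[R] X j) (x : ∀ i, X i) {i j : ℤ}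
    (h : i + p = j) : totalEnd p φ x j = φ i j h (x i) := by
  obtain rfl : i = j - p := by omega
  rfl

/-- Composition of graded maps becomes multiplication in a single ring, free of degree bookkeeping,
so the ring-theoretic obstruction lemmas apply. -/
theorem totalEnd_mul {p q r : ℤ} (h : p + q = r) (ψ : ∀ i j : ℤ, i + q = j → X i →ₗ[R] X j)
    (φ : ∀ i j : ℤ, i + p = j → X i →ₗ[R] X j) :
    totalEnd q ψ * totalEnd p φ = totalEnd r fun i j hij =>
      (ψ (i + p) j (by omega)).comp (φ i (i + p) rfl) := by
  refine LinearMap.ext fun x => funext fun j => ?_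
  rw [Module.End.mul_apply, totalEnd_apply ψ _ (by omega : j - r + p + q = j),
    totalEnd_apply φ _ rfl, totalEnd_apply _ x (sub_add_cancel j r)]
  rfl

end Total

/-! ### Derivations of DG modules over derivations of the algebra. -/

section Derivations

variable {R : Type u} [CommRing R] {A : DGAlg R}

namespace DGMod

variable {M N P : DGMod A} {p q r : ℤ}

/-- A map `g` of degree `-1` with `g (a x) = δ a x + (-1)^|a| a g x`. -/
def IsDer (M : DGMod A) (δ : ∀ i j : ℤ, j + 1 = i → A.X i →ₗ[R] A.X j)
    (g : ∀ i j : ℤ, j + 1 = i → M.X i →ₗ[R] M.X j) : Prop :=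
  ∀ (i j k i' j' k' : ℤ) (h : i + j = k) (hi : i' + 1 = i) (hj : j' + 1 = j)
    (hk : k' + 1 = k) (h₁ : i' + j = k') (h₂ : i + j' = k') (a : A.X i) (x : M.X j),
    g k k' hk (M.smul i j k h a x) =
      M.smul i' j k' h₁ (δ i i' hi a) x + i.negOnePow • M.smul i j' k' h₂ a (g j j' hj x)

variable {δ δ' : ∀ i j : ℤ, j + 1 = i → A.X i →ₗ[R] A.X j}
  {g g' : ∀ i j : ℤ, j + 1 = i → M.X i →ₗ[R] M.X j}

/-- Linear maps of degree $-1$ are treated as derivations over zero, so that $p\gamma + \gamma p$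
and $pd + dp$ are both handled by `IsDer.anticomm`. -/
theorem isDer_hApp (f : homX M M (-1)) :
    M.IsDer (fun _ _ _ => 0) fun i j h => hApp f i j (by omega) := by
  intro i j k i' j' k' h hi hj hk h₁ h₂ a x
  rw [hApp_smul f h (by omega : j + -1 = j') (by omega) h₂]
  simp

/-- The anticommutator of two derivations over anticommuting derivations of the algebra. -/
def IsDer.anticomm (hg : M.IsDer δ g) (hg' : M.IsDer δ' g')
    (hδ : ∀ (i j k : ℤ) (hj : j + 1 = i) (hk : k + 1 = j) (a : A.X i),
      δ j k hk (δ' i j hj a) + δ' j k hk (δ i j hj a) = 0) : homX M M (-2) :=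
  homOf (fun i j h => (g (i - 1) j (by omega)).comp (g' i (i - 1) (sub_add_cancel i 1)) +
    (g' (i - 1) j (by omega)).comp (g i (i - 1) (sub_add_cancel i 1))) <| by
    intro i j k j' k' h hj hk h' a m
    have e : (i - 1).negOnePow = - i.negOnePow := by
      rw [Int.negOnePow_sub, Int.negOnePow_one]; simp
    have e₂ : (-2 * i).negOnePow = 1 := Int.negOnePow_even _ ⟨-i, by ring⟩
    simp only [LinearMap.add_apply, LinearMap.comp_apply]
    rw [hg i j k (i - 1) (j - 1) (k - 1) h (sub_add_cancel i 1) (sub_add_cancel j 1) _ (by omega)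
        (by omega), hg' i j k (i - 1) (j - 1) (k - 1) h (sub_add_cancel i 1)
        (sub_add_cancel j 1) _ (by omega) (by omega), map_add, map_add, map_sign, map_sign,
      hg (i - 1) j (k - 1) (i - 1 - 1) (j - 1) k' _ (sub_add_cancel _ 1) (sub_add_cancel j 1) _
        (by omega) (by omega),
      hg' (i - 1) j (k - 1) (i - 1 - 1) (j - 1) k' _ (sub_add_cancel _ 1) (sub_add_cancel j 1) _
        (by omega) (by omega),
      hg i (j - 1) (k - 1) (i - 1) j' k' _ (sub_add_cancel i 1) (by omega) _
        (by omega) (by omega),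
      hg' i (j - 1) (k - 1) (i - 1) j' k' _ (sub_add_cancel i 1) (by omega) _
        (by omega) (by omega),
      eq_neg_of_add_eq_zero_left (hδ _ _ _ (sub_add_cancel i 1) (sub_add_cancel (i - 1) 1) a),
      e, e₂, map_add]
    simp only [map_neg, LinearMap.neg_apply, smul_add, smul_smul, Int.units_mul_self,
      Units.neg_smul]
    abel

theorem IsDer.hApp_anticomm (hg : M.IsDer δ g) (hg' : M.IsDer δ' g')
    (hδ : ∀ (i j k : ℤ) (hj : j + 1 = i) (hk : k + 1 = j) (a : A.X i),
      δ j k hk (δ' i j hj a) + δ' j k hk (δ i j hj a) = 0) {i j k : ℤ} (h : i + -2 = j)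
    (hk : k + 1 = i) (x : M.X i) :
    hApp (hg.anticomm hg' hδ) i j h x =
      g k j (by omega) (g' i k hk x) + g' k j (by omega) (g i k hk x) := by
  obtain rfl : k = i - 1 := by omega
  rfl

section SemiBasis

variable {ι : Type u} {deg : ι → ℤ} {e : ∀ s, M.X (deg s)}

/-- The derivation over `δ` that vanishes on a semi-basis. -/
noncomputable def IsSemiBasis.der (hb : M.IsSemiBasis deg e)
    (δ : ∀ i j : ℤ, j + 1 = i → A.X i →ₗ[R] A.X j) (n m : ℤ) (h : m + 1 = n) :
    M.X n →ₗ[R] M.X m :=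
  hb.desc n fun s i hi =>
    ((M.smul (i - 1) (deg s) m (by omega)).flip (e s)).comp (δ i (i - 1) (sub_add_cancel i 1))

theorem IsSemiBasis.der_smul (hb : M.IsSemiBasis deg e) {n m i i' : ℤ} (h : m + 1 = n) (s : ι)
    (hi : i + deg s = n) (hi' : i' + 1 = i) (a : A.X i) :
    hb.der δ n m h (M.smul i (deg s) n hi a (e s)) =
      M.smul i' (deg s) m (by omega) (δ i i' hi' a) (e s) := by
  obtain rfl : i' = i - 1 := by omega
  exact hb.desc_smul _ s i hi a

theorem IsSemiBasis.der_der (hb : M.IsSemiBasis deg e)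
    (hδ : ∀ (i j k : ℤ) (hj : j + 1 = i) (hk : k + 1 = j) (a : A.X i), δ j k hk (δ i j hj a) = 0)
    {n m l : ℤ} (h : m + 1 = n) (h' : l + 1 = m) (x : M.X n) :
    hb.der δ m l h' (hb.der δ n m h x) = 0 := by
  induction x using hb.induction with
  | h0 => simp
  | hadd x y hx hy => simp [hx, hy]
  | hsmul s i hi a =>
    rw [hb.der_smul h s hi (sub_add_cancel i 1), hb.der_smul h' s _ (sub_add_cancel (i - 1) 1), hδ]
    simp

theorem IsSemiBasis.isDer_der (hb : M.IsSemiBasis deg e)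
    (hδ : ∀ (i j k i' j' k' : ℤ) (h : i + j = k) (hi : i' + 1 = i) (hj : j' + 1 = j)
      (hk : k' + 1 = k) (h₁ : i' + j = k') (h₂ : i + j' = k') (x : A.X i) (y : A.X j),
      δ k k' hk (A.mul i j k h x y) =
        A.mul i' j k' h₁ (δ i i' hi x) y + i.negOnePow • A.mul i j' k' h₂ x (δ j j' hj y)) :
    M.IsDer δ (hb.der δ) := by
  intro i j k i' j' k' h hi hj hk h₁ h₂ a x
  induction x using hb.induction with
  | h0 => simp
  | hadd x y hx hy =>
    simp only [map_add, hx, hy, smul_add]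
    abel
  | hsmul s l hl b =>
    rw [← M.mul_smul i l (deg s) (i + l) j k rfl hl (by omega) h,
      hb.der_smul hk s _ (by omega : i + l - 1 + 1 = i + l),
      hb.der_smul hj s hl (sub_add_cancel l 1),
      hδ i l (i + l) i' (l - 1) (i + l - 1) rfl hi (sub_add_cancel l 1) _ (by omega) (by omega),
      ← M.mul_smul i' l (deg s) (i + l - 1) j k' (by omega) hl (by omega) h₁,
      ← M.mul_smul i (l - 1) (deg s) (i + l - 1) j' k' (by omega) (by omega) (by omega) h₂]
    simp

theorem IsSemiBasis.der_self (hb : M.IsSemiBasis deg e)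
    (hδ : ∀ (j : ℤ) (h : j + 1 = 0), δ 0 j h A.one = 0) (s : ι) {m : ℤ} (h : m + 1 = deg s) :
    hb.der δ (deg s) m h (e s) = 0 := by
  have := hb.der_smul (δ := δ) h s (zero_add _) (sub_add_cancel 0 1) A.one
  rwa [M.one_smul, hδ, map_zero, LinearMap.zero_apply] at this

end SemiBasis

/-- The endomorphism of the product of all components given by a homomorphism. -/
def toTotal (M : DGMod A) (p : ℤ) : homX M M p →ₗ[R] Module.End R (∀ i, M.X i) where
  toFun f := totalEnd p (hApp f)
  map_add' _ _ := rfl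
  map_smul' _ _ := rfl

theorem toTotal_hComp (g : homX M M q) (f : homX M M p) (h : p + q = r) :
    M.toTotal r (hComp g f r h) = M.toTotal q g * M.toTotal p f :=
  (totalEnd_mul h _ _).symm

theorem toTotal_id (M : DGMod A) : M.toTotal 0 (Hom.id M).toHomX = 1 := by
  refine LinearMap.ext fun x => funext fun j => ?_
  exact (totalEnd_apply _ x (add_zero j)).trans (Hom.hApp_toHomX _ _ _ _)

theorem toTotal_apply (f : homX M M p) (x : ∀ i, M.X i) {i j : ℤ} (h : i + p = j) :
    M.toTotal p f x j = hApp f i j h (x i) :=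
  totalEnd_apply _ x h

theorem toTotal_injective (M : DGMod A) (p : ℤ) : Function.Injective (M.toTotal p) := by
  intro f g h
  refine hApp_ext fun i j hij x => ?_
  have := congrFun (LinearMap.congr_fun h (Pi.single i x)) j
  rwa [toTotal_apply _ _ hij, toTotal_apply _ _ hij, Pi.single_eq_same] at this

end DGMod
end Derivations

theorem one_add_mul_one_sub_eq_one {E : Type*} [Ring E] {ε x : E} (hε : ε * ε = 0)
    (hx : x * ε = -(ε * x)) :
    (1 + ε * x) * (1 - ε * x) = 1 ∧ (1 - ε * x) * (1 + ε * x) = 1 := by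
  have h : 1 - ε * x = 1 + ε * -x := by rw [mul_neg, sub_eq_add_neg]
  rw [h, one_add_mul_one_sub hε hx, one_add_mul_one_sub hε (by rw [neg_mul, hx, mul_neg])]
  simp

/-! ### Making the contraction commute with the differential. -/

section Lifting

variable {R : Type u} [CommRing R]

namespace DGMod

variable {A B : DGAlg R} {F : DGMod B}

/-- Left multiplication by an element of degree one. -/
def lmul (F : DGMod B) (b : B.X 1) : homX F F 1 :=
  homOf (fun i j h => F.smul 1 i j (by omega) b) <| by
    intro i j k j' k' h hj hk h' a m
    rw [← F.mul_smul 1 i j (i + 1) k k' (add_comm 1 i) h (by omega) _,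
      ← F.mul_smul i 1 j (i + 1) j' k' rfl (by omega) (by omega) h',
      B.mul_comm 1 i (i + 1) (add_comm 1 i) rfl, map_sign₂]

theorem hApp_sum {M N : DGMod B} {p : ℤ} {κ : Type*} (s : Finset κ) (φ : κ → homX M N p) (i j : ℤ)
    (h : i + p = j) (x : M.X i) :
    hApp (∑ k ∈ s, φ k) i j h x = ∑ k ∈ s, hApp (φ k) i j h x := by
  classical
  induction s using Finset.induction_on with
  | empty => simp
  | insert a s ha ih => rw [Finset.sum_insert ha, Finset.sum_insert ha, hApp_add, ih]

/-- A homomorphism is determined by arbitrary values on the semi-basis, and each value lies in a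
finite $R$-module. Limits and remainders are therefore chosen one basis element at a time, even if
the basis is infinite. -/
theorem exists_adic_sum_homX (t : R) [IsAdicComplete (Ideal.span {t}) R]
    {ι : Type u} {deg : ι → ℤ} {e : ∀ s, F.X (deg s)} (hb : F.IsSemiBasis deg e)
    [∀ i, Module.Finite R (F.X i)] {p : ℤ} (y : ℕ → homX F F p) :
    ∃ s, ∀ n : ℕ, ∃ z, s = ∑ i ∈ Finset.range n, t ^ i • y i + t ^ n • z := by
  choose L z hz using fun s => exists_adic_sum t fun i => hApp (y i) (deg s) _ rfl (e s)
  refine ⟨hb.lift L, fun n => ⟨hb.lift fun s => z s n, hb.hApp_ext fun s => ?_⟩⟩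
  rw [hb.lift_apply, hApp_add, hApp_sum, hApp_const_smul, hb.lift_apply, hz s n]
  simp

/-- Under vanishing of the obstructions, the contraction on a semi-free module can be conjugated
to one that commutes with the differential. -/
theorem exists_isDer_d_eq_zero [IsNoetherianRing R] {t : R} [IsAdicComplete (Ideal.span {t}) R]
    {f : A.Hom B} (c : DGAlg.Contraction f t) {ι : Type u} {deg : ι → ℤ} {e : ∀ s, F.X (deg s)}
    (hb : F.IsSemiBasis deg e) [∀ i, Module.Finite R (F.X i)]
    (hExt : ∀ z : homX F F (-2), homD F F (-2) (-3) (by norm_num) z = 0 →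
      ∃ γ : homX F F (-1), homD F F (-1) (-2) (by norm_num) γ = z) :
    ∃ (π : ∀ i j : ℤ, j + 1 = i → F.X i →ₗ[R] F.X j) (u v : homX F F 0), F.IsDer c.contr π ∧
      (∀ (i j k : ℤ) (hj : j + 1 = i) (hk : k + 1 = j) (x : F.X i), π j k hk (π i j hj x) = 0) ∧
      (∀ (i j k : ℤ) (hj : j + 1 = i) (hk : k + 1 = j) (x : F.X i),
        π j k hk (F.d i j hj x) + F.d j k hk (π i j hj x) = 0) ∧
      (∀ (i : ℤ) (x : F.X i), hApp u i i (add_zero i) (hApp v i i (add_zero i) x) = x) ∧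
      (∀ (i : ℤ) (x : F.X i), hApp v i i (add_zero i) (hApp u i i (add_zero i) x) = x) ∧
      ∀ (s : ι) (j : ℤ) (h : j + 1 = deg s),
        π (deg s) j h (hApp v (deg s) (deg s) (add_zero _) (e s)) = 0 := by
  let g := hb.der c.contr
  have hg : F.IsDer c.contr g := hb.isDer_der c.contr_mul
  -- The differential and the contraction are not $B$-linear, hence not of the form `toTotal`; `ev`
  -- places them in the same ring.
  let ev : ∀ g : ∀ i j : ℤ, j + 1 = i → F.X i →ₗ[R] F.X j, Module.End R (∀ i, F.X i) :=
    fun g => totalEnd (-1) fun i j h => g i j (by omega)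
  have hev : ∀ g x (i j : ℤ) (h : j + 1 = i), ev g x j = g i j h (x i) :=
    fun g x i j h => totalEnd_apply _ x (by omega : i + -1 = j)
  let ε := F.toTotal 1 (F.lmul c.e)
  have hεa : ∀ x (i j : ℤ) (h : i + 1 = j), ε x j = F.smul 1 i j (by omega) c.e (x i) :=
    fun x i j h => totalEnd_apply _ x h
  have dd : ev F.d * ev F.d = 0 := by
    refine LinearMap.ext fun x => funext fun j => ?_
    rw [Module.End.mul_apply, hev _ _ (j + 1) j rfl, hev _ _ (j + 1 + 1) (j + 1) rfl, F.d_d]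
    rfl
  have gg : ev g * ev g = 0 := by
    refine LinearMap.ext fun x => funext fun j => ?_
    rw [Module.End.mul_apply, hev _ _ (j + 1) j rfl, hev _ _ (j + 1 + 1) (j + 1) rfl,
      hb.der_der c.contr_contr]
    rfl
  have ee : ε * ε = 0 := by
    refine LinearMap.ext fun x => funext fun j => ?_
    rw [Module.End.mul_apply, hεa _ (j - 1) j (by omega), hεa _ (j - 2) (j - 1) (by omega),
      ← F.mul_smul 1 1 (j - 2) 2 (j - 1) j (by norm_num) _ (by omega), B.mul_self 1 2 _ odd_one]
    simp
  have ge : ev g * ε + ε * ev g = 1 := by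
    refine LinearMap.ext fun x => funext fun j => ?_
    rw [LinearMap.add_apply, Module.End.mul_apply, Module.End.mul_apply, Pi.add_apply,
      hev _ _ (j + 1) j rfl, hεa _ j (j + 1) rfl, hεa _ (j - 1) j (by omega),
      hev _ _ j (j - 1) (by omega),
      hg 1 j (j + 1) 0 (j - 1) j _ rfl (sub_add_cancel j 1) rfl (zero_add j) (by omega), c.contr_e,
      F.one_smul]
    simp
  have de : ev F.d * ε + ε * ev F.d = t • 1 := by
    refine LinearMap.ext fun x => funext fun j => ?_
    rw [LinearMap.add_apply, Module.End.mul_apply, Module.End.mul_apply, Pi.add_apply,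
      hev _ _ (j + 1) j rfl, hεa _ j (j + 1) rfl, hεa _ (j - 1) j (by omega),
      hev _ _ j (j - 1) (by omega),
      F.leibniz 1 j (j + 1) 0 (j - 1) j _ rfl (sub_add_cancel j 1) rfl (zero_add j) (by omega),
      c.d_e, LinearMap.map_smul₂, F.one_smul]
    simp
  have hL : ∀ (i j k : ℤ), i + j = k → ∀ x ∈ LinearMap.range (F.toTotal i),
      ∀ y ∈ LinearMap.range (F.toTotal j), x * y ∈ LinearMap.range (F.toTotal k) := by
    rintro i j k h _ ⟨x, rfl⟩ _ ⟨y, rfl⟩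
    exact ⟨hComp x y k (by omega), toTotal_hComp x y _⟩
  have hcomm : ∀ (g g' : ∀ i j : ℤ, j + 1 = i → F.X i →ₗ[R] F.X j) (δ δ') (hg : F.IsDer δ g)
      (hg' : F.IsDer δ' g') (hδ : ∀ (i j k : ℤ) (hj : j + 1 = i) (hk : k + 1 = j) (a : B.X i),
      δ j k hk (δ' i j hj a) + δ' j k hk (δ i j hj a) = 0),
      F.toTotal (-2) (hg.anticomm hg' hδ) = ev g * ev g' + ev g' * ev g := by
    intro g g' δ δ' hg hg' hδ
    refine LinearMap.ext fun x => funext fun j => ?_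
    rw [toTotal_apply _ x (by omega : j + 2 + -2 = j),
      hg.hApp_anticomm hg' hδ _ (by omega : j + 1 + 1 = j + 2), LinearMap.add_apply,
      Module.End.mul_apply, Module.End.mul_apply, Pi.add_apply, hev _ _ (j + 1) j rfl,
      hev _ _ (j + 1) j rfl, hev _ _ (j + 2) (j + 1) (by omega),
      hev _ _ (j + 2) (j + 1) (by omega)]
  have hεL : ∀ (p : ℤ) (x : homX F F p), F.toTotal p x * ε = p.negOnePow • (ε * F.toTotal p x) := by
    intro p x
    refine LinearMap.ext fun y => funext fun j => ?_
    change F.toTotal p x (ε y) j = p.negOnePow • (ε (F.toTotal p x y) j)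
    rw [toTotal_apply _ _ (sub_add_cancel j p), hεa _ (j - p - 1) (j - p) (by omega),
      hεa _ (j - 1) j (by omega), toTotal_apply _ _ (by omega : j - p - 1 + p = j - 1),
      hApp_smul x _ (by omega : j - p - 1 + p = j - 1) _ (by omega), mul_one]
  have hodd : (-1 : ℤ).negOnePow = -1 := Int.negOnePow_odd _ ⟨-1, by norm_num⟩
  have heven : (-2 : ℤ).negOnePow = 1 := Int.negOnePow_even _ ⟨-1, by norm_num⟩
  -- The graded pieces are the images of the $B$-linear homomorphisms of each degree. Linearity
  -- supplies the sign rules against `ε`, and `anticomm` shows that the defects are linear of degree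
  -- $-2$.
  obtain ⟨-, ⟨γ, rfl⟩, hγ⟩ := exists_conj_anticommute t (fun p => LinearMap.range (F.toTotal p))
    (ev F.d) (ev g) ε ⟨_, F.toTotal_id⟩ hL dd gg ee ge de ⟨_, rfl⟩ (by
      rintro _ ⟨x, rfl⟩
      rw [hεL, hodd]
      simp) (by
      rintro _ ⟨x, rfl⟩
      rw [hεL, heven]
      simp) (by
      rintro _ ⟨x, rfl⟩
      exact ⟨_, hcomm _ _ _ _ hg (isDer_hApp x) (fun _ _ _ _ _ _ => by simp)⟩)
    ⟨_, hcomm _ _ _ _ hg F.leibniz c.contr_d⟩ (by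
      rintro _ ⟨x, rfl⟩ hx
      obtain ⟨γ, hγ⟩ := hExt x (by
        refine F.toTotal_injective _ (LinearMap.ext fun y => funext fun j => ?_)
        have := congrFun (LinearMap.congr_fun hx y) j
        rw [Module.End.mul_apply, Module.End.mul_apply, hev _ _ (j + 1) j rfl,
          toTotal_apply _ _ (by omega : j + 3 + -2 = j + 1),
          toTotal_apply _ _ (by omega : j + 2 + -2 = j), hev _ _ (j + 3) (j + 2) (by omega)] at this
        rw [toTotal_apply _ y (by omega : j + 3 + -3 = j),
          hApp_homD x _ _ (by omega : j + 2 + 1 = j + 3) rfl, heven, this]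
        simp)
      refine ⟨_, ⟨γ, rfl⟩, ?_⟩
      rw [← hγ]
      refine LinearMap.ext fun y => funext fun j => ?_
      rw [toTotal_apply _ y (by omega : j + 2 + -2 = j),
        hApp_homD γ _ _ (by omega : j + 1 + 1 = j + 2) rfl, hodd, LinearMap.add_apply,
        Module.End.mul_apply, Module.End.mul_apply, Pi.add_apply, hev _ _ (j + 1) j rfl,
        toTotal_apply _ y (by omega : j + 2 + -1 = j + 1),
        toTotal_apply _ _ (by omega : j + 1 + -1 = j), hev _ _ (j + 2) (j + 1) (by omega)]
      simp) (by
      intro y hy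
      choose φ hφ using hy
      obtain ⟨s, hs⟩ := exists_adic_sum_homX t hb φ
      refine ⟨_, ⟨s, rfl⟩, fun n => ?_⟩
      obtain ⟨z, hz⟩ := hs n
      refine ⟨_, ⟨z, rfl⟩, ?_⟩
      rw [hz, map_add, map_sum, map_smul]
      simp only [map_smul, hφ]) (by
      intro x hx
      -- Separation is checked on each component of each value, which lies in a finite $R$-module.
      refine LinearMap.ext fun y => funext fun j => eq_zero_of_forall_eq_pow_smul t _ fun n => ?_
      obtain ⟨z, rfl⟩ := hx n
      exact ⟨z y j, rfl⟩)
  have hΓε : F.toTotal (-1) γ * ε = -(ε * F.toTotal (-1) γ) := by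
    rw [hεL, hodd]
    simp
  let u : homX F F 0 := (Hom.id F).toHomX + hComp (F.lmul c.e) γ 0 (by norm_num)
  let v : homX F F 0 := (Hom.id F).toHomX - hComp (F.lmul c.e) γ 0 (by norm_num)
  have hu : F.toTotal 0 u = 1 + ε * F.toTotal (-1) γ := by
    rw [map_add, toTotal_hComp, toTotal_id]
  have hv : F.toTotal 0 v = 1 - ε * F.toTotal (-1) γ := by
    rw [map_sub, toTotal_hComp, toTotal_id]
  rw [conj, ← hu, ← hv] at hγ
  have huv : F.toTotal 0 u * F.toTotal 0 v = 1 := by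
    rw [hu, hv]
    exact (one_add_mul_one_sub_eq_one ee hΓε).1
  have hvu : F.toTotal 0 v * F.toTotal 0 u = 1 := by
    rw [hu, hv]
    exact (one_add_mul_one_sub_eq_one ee hΓε).2
  have happ : ∀ {u v : homX F F 0}, F.toTotal 0 u * F.toTotal 0 v = 1 → ∀ (i : ℤ) (x : F.X i),
      hApp u i i (add_zero i) (hApp v i i (add_zero i) x) = x := by
    intro u v h i x
    have := congrFun (LinearMap.congr_fun h (Pi.single i x)) i
    rwa [Module.End.mul_apply, toTotal_apply _ _ (add_zero i), toTotal_apply _ _ (add_zero i),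
      Module.End.one_apply, Pi.single_eq_same] at this
  -- The conjugation is shifted from the differential to the contraction, so that `F` keeps its
  -- differential. As $u$ and $v$ are linear and mutually inverse, $\pi = v g u$ is a derivation of
  -- square zero over the same contraction, and it kills the basis $v(e_s)$.
  let π : ∀ i j : ℤ, j + 1 = i → F.X i →ₗ[R] F.X j := fun i j h =>
    (hApp v j j (add_zero j)).comp ((g i j h).comp (hApp u i i (add_zero i)))
  have hπ : ev π = F.toTotal 0 v * ev g * F.toTotal 0 u := by
    refine LinearMap.ext fun x => funext fun j => ?_
    rw [Module.End.mul_apply, Module.End.mul_apply, toTotal_apply _ _ (add_zero j),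
      hev _ _ (j + 1) j rfl, hev _ _ (j + 1) j rfl, toTotal_apply _ _ (add_zero (j + 1))]
    rfl
  have hπd : ev π * ev F.d + ev F.d * ev π = 0 := by
    have h := congrArg (fun x => F.toTotal 0 v * x * F.toTotal 0 u) hγ
    have e₁ : F.toTotal 0 v * (ev g * (F.toTotal 0 u * ev F.d * F.toTotal 0 v) +
        F.toTotal 0 u * ev F.d * F.toTotal 0 v * ev g) * F.toTotal 0 u =
        F.toTotal 0 v * ev g * F.toTotal 0 u * ev F.d * (F.toTotal 0 v * F.toTotal 0 u) +
          (F.toTotal 0 v * F.toTotal 0 u) * ev F.d *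
            (F.toTotal 0 v * ev g * F.toTotal 0 u) := by
      noncomm_ring
    rw [hvu, mul_one, one_mul, ← hπ] at e₁
    rw [← e₁]
    exact h.trans (by simp)
  refine ⟨π, u, v, ?_, ?_, ?_, happ huv, happ hvu, ?_⟩
  · intro i j k i' j' k' h hi hj hk h₁ h₂ a x
    simp only [π, LinearMap.comp_apply]
    rw [hApp_smul u h (add_zero j) (add_zero k) h, zero_mul, Int.negOnePow_zero, _root_.one_smul,
      hg i j k i' j' k' h hi hj hk h₁ h₂, map_add, map_sign,
      hApp_smul v h₁ (add_zero j) (add_zero k') h₁,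
      hApp_smul v h₂ (add_zero j') (add_zero k') h₂, happ hvu]
    simp
  · intro i j k hj hk x
    simp only [π, LinearMap.comp_apply]
    rw [happ huv, hb.der_der c.contr_contr, map_zero]
  · intro i j k hj hk x
    have := congrFun (LinearMap.congr_fun hπd (Pi.single i x)) k
    rwa [LinearMap.add_apply, Module.End.mul_apply, Module.End.mul_apply, Pi.add_apply,
      hev _ _ j k hk, hev _ _ j k hk, hev _ _ i j hj, hev _ _ i j hj, Pi.single_eq_same] at this
  · intro s j h
    simp only [π, LinearMap.comp_apply]
    rw [happ huv, hb.der_self, map_zero]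
    intro j h
    have := c.contr_app 0 j h A.one
    rwa [f.map_one] at this

end DGMod
end Lifting

/-! ### Descent to the kernel of the contraction. -/

section Descent

variable {R : Type u} [CommRing R]

namespace DGMod

variable {A B : DGAlg R} {F : DGMod B} {ι : Type u} {deg : ι → ℤ} {e : ∀ s, F.X (deg s)}

theorem IsSemiBasis.map (hb : F.IsSemiBasis deg e) (v : homX F F 0)
    (hv : ∀ i, Function.Bijective (hApp v i i (add_zero i))) :
    F.IsSemiBasis deg fun s => hApp v (deg s) (deg s) (add_zero _) (e s) := by
  classical
  intro n
  have h : (DirectSum.toModule R ι (F.X n) fun s =>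
      (F.smul (n - deg s) (deg s) n (sub_add_cancel n (deg s))).flip
        (hApp v (deg s) (deg s) (add_zero _) (e s))) =
      (hApp v n n (add_zero n)).comp (hb.equiv n).toLinearMap := by
    refine DirectSum.linearMap_ext R fun s => LinearMap.ext fun a => ?_
    rw [LinearMap.comp_apply, DirectSum.toModule_lof, LinearMap.comp_apply, LinearMap.comp_apply,
      LinearEquiv.coe_coe, hb.equiv_lof, hApp_smul v _ (add_zero _) _ (sub_add_cancel n (deg s))]
    simp
  rw [h]
  exact (hv n).comp (hb.equiv n).bijective

/-- Restriction of scalars along a morphism of DG algebras. -/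
def restrictScalars (f : A.Hom B) (M : DGMod B) : DGMod A where
  toCx := M.toCx
  smul i j k h := (M.smul i j k h).comp (f.app i)
  mul_smul i j k ij jk n hij hjk h₁ h₂ a b x := by
    simp only [LinearMap.comp_apply]
    rw [f.map_mul, M.mul_smul i j k ij jk n hij hjk h₁ h₂]
  one_smul i x := by
    simp only [LinearMap.comp_apply]
    rw [f.map_one, M.one_smul]
  leibniz i j k i' j' k' h hi hj hk h₁ h₂ a x := by
    simp only [LinearMap.comp_apply]
    rw [M.leibniz i j k i' j' k' h hi hj hk h₁ h₂, f.map_d]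

section Kernel

variable {f : A.Hom B} {t : R} (c : DGAlg.Contraction f t)
  {π : ∀ i j : ℤ, j + 1 = i → F.X i →ₗ[R] F.X j} (hπ : F.IsDer c.contr π)
  (hπd : ∀ (i j k : ℤ) (hj : j + 1 = i) (hk : k + 1 = j) (x : F.X i),
    π j k hk (F.d i j hj x) + F.d j k hk (π i j hj x) = 0)

theorem IsDer.apply_app_smul (hπ : F.IsDer c.contr π) {i j k j' k' : ℤ} (h : i + j = k)
    (hj : j' + 1 = j) (hk : k' + 1 = k) (h₂ : i + j' = k') (a : A.X i) (x : F.X j) :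
    π k k' hk (F.smul i j k h (f.app i a) x) =
      i.negOnePow • F.smul i j' k' h₂ (f.app i a) (π j j' hj x) := by
  rw [hπ i j k (i - 1) j' k' h (sub_add_cancel i 1) hj hk (by omega) h₂, c.contr_app, map_zero,
    LinearMap.zero_apply, zero_add]

theorem IsDer.apply_e_smul (hπ : F.IsDer c.contr π) {j k : ℤ} (h : 1 + j = k) {j' : ℤ}
    (hj : j' + 1 = j) (x : F.X j) :
    π k j (by omega) (F.smul 1 j k h c.e x) = x - F.smul 1 j' j (by omega) c.e (π j j' hj x) := by
  rw [hπ 1 j k 0 j' j h rfl hj (by omega) (zero_add j) (by omega), c.contr_e, F.one_smul]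
  simp [sub_eq_add_neg]

/-- The kernel of a contraction that commutes with the differential, as a DG module over `A`. -/
def kerDer : DGMod A :=
  ofSubmodule (restrictScalars f F) F.d (fun i => LinearMap.ker (π i (i - 1) (sub_add_cancel i 1)))
    (restrictScalars f F).leibniz
    (fun i j k h a (x : F.X j) hx =>
      (hπ.apply_app_smul c h (sub_add_cancel j 1) (sub_add_cancel k 1) (by omega) a x).trans <|
        (congrArg (fun y => i.negOnePow • F.smul i (j - 1) (k - 1) (by omega) (f.app i a) y)
          hx).trans (by rw [map_zero, smul_zero]))
    (fun i j h (x : F.X i) hx => by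
      obtain rfl : j = i - 1 := by omega
      exact (eq_neg_of_add_eq_zero_left (hπd _ _ _ h (sub_add_cancel _ 1) x)).trans <|
        (congrArg (fun y => -F.d (i - 1) (i - 1 - 1) (sub_add_cancel _ 1) y) hx).trans
          (by rw [map_zero, neg_zero]))
    (fun i j k hj hk x _ => F.d_d i j k hj hk x)

/-- The inclusion of the kernel of a contraction. -/
def kerDerIncl (i : ℤ) : (kerDer c hπ hπd).X i →ₗ[R] F.X i :=
  (LinearMap.ker (π i (i - 1) (sub_add_cancel i 1))).subtype

theorem kerDerIncl_injective (i : ℤ) : Function.Injective (kerDerIncl c hπ hπd i) :=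
  Subtype.val_injective

theorem apply_kerDerIncl {i j : ℤ} (h : j + 1 = i) (x : (kerDer c hπ hπd).X i) :
    π i j h (kerDerIncl c hπ hπd i x) = 0 := by
  obtain rfl : j = i - 1 := by omega
  exact x.2

theorem exists_kerDerIncl_eq {i j : ℤ} (h : j + 1 = i) (x : F.X i) (hx : π i j h x = 0) :
    ∃ y, kerDerIncl c hπ hπd i y = x := by
  obtain rfl : j = i - 1 := by omega
  exact ⟨⟨x, hx⟩, rfl⟩

theorem kerDerIncl_d (i j : ℤ) (h : j + 1 = i) (x : (kerDer c hπ hπd).X i) :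
    kerDerIncl c hπ hπd j ((kerDer c hπ hπd).d i j h x) = F.d i j h (kerDerIncl c hπ hπd i x) :=
  rfl

theorem kerDerIncl_smul (i j k : ℤ) (h : i + j = k) (a : A.X i) (x : (kerDer c hπ hπd).X j) :
    kerDerIncl c hπ hπd k ((kerDer c hπ hπd).smul i j k h a x) =
      F.smul i j k h (f.app i a) (kerDerIncl c hπ hπd j x) :=
  rfl

theorem isBoundedBelow_kerDer (hF : F.IsBoundedBelow) : (kerDer c hπ hπd).IsBoundedBelow := by
  obtain ⟨b, hb⟩ := hF
  refine ⟨b, fun i hi => ?_⟩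
  have := hb i hi
  exact (kerDerIncl_injective c hπ hπd i).subsingleton

open Classical in
theorem mapRange_lof {X Y : ι → Type u} [∀ s, AddCommGroup (X s)] [∀ s, AddCommGroup (Y s)]
    [∀ s, Module R (X s)] [∀ s, Module R (Y s)] (φ : ∀ s, X s →ₗ[R] Y s) (s : ι) (a : X s) :
    DFinsupp.mapRange.linearMap φ (DirectSum.lof R ι X s a) = DirectSum.lof R ι Y s (φ s a) :=
  DFinsupp.mapRange_single (hf := fun s => map_zero (φ s))

/-- Because $\pi$ kills the basis, it acts on $F = \bigoplus B e_s$ by the contraction of $B$ on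
each coefficient. Its kernel is thus $\bigoplus A e_s$. -/
theorem isSemiBasis_kerDer (hb : F.IsSemiBasis deg e)
    (he : ∀ (s : ι) (j : ℤ) (h : j + 1 = deg s), π (deg s) j h (e s) = 0)
    (e' : ∀ s, (kerDer c hπ hπd).X (deg s)) (he' : ∀ s, kerDerIncl c hπ hπd _ (e' s) = e s) :
    (kerDer c hπ hπd).IsSemiBasis deg e' := by
  classical
  intro n
  set φ := DirectSum.toModule R ι ((kerDer c hπ hπd).X n) fun s =>
    ((kerDer c hπ hπd).smul (n - deg s) (deg s) n (sub_add_cancel n (deg s))).flip (e' s) with hφ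
  have h₁ : (kerDerIncl c hπ hπd n).comp φ = (hb.equiv n).toLinearMap.comp
      (DFinsupp.mapRange.linearMap fun s => f.app (n - deg s)) := by
    refine DirectSum.linearMap_ext R fun s => LinearMap.ext fun a => ?_
    simp only [LinearMap.comp_apply, LinearEquiv.coe_coe, hφ]
    rw [DirectSum.toModule_lof, LinearMap.flip_apply, kerDerIncl_smul, he']
    refine (hb.equiv_lof n s _).symm.trans (congrArg (hb.equiv n) ?_)
    exact (mapRange_lof (X := fun s => A.X (n - deg s)) (Y := fun s => B.X (n - deg s))
      (fun s => f.app (n - deg s)) s a).symm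
  have h₂ : (π n (n - 1) (sub_add_cancel n 1)).comp (hb.equiv n).toLinearMap =
      (hb.equiv (n - 1)).toLinearMap.comp (DFinsupp.mapRange.linearMap fun s =>
        c.contr (n - deg s) (n - 1 - deg s) (by omega)) := by
    refine DirectSum.linearMap_ext R fun s => LinearMap.ext fun a => ?_
    simp only [LinearMap.comp_apply, LinearEquiv.coe_coe]
    rw [hb.equiv_lof, hπ (n - deg s) (deg s) n (n - 1 - deg s) (deg s - 1) (n - 1) _ (by omega)
      (sub_add_cancel _ 1) _ (by omega) (by omega), he, map_zero, smul_zero, add_zero]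
    refine (hb.equiv_lof (n - 1) s _).symm.trans (congrArg (hb.equiv (n - 1)) ?_)
    exact (mapRange_lof (X := fun s => B.X (n - deg s)) (Y := fun s => B.X (n - 1 - deg s))
      (fun s => c.contr (n - deg s) (n - 1 - deg s) (by omega)) s a).symm
  constructor
  · refine Function.Injective.of_comp (f := kerDerIncl c hπ hπd n) ?_
    rw [← LinearMap.coe_comp, h₁, LinearMap.coe_comp]
    refine (hb.equiv n).injective.comp ?_
    exact (DFinsupp.mapRange_injective _ fun _ => map_zero _).2 fun s => c.app_injective _
  · intro y
    obtain ⟨b, hb'⟩ := (hb.equiv n).surjective (kerDerIncl c hπ hπd n y)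
    have hc : DFinsupp.mapRange.linearMap (fun s =>
        c.contr (n - deg s) (n - 1 - deg s) (by omega)) b = 0 := by
      refine (hb.equiv (n - 1)).injective ?_
      have := LinearMap.congr_fun h₂ b
      simp only [LinearMap.comp_apply, LinearEquiv.coe_coe] at this
      rw [← this, hb', apply_kerDerIncl, map_zero]
    -- A set-theoretic choice of preimages suffices. It is defined on all of $B$, with default $0$,
    -- and sends $0$ to $0$, so it can be applied to the coefficients of a finitely supported
    -- family.
    have hg : ∀ (i : ℤ) (b : B.X i), ∃ a, ∀ (j : ℤ) (h : j + 1 = i), c.contr i j h b = 0 →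
        f.app i a = b := by
      intro i b
      by_cases h : c.contr i (i - 1) (sub_add_cancel i 1) b = 0
      · obtain ⟨a, ha⟩ := c.exists_app_eq _ b h
        exact ⟨a, fun _ _ _ => ha⟩
      · refine ⟨0, fun j hj h' => absurd ?_ h⟩
        obtain rfl : j = i - 1 := by omega
        exact h'
    choose g hg using hg
    have hg0 : ∀ i, g i 0 = 0 := fun i => c.app_injective i <| by
      rw [hg i 0 (i - 1) (sub_add_cancel i 1) (map_zero _), map_zero]
    refine ⟨DFinsupp.mapRange (fun s => g (n - deg s)) (fun s => hg0 _) b,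
      kerDerIncl_injective c hπ hπd n ?_⟩
    rw [← hb']
    refine (LinearMap.congr_fun h₁ _).trans (congrArg (hb.equiv n) ?_)
    refine DFinsupp.ext fun s => ?_
    exact hg _ _ _ _ (DFinsupp.ext_iff.1 hc s)

/-- The map `B ⊗_A ker π → F`, `b ⊗ x ↦ b x`, before passing to the quotient. -/
def kerDerAct (n : ℤ) : Cx.TensorX B.toCx (kerDer c hπ hπd).toCx n →ₗ[R] F.X n :=
  Cx.tlift _ _ n fun i j h => (F.smul i j n h).compl₂ (kerDerIncl c hπ hπd j)

theorem kerDerAct_tmk {i j n : ℤ} (h : i + j = n) (b : B.X i) (x : (kerDer c hπ hπd).X j) :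
    kerDerAct c hπ hπd n (Cx.tmk _ _ i j n h b x) = F.smul i j n h b (kerDerIncl c hπ hπd j x) :=
  Cx.tlift_tmk _ _ _ _ _ _ _ _ _

theorem balanced_le_ker_kerDerAct (n : ℤ) :
    balanced f (kerDer c hπ hπd) n ≤ LinearMap.ker (kerDerAct c hπ hπd n) := by
  rw [balanced, Submodule.span_le]
  rintro _ ⟨i, j, k, ij, jk, hij, hjk, h₁, h₂, b, a, m, rfl⟩
  refine LinearMap.mem_ker.2 ?_
  rw [map_sub, kerDerAct_tmk, kerDerAct_tmk, kerDerIncl_smul,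
    F.mul_smul i j k ij jk n hij hjk h₁ h₂,
    sub_self]

theorem kerDerAct_d (n m : ℤ) (h : m + 1 = n)
    (z : Cx.TensorX B.toCx (kerDer c hπ hπd).toCx n) :
    kerDerAct c hπ hπd m (Cx.tensorD _ _ n m h z) = F.d n m h (kerDerAct c hπ hπd n z) := by
  induction z using Cx.tensor_induction with
  | h0 => simp
  | hadd x y hx hy => simp only [map_add, hx, hy]
  | hmk i j hij b x =>
    rw [Cx.tensorD_tmk _ _ h hij (sub_add_cancel i 1) (sub_add_cancel j 1), map_add, map_sign,
      kerDerAct_tmk, kerDerAct_tmk, kerDerAct_tmk, kerDerIncl_d,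
      F.leibniz i j n (i - 1) (j - 1) m hij (sub_add_cancel i 1) (sub_add_cancel j 1) h]

theorem kerDerAct_act (i j k : ℤ) (h : i + j = k) (b : B.X i)
    (z : Cx.TensorX B.toCx (kerDer c hπ hπd).toCx j) :
    kerDerAct c hπ hπd k (tensorAct B _ i j k h b z) =
      F.smul i j k h b (kerDerAct c hπ hπd j z) := by
  induction z using Cx.tensor_induction with
  | h0 => simp
  | hadd x y hx hy => simp only [map_add, hx, hy]
  | hmk p q hpq b' x =>
    rw [tensorAct_tmk _ _ _ _ rfl, kerDerAct_tmk, kerDerAct_tmk,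
      F.mul_smul i p q (i + p) j k rfl hpq _ h]

/-- The map `B ⊗_A ker π → F`, `b ⊗ x ↦ b x`. -/
def kerDerHom : (baseChange f (kerDer c hπ hπd)).Hom F where
  app n := (balanced f (kerDer c hπ hπd) n).liftQ (kerDerAct c hπ hπd n)
    (balanced_le_ker_kerDerAct c hπ hπd n)
  map_d n m h z := by
    obtain ⟨z, rfl⟩ := Submodule.mkQ_surjective _ z
    exact kerDerAct_d c hπ hπd n m h z
  map_smul i j k h b z := by
    obtain ⟨z, rfl⟩ := Submodule.mkQ_surjective _ z
    exact kerDerAct_act c hπ hπd i j k h b z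

theorem kerDerHom_app_mkQ (n : ℤ) (z : Cx.TensorX B.toCx (kerDer c hπ hπd).toCx n) :
    (kerDerHom c hπ hπd).app n ((balanced f (kerDer c hπ hπd) n).mkQ z) =
      kerDerAct c hπ hπd n z := rfl

/-- As $B = A + eA$, scalars from $A$ can be moved across the tensor sign, leaving $1 \otimes M + e
\otimes M$. -/
theorem exists_mkQ_eq (M : DGMod A) (n m : ℤ) (h : 1 + m = n) (z : Cx.TensorX B.toCx M.toCx n) :
    ∃ (x : M.X n) (y : M.X m), z - (Cx.tmk _ _ 0 n n (zero_add n) B.one x +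
      Cx.tmk _ _ 1 m n h c.e y) ∈ balanced f M n := by
  induction z using Cx.tensor_induction with
  | h0 => exact ⟨0, 0, by simp⟩
  | hadd z z' hz hz' =>
    obtain ⟨x, y, hxy⟩ := hz
    obtain ⟨x', y', hxy'⟩ := hz'
    refine ⟨x + x', y + y', ?_⟩
    convert add_mem hxy hxy' using 1
    simp only [map_add]
    abel
  | hmk i j hij b z =>
    obtain ⟨a, a', rfl⟩ := c.exists_eq i (i - 1) (by ring) b
    refine ⟨M.smul i j n hij a z, M.smul (i - 1) j m (by omega) a' z, ?_⟩
    have h₁ := mem_balanced f M (zero_add i) hij hij (zero_add n) B.one a z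
    have h₂ := mem_balanced f M (by ring : 1 + (i - 1) = i) (by omega : i - 1 + j = m) hij h c.e
      a' z
    rw [B.one_mul] at h₁
    convert add_mem h₁ h₂ using 1
    simp only [map_add, LinearMap.add_apply]
    abel

/-- Any $x$ equals $(x - e\,\pi x) + e\,\pi x$ with $\pi x$ and $x - e\,\pi x$ in the kernel, so $F
= \ker\pi + e\ker\pi$. The sum is direct because $\pi(x + ey) = y$ for $x, y \in \ker\pi$. -/
theorem bijective_kerDerHom_app
    (hππ : ∀ (i j k : ℤ) (hj : j + 1 = i) (hk : k + 1 = j) (x : F.X i),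
      π j k hk (π i j hj x) = 0) (n : ℤ) :
    Function.Bijective ((kerDerHom c hπ hπd).app n) := by
  constructor
  · rw [injective_iff_map_eq_zero]
    intro z hz
    obtain ⟨z, rfl⟩ := Submodule.mkQ_surjective _ z
    obtain ⟨x, y, h⟩ := exists_mkQ_eq c (kerDer c hπ hπd) n (n - 1) (by ring) z
    have hz' := LinearMap.mem_ker.1 (balanced_le_ker_kerDerAct c hπ hπd n h)
    rw [kerDerHom_app_mkQ] at hz
    rw [map_sub, hz, zero_sub, neg_eq_zero, map_add, kerDerAct_tmk, kerDerAct_tmk,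
      F.one_smul] at hz'
    have hy := congrArg (π n (n - 1) (sub_add_cancel n 1)) hz'
    rw [map_add, apply_kerDerIncl, hπ.apply_e_smul c _ (sub_add_cancel (n - 1) 1),
      apply_kerDerIncl, map_zero, map_zero, zero_add, sub_zero] at hy
    obtain rfl : y = 0 := kerDerIncl_injective c hπ hπd _ (hy.trans (map_zero _).symm)
    rw [map_zero, map_zero, add_zero] at hz'
    obtain rfl : x = 0 := kerDerIncl_injective c hπ hπd _ (hz'.trans (map_zero _).symm)
    rw [map_zero, map_zero, add_zero, sub_zero] at h
    exact (Submodule.Quotient.mk_eq_zero _).2 h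
  · intro x
    obtain ⟨y, hy⟩ := exists_kerDerIncl_eq c hπ hπd (sub_add_cancel (n - 1) 1)
      (π n (n - 1) (sub_add_cancel n 1) x) (hππ _ _ _ _ _ x)
    obtain ⟨z, hz⟩ := exists_kerDerIncl_eq c hπ hπd (sub_add_cancel n 1)
      (x - F.smul 1 (n - 1) n (by ring) c.e (π n (n - 1) (sub_add_cancel n 1) x)) (by
        rw [map_sub, hπ.apply_e_smul c _ (sub_add_cancel (n - 1) 1), hππ, map_zero, sub_zero,
          sub_self])
    refine ⟨(balanced f (kerDer c hπ hπd) n).mkQ (Cx.tmk _ _ 0 n n (zero_add n) B.one z +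
      Cx.tmk _ _ 1 (n - 1) n (by ring) c.e y), ?_⟩
    rw [kerDerHom_app_mkQ, map_add, kerDerAct_tmk, kerDerAct_tmk, hy, hz, F.one_smul,
      sub_add_cancel]

end Kernel

theorem Hom.isQuasiIso_of_bijective {M N : DGMod B} {f : M.Hom N}
    (hf : ∀ i, Function.Bijective (f.app i)) : f.IsQuasiIso := by
  refine Hom.isQuasiIso_of (fun i x _ ⟨y, hy⟩ => ?_) fun i y hy => ?_
  · obtain ⟨z, rfl⟩ := (hf (i + 1)).2 y
    refine ⟨z, (hf i).1 ?_⟩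
    rw [f.map_d]
    exact hy
  · obtain ⟨x, rfl⟩ := (hf i).2 y
    refine ⟨x, ?_, by rw [sub_self]; exact zero_mem _⟩
    rw [Cx.mem_cycles _ (sub_add_cancel i 1)] at hy ⊢
    refine (hf (i - 1)).1 ?_
    rw [f.map_d, hy, map_zero]

/-- Quasi-lifting along the adjunction of an exterior variable that kills `t`. -/
theorem isQuasiLiftable_of_contraction [IsNoetherianRing R] {t : R}
    [IsAdicComplete (Ideal.span {t}) R] {f : A.Hom B} (c : DGAlg.Contraction f t)
    (hA : ∀ i, Module.Finite R (A.X i)) (D : DGMod B) (hbounded : D.IsHomologicallyBoundedBelow)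
    (hdegreewise : D.IsHomologicallyDegreewiseFinite) (hExt : ExtVanishes D D 2) :
    IsQuasiLiftable f D := by
  have hB := c.finite hA
  obtain ⟨F, hF, hfin, g, hg⟩ := exists_finite_resolution hB D hbounded
    (finite_H_of_isHomologicallyDegreewiseFinite (hB 0) D hdegreewise)
  obtain ⟨ι, deg, e, hb⟩ := hF.2
  obtain ⟨π, u, v, hπ, hππ, hπd, huv, hvu, he⟩ := exists_isDer_d_eq_zero c hb
    (hExt.exists_homD_eq hF hg)
  -- The basis `e` is killed by the original contraction; its image under the automorphism $v$ is
  -- the one killed by $\pi$.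
  have hb' := hb.map v fun i => Function.bijective_iff_has_inverse.2
    ⟨hApp u i i (add_zero i), huv i, hvu i⟩
  choose e' he' using fun s => exists_kerDerIncl_eq c hπ hπd (sub_add_cancel (deg s) 1) _
    (he s _ _)
  refine ⟨kerDer c hπ hπd, ⟨isBoundedBelow_kerDer c hπ hπd hF.1, ι, deg, e',
    isSemiBasis_kerDer c hπ hπd hb' he e' he'⟩, ?_⟩
  -- The zigzag is $D \leftarrow F \leftarrow B \otimes_A \ker\pi$, the second arrow being an
  -- isomorphism.
  exact .trans _ F _ (.symm _ _ (.rel _ _ ⟨g, hg⟩)) (.symm _ _ (.rel _ _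
    ⟨_, Hom.isQuasiIso_of_bijective (bijective_kerDerHom_app c hπ hπd hππ)⟩))

end DGMod
end Descent

end DG

theorem mainTheorem6 {R : Type*} [CommRing R] [IsNoetherianRing R] (t : R)
    [IsAdicComplete (Ideal.span {t}) R] (A : DG.DGAlg R)
    (hfree : ∀ i : ℤ, Module.Free R (A.X i)) (hfinite : ∀ i : ℤ, Module.Finite R (A.X i))
    (D : DG.DGMod ((DG.DGAlg.koszul t).tensor A))
    (hbounded : D.IsHomologicallyBoundedBelow) (hdegreewise : D.IsHomologicallyDegreewiseFinite)
    (hExt : DG.DGMod.ExtVanishes D D 2) :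
    DG.DGMod.IsQuasiLiftable (DG.DGAlg.tensorInr (DG.DGAlg.koszul t) A) D :=
  DG.DGMod.isQuasiLiftable_of_contraction (DG.DGAlg.koszulContraction t A) hfinite D hbounded
    hdegreewise hExt
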